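/- **Setting.** Let $\kappa,\tau>0$. On $\mathbb R^4_2$ put $\langle u,v\rangle=u_1v_1+u_2v_2-u_3v_3-u_4v_4$, and define $$J_1x=(-x_2,x_1,-x_4,x_3),\quad J_2x=(x_3,-x_4,x_1,-x_2),\quad J_3x=(x_4,x_3,x_2,x_1).$$ Let $\mathbb H^3_{1,\tau}=\{q\in\mathbb R^4_2:\langle q,q\rangle=-4/\kappa\}$ with the Berger-like Lorentzian metric $$g_\tau(U,V)=\langle U,V\rangle+(1-\tau^2)\langle U,X_1\rangle\langle V,X_1\rangle,\qquad X_1(q)=\tfrac{\sqrt\kappa}{2}J_1q,$$ and let $E_1=\tau^{-1}X_1$, $E_2=\tfrac{\sqrt\kappa}2J_2q$, $E_3=\tfrac{\sqrt\kappa}2J_3q$ be its pseudo-orthonormal frame. The wedge product is determined by $E_1\wedge E_2=E_3$, $E_2\wedge E_3=-E_1$, $E_3\wedge E_1=E_2$. A *helix surface* with constant angle function $\nu$ is a smooth surface $M$ immersed in $\mathbb H^3_{1,\tau}$, with position vector $F:M\to\mathbb R^4_2$, oriented by a smooth unit normal field $N$ with $g_\tau(N,N)=\lambda\in\{1,-1\}$,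 for which $\lambda\, g_\tau(N,E_1)$ is constant and equal to $\nu$. Write $T=E_1-\nu N$ for the tangential part of $E_1$, $JT=N\wedge T$, and $B=\nu^2(\tau^2-1)-\lambda$. For real $\xi,\xi_1,\xi_2,\xi_3$ let $A(\xi,\xi_1,\xi_2,\xi_3)$ be the $4\times4$ matrix with rows $r_1,\ J_1r_1,\ r_3,\ J_1r_3$, where $$r_1=(\cosh\xi_1\cos\xi_2,-\cosh\xi_1\sin\xi_2,\sinh\xi_1\cos\xi_3,-\sinh\xi_1\sin\xi_3),\qquad r_3=\sin\xi\,J_2r_1+\cos\xi\,J_3r_1 .$$ Assume from now on $\nu\neq0$ and $B<0$. Put $\alpha=-\frac{\sqrt\kappa}{2}\frac{B}{\lambda\tau}$, $\beta=|\nu|\frac{\sqrt{-\kappa B}}{2}$, and let $\gamma=(\gamma_1,\gamma_2,\gamma_3,\gamma_4)$ be the curve $$\begin{aligned} \gamma_1(x)&=\tfrac{2\sqrt{\lambda+\nu^2}}{\sqrt{-\kappa B}}\cos(\alpha x)\sinh(\beta x),\\ \gamma_2(x)&=\tfrac{2\sqrt{\lambda+\nu^2}}{\sqrt{-\kappa B}}\sin(\alpha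 x)\sinh(\beta x),\\ \gamma_3(x)&=\tfrac{2}{\sqrt\kappa}\cos(\alpha x)\cosh(\beta x)-\tfrac{2\lambda\tau|\nu|}{\sqrt{-\kappa B}}\sin(\alpha x)\sinh(\beta x),\\ \gamma_4(x)&=\tfrac{2}{\sqrt\kappa}\sin(\alpha x)\cosh(\beta x)+\tfrac{2\lambda\tau|\nu|}{\sqrt{-\kappa B}}\cos(\alpha x)\sinh(\beta x). \end{aligned}$$ We say that $F=A(y)\gamma(x)$ *is in helix form* if $A(y)=A(\xi,\xi_1(y),\xi_2(y),\xi_3(y))$ is a one-parameter family of pseudo-orthogonal matrices commuting with $J_1$, with $\xi$ constant and $\xi_1,\xi_2,\xi_3$ smooth functions on an open interval satisfying $$\begin{aligned} &|\nu|\sqrt{\lambda+\nu^2}\,\bigl[2\cos(\xi_2-\xi_3)\,\xi_1'+(\xi_2'+\xi_3')\sin(\xi_2-\xi_3)\sinh(2\xi_1)\bigr]\\ &\quad+2\lambda\tau\nu^2\,\bigl[\cosh^2(\xi_1)\,\xi_2'+\sinh^2(\xi_1)\,\xi_3'\bigr]=0.\qquad(*) \end{aligned}$$ **Theorem (characterization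 for $B<0$).** Let $M$ be a helix surface in $\mathbb H^3_{1,\tau}$ with constant angle function $\nu\ne0$ such that $B<0$. 1. Every point of $M$ has a neighbourhood with local coordinates $(x,y)$ such that $\partial_x=T$, $\partial_y=a\,T+b\,JT$ for some smooth functions $a,b$, and $F(x,y)=A(y)\gamma(x)$ in helix form. 2. In any local coordinates $(x,y)$ on $M$ with $\partial_x=T$, $\partial_y=a\,T+b\,JT$, where $a=-\frac{\lambda\tau}{\sqrt{-B}}\sinh(\eta(y)+\nu\sqrt{-\kappa B}\,x)$ and $b=\cosh(\eta(y)+\nu\sqrt{-\kappa B}\,x)$ for some function $\eta$, one has, near every point of the coordinate domain, $F(x,y)=A(y)\gamma(x)$ in helix form. Conversely, let $\lambda\in\{1,-1\}$, $\nu\neq0$, $B<0$, let $\xi$ be constant and let $\xi_1,\xi_2,\xi_3$ be smooth functions on an open set of $\mathbb R$ satisfying $(*)$. Then $F(x,y)=A(\xi,\xi_1(y),\xi_2(y),\xi_3(y))\,\gamma(x)$, on any open set of the $(x,y)$-plane on which it is defined and is an immersion, is, with a suitable unit normal field $N$ with $g_\tau(N,N)=\lambda$, a helix surface in $\mathbb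 H^3_{1,\tau}$ with constant angle function $\nu$. -/

import Mathlib

open scoped Manifold ContDiff Matrix

noncomputable section

namespace AntiDeSitter

/-! ### The space `ℝ⁴₂`, the paraquaternionic structures and the Berger-like metric -/

/-- The neutral scalar product `x₁y₁ + x₂y₂ - x₃y₃ - x₄y₄` on `ℝ⁴`. -/
def g0 (u v : Fin 4 → ℝ) : ℝ := u 0 * v 0 + u 1 * v 1 - u 2 * v 2 - u 3 * v 3

/-- Left multiplication by the paraquaternion `i`. -/
def J1 : Matrix (Fin 4) (Fin 4) ℝ :=
  !![0, -1, 0, 0; 1, 0, 0, 0; 0, 0, 0, -1; 0, 0, 1, 0]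

/-- Left multiplication by the paraquaternion `j`. -/
def J2 : Matrix (Fin 4) (Fin 4) ℝ :=
  !![0, 0, 1, 0; 0, 0, 0, -1; 1, 0, 0, 0; 0, -1, 0, 0]

/-- Left multiplication by the paraquaternion `k`. -/
def J3 : Matrix (Fin 4) (Fin 4) ℝ :=
  !![0, 0, 0, 1; 0, 0, 1, 0; 0, 1, 0, 0; 1, 0, 0, 0]

/-- The Gram matrix of `g0`. -/
def eps : Matrix (Fin 4) (Fin 4) ℝ := Matrix.diagonal ![1, 1, -1, -1]

/-- The anti-de Sitter space `ℍ³₁(κ/4)`, a hyperquadric of `ℝ⁴₂`. -/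
def adS (κ : ℝ) : Set (Fin 4 → ℝ) := {q | g0 q q = -(4 / κ)}

/-- The hyperbolic Hopf vector field `X₁`. -/
def X1 (κ : ℝ) (q : Fin 4 → ℝ) : Fin 4 → ℝ := (√κ / 2) • (J1 *ᵥ q)

/-- The Berger-like metric `g_τ` at the point `q` (applied to vectors tangent to `adS κ` at `q`). -/
def gτ (κ τ : ℝ) (q u v : Fin 4 → ℝ) : ℝ :=
  g0 u v + (1 - τ ^ 2) * g0 u (X1 κ q) * g0 v (X1 κ q)

/-- The `g_τ`-orthonormal frame: `E₁` is timelike, `E₂`, `E₃` are spacelike. -/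
def E1 (κ τ : ℝ) (q : Fin 4 → ℝ) : Fin 4 → ℝ := τ⁻¹ • X1 κ q

/-- See `E1`. -/
def E2 (κ : ℝ) (q : Fin 4 → ℝ) : Fin 4 → ℝ := (√κ / 2) • (J2 *ᵥ q)

/-- See `E1`. -/
def E3 (κ : ℝ) (q : Fin 4 → ℝ) : Fin 4 → ℝ := (√κ / 2) • (J3 *ᵥ q)

/-- The wedge product of tangent vectors at `q`: the bilinear alternating product with
`E₁ ∧ E₂ = E₃`, `E₂ ∧ E₃ = -E₁`, `E₃ ∧ E₁ = E₂`. The components of `u` in the frame are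
`-g_τ(u, E₁)`, `g_τ(u, E₂)`, `g_τ(u, E₃)`. -/
def wedge (κ τ : ℝ) (q u v : Fin 4 → ℝ) : Fin 4 → ℝ :=
  let c1 : (Fin 4 → ℝ) → ℝ := fun w => -gτ κ τ q w (E1 κ τ q)
  let c2 : (Fin 4 → ℝ) → ℝ := fun w => gτ κ τ q w (E2 κ q)
  let c3 : (Fin 4 → ℝ) → ℝ := fun w => gτ κ τ q w (E3 κ q)
  (c1 u * c2 v - c2 u * c1 v) • E3 κ q
    - (c2 u * c3 v - c3 u * c2 v) • E1 κ τ q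
    + (c3 u * c1 v - c1 u * c3 v) • E2 κ q

/-! ### Helix surfaces -/

/-- `F : M → ℝ⁴₂` is the position vector of a surface immersed in `(ℍ³₁(κ/4), g_τ)`, oriented by
the smooth unit normal field `N` with `g_τ(N, N) = lam`, whose angle function
`lam * g_τ(N, E₁)` is constant, equal to `ν`. -/
structure IsHelixSurface {M : Type*} [TopologicalSpace M]
    [ChartedSpace (EuclideanSpace ℝ (Fin 2)) M]
    (κ τ lam ν : ℝ) (F N : M → (Fin 4 → ℝ)) : Prop where
  smooth : ContMDiff (𝓡 2) 𝓘(ℝ, Fin 4 → ℝ) ∞ F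
  mem : ∀ p, F p ∈ adS κ
  immersion : ∀ p, Function.Injective (mfderiv (𝓡 2) 𝓘(ℝ, Fin 4 → ℝ) F p)
  smooth_normal : ContMDiff (𝓡 2) 𝓘(ℝ, Fin 4 → ℝ) ∞ N
  normal_tangent : ∀ p, g0 (F p) (N p) = 0
  normal_orthogonal : ∀ p (v : TangentSpace (𝓡 2) p),
    gτ κ τ (F p) (mfderiv (𝓡 2) 𝓘(ℝ, Fin 4 → ℝ) F p v) (N p) = 0
  normal_unit : ∀ p, gτ κ τ (F p) (N p) (N p) = lam
  angle : ∀ p, lam * gτ κ τ (F p) (N p) (E1 κ τ (F p)) = ν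

/-- The constant `B = ν²(τ² - 1) - lam`. -/
def helixB (τ lam ν : ℝ) : ℝ := ν ^ 2 * (τ ^ 2 - 1) - lam

/-- For a helix surface: the tangential projection `T = E₁ - ν N` of `E₁`. -/
def tangentT {M : Type*} (κ τ ν : ℝ) (F N : M → (Fin 4 → ℝ)) (p : M) : Fin 4 → ℝ :=
  E1 κ τ (F p) - ν • N p

/-- The rotated field `JT = N ∧ T`. -/
def tangentJT {M : Type*} (κ τ ν : ℝ) (F N : M → (Fin 4 → ℝ)) (p : M) : Fin 4 → ℝ :=
  wedge κ τ (F p) (N p) (tangentT κ τ ν F N p)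

/-- The `i`-th partial derivative of `F` at `p` in the local coordinates `e`. -/
def coordDeriv {M : Type*} [TopologicalSpace M]
    (e : OpenPartialHomeomorph M (EuclideanSpace ℝ (Fin 2))) (F : M → (Fin 4 → ℝ))
    (i : Fin 2) (p : M) : Fin 4 → ℝ :=
  fderiv ℝ (fun z => F (e.symm z)) (e p) (EuclideanSpace.single i 1)

/-- `e = (x, y)` is a system of smooth local coordinates on `M` with `∂ₓ = T` and
`∂_y = a T + b JT` for the smooth functions `a`, `b` of `(x, y)`. -/
structure IsLocalSystem {M : Type*} [TopologicalSpace M]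
    [ChartedSpace (EuclideanSpace ℝ (Fin 2)) M]
    (κ τ ν : ℝ) (F N : M → (Fin 4 → ℝ))
    (e : OpenPartialHomeomorph M (EuclideanSpace ℝ (Fin 2)))
    (a b : EuclideanSpace ℝ (Fin 2) → ℝ) : Prop where
  chart : e ∈ IsManifold.maximalAtlas (𝓡 2) ∞ M
  smooth_a : ContDiffOn ℝ ∞ a e.target
  smooth_b : ContDiffOn ℝ ∞ b e.target
  deriv_x : ∀ p ∈ e.source, coordDeriv e F 0 p = tangentT κ τ ν F N p
  deriv_y : ∀ p ∈ e.source, coordDeriv e F 1 p =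
    a (e p) • tangentT κ τ ν F N p + b (e p) • tangentJT κ τ ν F N p

/-! ### The explicit parametrization for `B < 0` -/

/-- `α = -(√κ / 2) (B / (lam τ))`. -/
def helixAlpha (κ τ lam ν : ℝ) : ℝ := -(√κ / 2) * (helixB τ lam ν / (lam * τ))

/-- `β = |ν| √(-κ B) / 2`. -/
def helixBeta (κ τ lam ν : ℝ) : ℝ := |ν| * (√(-(κ * helixB τ lam ν)) / 2)

/-- The curve `γ`. -/
def helixGamma (κ τ lam ν x : ℝ) : Fin 4 → ℝ :=
  let α := helixAlpha κ τ lam ν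
  let β := helixBeta κ τ lam ν
  let s := 2 * √(lam + ν ^ 2) / √(-(κ * helixB τ lam ν))
  let t := 2 * lam * τ * |ν| / √(-(κ * helixB τ lam ν))
  ![s * Real.cos (α * x) * Real.sinh (β * x),
    s * Real.sin (α * x) * Real.sinh (β * x),
    2 / √κ * Real.cos (α * x) * Real.cosh (β * x) - t * Real.sin (α * x) * Real.sinh (β * x),
    2 / √κ * Real.sin (α * x) * Real.cosh (β * x) + t * Real.cos (α * x) * Real.sinh (β * x)]

/-- First row of the matrix `A(ξ, ξ₁, ξ₂, ξ₃)`. -/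
def row1 (x1 x2 x3 : ℝ) : Fin 4 → ℝ :=
  ![Real.cosh x1 * Real.cos x2, -(Real.cosh x1 * Real.sin x2),
    Real.sinh x1 * Real.cos x3, -(Real.sinh x1 * Real.sin x3)]

/-- Third row of the matrix `A(ξ, ξ₁, ξ₂, ξ₃)`. -/
def row3 (x0 x1 x2 x3 : ℝ) : Fin 4 → ℝ :=
  Real.sin x0 • (J2 *ᵥ row1 x1 x2 x3) + Real.cos x0 • (J3 *ᵥ row1 x1 x2 x3)

/-- The pseudo-orthogonal matrix `A(ξ, ξ₁, ξ₂, ξ₃)` commuting with `J₁`: its rows are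
`r₁`, `J₁ r₁`, `r₃`, `J₁ r₃`. -/
def matA (x0 x1 x2 x3 : ℝ) : Matrix (Fin 4) (Fin 4) ℝ :=
  Matrix.of ![row1 x1 x2 x3, J1 *ᵥ row1 x1 x2 x3, row3 x0 x1 x2 x3, J1 *ᵥ row3 x0 x1 x2 x3]

/-- The differential constraint on `ξ₁`, `ξ₂`, `ξ₃` at the parameter value `y`. -/
def Constraint (τ lam ν : ℝ) (ξ₁ ξ₂ ξ₃ : ℝ → ℝ) (y : ℝ) : Prop :=
  |ν| * √(lam + ν ^ 2) *
      (2 * Real.cos (ξ₂ y - ξ₃ y) * deriv ξ₁ y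
        + (deriv ξ₂ y + deriv ξ₃ y) * Real.sin (ξ₂ y - ξ₃ y) * Real.sinh (2 * ξ₁ y))
    + 2 * lam * τ * ν ^ 2 *
      (Real.cosh (ξ₁ y) ^ 2 * deriv ξ₂ y + Real.sinh (ξ₁ y) ^ 2 * deriv ξ₃ y) = 0

/-- On the set `V ⊆ M`, in the coordinates `e = (x, y)`, the position vector is
`F = A(y) γ(x)`, where `A(y) = A(ξ, ξ₁, ξ₂, ξ₃)(y)` is a smooth one-parameter family of
pseudo-orthogonal matrices commuting with `J₁`, with `ξ` constant and `ξ₁, ξ₂, ξ₃` satisfying the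
constraint. -/
def HasHelixForm {M : Type*} [TopologicalSpace M] (κ τ lam ν : ℝ) (F : M → (Fin 4 → ℝ))
    (e : OpenPartialHomeomorph M (EuclideanSpace ℝ (Fin 2))) (V : Set M) : Prop :=
  ∃ (c d ξ : ℝ) (ξ₁ ξ₂ ξ₃ : ℝ → ℝ),
    ContDiffOn ℝ ∞ ξ₁ (Set.Ioo c d) ∧ ContDiffOn ℝ ∞ ξ₂ (Set.Ioo c d) ∧
    ContDiffOn ℝ ∞ ξ₃ (Set.Ioo c d) ∧
    (∀ y ∈ Set.Ioo c d,
      (matA ξ (ξ₁ y) (ξ₂ y) (ξ₃ y))ᵀ * eps * matA ξ (ξ₁ y) (ξ₂ y) (ξ₃ y) = eps ∧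
      matA ξ (ξ₁ y) (ξ₂ y) (ξ₃ y) * J1 = J1 * matA ξ (ξ₁ y) (ξ₂ y) (ξ₃ y) ∧
      Constraint τ lam ν ξ₁ ξ₂ ξ₃ y) ∧
    ∀ q ∈ V, e q 1 ∈ Set.Ioo c d ∧
      F q = matA ξ (ξ₁ (e q 1)) (ξ₂ (e q 1)) (ξ₃ (e q 1)) *ᵥ helixGamma κ τ lam ν (e q 0)

end AntiDeSitter

end

/-!
Let `r = √κ / 2` and replace the unit normal `N` by its horizontal part `n = N + lam ν E₁`. Then `N`
is a unit normal with constant angle `ν` exactly when `n` is `g0`-orthogonal to `F` and `J₁F`, has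
constant square `lam + ν²`, and `n - lam ν τ r J₁F` is `g0`-orthogonal to the surface
(`normal_iff`, `gτ_normal`). The Berger-like metric disappears, and `T`, `JT` become a combination
of `J₁F` and `n`, respectively `-J₁n` (`horizT_eq`, `wedge_eq`). This is the structure `HelixPatch`.

With `ℝ⁴₂ = ℂ²`, where `J₁` acts as `i`, the horizontal vectors at `F` form a complex line, and `n` is
determined by its complex coordinate, the `phase`, which has constant modulus. Symmetry of the
second derivatives of `F` forces the phase to turn at the constant speed `2 α` along `T`
(`fderiv_n_eq`, `fderiv_phase_T`). So along `T` the position satisfies a linear equation with known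
coefficients, solved by `transport`. The curve `A γ` is the solution starting at `A γ(0)`
(`matA_helixGamma`), and the matrices `A` parametrize all starting points and phases: their
complex entries satisfy `|a|² - |b|² = 1`, and `ξ₁, ξ₂, ξ₃` are hyperbolic polar coordinates for them.

In coordinates with `∂ₓ = T` in which the phase is a function of `x` alone, the starting points form
a curve depending on `y`, and the surface is in helix form (`HelixPatch.hasHelixForm`). The flow
respects the conormal direction (`conormal_transport`), so the orthogonality of the conormal to the
surface holds along a whole line of `T` if and only if it holds at `x = 0`, where it is the
differential constraint (`constraint_iff`). Smoothness of `ξ₁, ξ₂, ξ₃` is delicate where `ξ₁ = 0`,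
since `ξ₃` is then an argument of `0`. But there the curve crosses `b = 0` with non-zero velocity,
because the surface is immersed, and Hadamard's lemma removes the zero
(`exists_hyperbolic_polar`).

Such coordinates exist near every point: `x` is the argument of the phase divided by `2 α`, and `y`
a suitable real component of the starting point (`HelixPatch.exists_coordinates`). If coordinates
with `∂ₓ = T` and `∂_y = a T + b JT` are given, the phase turns along `y` at the speed
`2 α a + ∂ₓb / ν` (`HelixPatch.fderiv_phase_y`), which vanishes for the coefficients in the theorem.

Conversely, on `A(y) γ(x)` the horizontal field with the phase determined by `x` and `ξ` satisfies
all conditions on `n`, by the flow equation along `x` and by the constraint along `y`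
(`helixPatch_of_constraint`).
-/

namespace AntiDeSitter

open ComplexConjugate

/-! ### Smooth polar coordinates along a curve in the plane -/

/-- The averages `∫₀¹ sᵏ g(y₀ + s (y - y₀)) ds` of a smooth function `g` can be differentiated under
the integral sign. -/
lemma hasDerivAt_integral_pow_smul {c d y₀ : ℝ} (hy₀ : y₀ ∈ Set.Ioo c d) {g : ℝ → ℂ}
    (hg : ContDiffOn ℝ ∞ g (Set.Ioo c d)) (k : ℕ) {y : ℝ} (hy : y ∈ Set.Ioo c d) :
    HasDerivAt (fun y => ∫ s in (0 : ℝ)..1, s ^ k • g (y₀ + s * (y - y₀)))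
      (∫ s in (0 : ℝ)..1, s ^ (k + 1) • deriv g (y₀ + s * (y - y₀))) y := by
  have hstar : ∀ y ∈ Set.Ioo c d, ∀ s ∈ Set.Icc (0 : ℝ) 1, y₀ + s * (y - y₀) ∈ Set.Ioo c d := by
    intro y hy s hs
    exact (convex_Ioo c d).add_smul_sub_mem hy₀ hy hs
  have hg' : ContDiffOn ℝ ∞ (deriv g) (Set.Ioo c d) := hg.deriv_of_isOpen isOpen_Ioo (by simp)
  have hcont : ∀ (h : ℝ → ℂ) (j : ℕ), ContDiffOn ℝ ∞ h (Set.Ioo c d) → ContinuousOn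
      (fun p : ℝ × ℝ => p.2 ^ j • h (y₀ + p.2 * (p.1 - y₀))) (Set.Ioo c d ×ˢ Set.Icc 0 1) := by
    intro h j hh
    have h0 : ContinuousOn (fun p : ℝ × ℝ => h (y₀ + p.2 * (p.1 - y₀)))
        (Set.Ioo c d ×ˢ Set.Icc 0 1) := by
      refine hh.continuousOn.comp (f := fun p : ℝ × ℝ => y₀ + p.2 * (p.1 - y₀)) (by fun_prop) ?_
      rintro ⟨y, s⟩ ⟨h1, h2⟩
      exact hstar y h1 s h2
    exact ContinuousOn.smul (f := fun p : ℝ × ℝ => p.2 ^ j) (by fun_prop) h0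
  have hint : ∀ (h : ℝ → ℂ) (j : ℕ), ContDiffOn ℝ ∞ h (Set.Ioo c d) → ∀ y ∈ Set.Ioo c d,
      IntervalIntegrable (fun s => s ^ j • h (y₀ + s * (y - y₀))) MeasureTheory.volume 0 1 := by
    intro h j hh y hy
    apply ContinuousOn.intervalIntegrable
    rw [Set.uIcc_of_le zero_le_one]
    exact (hcont h j hh).comp (f := fun s : ℝ => (y, s)) (by fun_prop) fun s hs => ⟨hy, hs⟩
  obtain ⟨ε, hε, hball⟩ := Metric.isOpen_iff.1 isOpen_Ioo y hy
  have hcb : Metric.closedBall y (ε / 2) ⊆ Set.Ioo c d :=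
    (Metric.closedBall_subset_ball (by linarith)).trans hball
  obtain ⟨C, hC⟩ := ((isCompact_closedBall y (ε / 2)).prod
    (isCompact_Icc (a := (0 : ℝ)) (b := 1))).exists_bound_of_continuousOn
    ((hcont (deriv g) (k + 1) hg').mono (Set.prod_mono hcb subset_rfl))
  refine (intervalIntegral.hasDerivAt_integral_of_dominated_loc_of_deriv_le
    (F := fun y s => s ^ k • g (y₀ + s * (y - y₀)))
    (F' := fun y s => s ^ (k + 1) • deriv g (y₀ + s * (y - y₀))) (bound := fun _ => C)
    (Metric.closedBall_mem_nhds y (half_pos hε)) ?_ (hint g k hg y hy)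
    (intervalIntegrable_iff.1 (hint _ (k + 1) hg' y hy)).aestronglyMeasurable ?_ (by simp) ?_).2
  · filter_upwards [isOpen_Ioo.mem_nhds hy] with x hx
    exact (intervalIntegrable_iff.1 (hint g k hg x hx)).aestronglyMeasurable
  · refine Filter.Eventually.of_forall fun s hs x hx => hC (x, s) ⟨hx, ?_⟩
    rw [Set.uIoc_of_le zero_le_one] at hs
    exact ⟨hs.1.le, hs.2⟩
  · refine Filter.Eventually.of_forall fun s hs x hx => ?_
    rw [Set.uIoc_of_le zero_le_one] at hs
    have hmem := hstar x (hcb hx) s ⟨hs.1.le, hs.2⟩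
    have h1 : HasDerivAt g (deriv g (y₀ + s * (x - y₀))) (y₀ + s * (x - y₀)) :=
      ((hg.contDiffAt (isOpen_Ioo.mem_nhds hmem)).differentiableAt (by simp)).hasDerivAt
    have h2 : HasDerivAt (fun x : ℝ => y₀ + s * (x - y₀)) s x := by
      simpa using (((hasDerivAt_id x).sub_const y₀).const_mul s).const_add y₀
    have h3 := (h1.scomp x h2).const_smul (s ^ k)
    rw [pow_succ, mul_smul]
    exact h3

/-- **Hadamard's lemma** on an interval: a smooth function is `f(y₀) + (y - y₀) u(y)` with `u`
smooth. -/
lemma exists_contDiffOn_eq_add_smul {c d y₀ : ℝ} (hy₀ : y₀ ∈ Set.Ioo c d) {f : ℝ → ℂ}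
    (hf : ContDiffOn ℝ ∞ f (Set.Ioo c d)) :
    ∃ u : ℝ → ℂ, ContDiffOn ℝ ∞ u (Set.Ioo c d) ∧ u y₀ = deriv f y₀ ∧
      ∀ y ∈ Set.Ioo c d, f y = f y₀ + (y - y₀) • u y := by
  have key : ∀ (n k : ℕ) (g : ℝ → ℂ), ContDiffOn ℝ ∞ g (Set.Ioo c d) →
      ContDiffOn ℝ n (fun y => ∫ s in (0 : ℝ)..1, s ^ k • g (y₀ + s * (y - y₀)))
        (Set.Ioo c d) := by
    intro n
    induction n with
    | zero =>
      intro k g hg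
      simp only [CharP.cast_eq_zero, contDiffOn_zero]
      exact fun y hy => (hasDerivAt_integral_pow_smul hy₀ hg k hy).continuousAt.continuousWithinAt
    | succ n ih =>
      intro k g hg
      push_cast
      rw [contDiffOn_succ_iff_deriv_of_isOpen isOpen_Ioo]
      refine ⟨fun y hy => (hasDerivAt_integral_pow_smul hy₀ hg k
        hy).differentiableAt.differentiableWithinAt, by simp, ?_⟩
      exact (ih (k + 1) (deriv g) (hg.deriv_of_isOpen isOpen_Ioo (by simp))).congr
        fun y hy => (hasDerivAt_integral_pow_smul hy₀ hg k hy).deriv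
  have hf' : ContDiffOn ℝ ∞ (deriv f) (Set.Ioo c d) := hf.deriv_of_isOpen isOpen_Ioo (by simp)
  refine ⟨fun y => ∫ s in (0 : ℝ)..1, s ^ 0 • deriv f (y₀ + s * (y - y₀)),
    contDiffOn_infty.2 fun n => key n 0 _ hf', by simp, fun y hy => ?_⟩
  have hstar : ∀ s ∈ Set.uIcc (0 : ℝ) 1, y₀ + s * (y - y₀) ∈ Set.Ioo c d := by
    intro s hs
    rw [Set.uIcc_of_le zero_le_one] at hs
    exact (convex_Ioo c d).add_smul_sub_mem hy₀ hy hs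
  have h := intervalIntegral.integral_eq_sub_of_hasDerivAt
    (f := fun s => f (y₀ + s * (y - y₀)))
    (f' := fun s => (y - y₀) • deriv f (y₀ + s * (y - y₀))) (a := 0) (b := 1)
    (fun s hs => by
      have h1 : HasDerivAt f (deriv f (y₀ + s * (y - y₀))) (y₀ + s * (y - y₀)) :=
        ((hf.contDiffAt (isOpen_Ioo.mem_nhds (hstar s hs))).differentiableAt (by simp)).hasDerivAt
      have h2 : HasDerivAt (fun s : ℝ => y₀ + s * (y - y₀)) (y - y₀) s := by
        simpa using ((hasDerivAt_id s).mul_const (y - y₀)).const_add y₀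
      exact h1.scomp s h2)
    (ContinuousOn.intervalIntegrable
      ((hf'.continuousOn.comp (f := fun s : ℝ => y₀ + s * (y - y₀)) (by fun_prop)
        hstar).const_smul (y - y₀)))
  rw [intervalIntegral.integral_smul] at h
  simp only [pow_zero, one_smul]
  rw [h]
  simp

/-- The point `exp (i t)` of the unit circle. -/
noncomputable def cis (t : ℝ) : ℂ := Complex.exp (t * Complex.I)

/-- A smooth curve in `ℂ` has a smooth argument near a point where it does not vanish. -/
lemma exists_contDiffOn_arg {c d y₀ : ℝ} (hy₀ : y₀ ∈ Set.Ioo c d) {u : ℝ → ℂ}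
    (hu : ContDiffOn ℝ ∞ u (Set.Ioo c d)) (h0 : u y₀ ≠ 0) :
    ∃ (δ : ℝ) (θ : ℝ → ℝ), 0 < δ ∧ Set.Ioo (y₀ - δ) (y₀ + δ) ⊆ Set.Ioo c d ∧
      ContDiffOn ℝ ∞ θ (Set.Ioo (y₀ - δ) (y₀ + δ)) ∧
      ContDiffOn ℝ ∞ (fun y => ‖u y‖) (Set.Ioo (y₀ - δ) (y₀ + δ)) ∧
      ∀ y ∈ Set.Ioo (y₀ - δ) (y₀ + δ), u y ≠ 0 ∧
        u y = ‖u y‖ * cis (θ y) := by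
  have hc : ContinuousAt (fun y => u y / u y₀) y₀ :=
    ((hu.continuousOn.continuousAt (isOpen_Ioo.mem_nhds hy₀)).div_const _)
  have hev : ∀ᶠ y in nhds y₀, u y / u y₀ ∈ Complex.slitPlane :=
    hc.eventually (Complex.isOpen_slitPlane.mem_nhds (by simp [div_self h0]))
  obtain ⟨δ, hδ, hsub⟩ := Metric.eventually_nhds_iff_ball.1
    (hev.and (isOpen_Ioo.eventually_mem hy₀))
  rw [Real.ball_eq_Ioo] at hsub
  have hsub' : Set.Ioo (y₀ - δ) (y₀ + δ) ⊆ Set.Ioo c d := fun y hy => (hsub y hy).2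
  have hne : ∀ y ∈ Set.Ioo (y₀ - δ) (y₀ + δ), u y ≠ 0 := by
    intro y hy h
    have := (hsub y hy).1
    simp [h] at this
  refine ⟨δ, fun y => Complex.arg (u y₀) + (Complex.log (u y / u y₀)).im, hδ, hsub', ?_, ?_, ?_⟩
  · refine contDiffOn_const.add ?_
    refine ContDiff.comp_contDiffOn (𝕜 := ℝ) (g := fun z : ℂ => z.im) Complex.imCLM.contDiff ?_
    intro y hy
    have h1 : ContDiffAt ℝ ∞ Complex.log (u y / u y₀) :=
      (Complex.contDiffAt_log (hsub y hy).1).restrict_scalars ℝ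
    exact h1.comp_contDiffWithinAt y ((hu.mono hsub').div_const _ y hy)
  · exact (hu.mono hsub').norm ℝ hne
  · intro y hy
    refine ⟨hne y hy, ?_⟩
    have h1 := Complex.norm_mul_exp_arg_mul_I (u y / u y₀)
    have h2 := Complex.norm_mul_exp_arg_mul_I (u y₀)
    have h3 : u y = u y₀ * (u y / u y₀) := by field_simp
    simp only [Complex.log_im, cis]
    push_cast
    rw [add_mul, Complex.exp_add]
    calc u y = u y₀ * (u y / u y₀) := h3
      _ = (‖u y₀‖ * ‖u y / u y₀‖ : ℝ) * (Complex.exp (Complex.arg (u y₀) * Complex.I) *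
          Complex.exp (Complex.arg (u y / u y₀) * Complex.I)) := by
        have h4 : u y₀ * (u y / u y₀) = (‖u y₀‖ * Complex.exp (Complex.arg (u y₀) * Complex.I)) *
            (‖u y / u y₀‖ * Complex.exp (Complex.arg (u y / u y₀) * Complex.I)) := by rw [h1, h2]
        rw [h4]
        push_cast; ring
      _ = _ := by rw [← norm_mul, ← h3]

/-- Polar coordinates on the hyperboloid `|a|² - |b|² = 1`, smooth along a curve. The curve may
cross `b = 0`, where the argument of `b` is not defined, provided it does so with non-zero
velocity: the quotient of `b` by the parameter then has a smooth argument. -/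
lemma exists_hyperbolic_polar {c d y₀ : ℝ} (hy₀ : y₀ ∈ Set.Ioo c d) {a b : ℝ → ℂ}
    (ha : ContDiffOn ℝ ∞ a (Set.Ioo c d)) (hb : ContDiffOn ℝ ∞ b (Set.Ioo c d))
    (hab : ∀ y ∈ Set.Ioo c d, Complex.normSq (a y) - Complex.normSq (b y) = 1)
    (hb0 : b y₀ = 0 → deriv b y₀ ≠ 0) :
    ∃ (δ : ℝ) (ξ₁ ξ₂ ξ₃ : ℝ → ℝ), 0 < δ ∧ Set.Ioo (y₀ - δ) (y₀ + δ) ⊆ Set.Ioo c d ∧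
      ContDiffOn ℝ ∞ ξ₁ (Set.Ioo (y₀ - δ) (y₀ + δ)) ∧
      ContDiffOn ℝ ∞ ξ₂ (Set.Ioo (y₀ - δ) (y₀ + δ)) ∧
      ContDiffOn ℝ ∞ ξ₃ (Set.Ioo (y₀ - δ) (y₀ + δ)) ∧
      ∀ y ∈ Set.Ioo (y₀ - δ) (y₀ + δ),
        a y = Real.cosh (ξ₁ y) * cis (ξ₂ y) ∧
        b y = Real.sinh (ξ₁ y) * cis (ξ₃ y) := by
  obtain ⟨h, u, hh, hu, hu0, hbu⟩ : ∃ (h : ℝ → ℝ) (u : ℝ → ℂ), ContDiff ℝ ∞ h ∧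
      ContDiffOn ℝ ∞ u (Set.Ioo c d) ∧ u y₀ ≠ 0 ∧ ∀ y ∈ Set.Ioo c d, b y = h y • u y := by
    by_cases h0 : b y₀ = 0
    · obtain ⟨u, hu, hu0, hbu⟩ := exists_contDiffOn_eq_add_smul hy₀ hb
      refine ⟨fun y => y - y₀, u, by fun_prop, hu, hu0 ▸ hb0 h0, fun y hy => ?_⟩
      rw [hbu y hy, h0, zero_add]
    · exact ⟨fun _ => 1, b, contDiff_const, hb, h0, by simp⟩
  have ha0 : a y₀ ≠ 0 := by
    intro h0
    have h1 := hab y₀ hy₀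
    rw [h0, map_zero] at h1
    linarith [Complex.normSq_nonneg (b y₀)]
  obtain ⟨δ, θ, hδ, hsub, hθ, -, haθ⟩ := exists_contDiffOn_arg hy₀ ha ha0
  obtain ⟨δ', θ', hδ', hsub', hθ', hn, hbθ⟩ := exists_contDiffOn_arg hy₀ hu hu0
  have hm : Set.Ioo (y₀ - min δ δ') (y₀ + min δ δ') ⊆ Set.Ioo (y₀ - δ) (y₀ + δ) :=
    Set.Ioo_subset_Ioo (by linarith [min_le_left δ δ']) (by linarith [min_le_left δ δ'])
  have hm' : Set.Ioo (y₀ - min δ δ') (y₀ + min δ δ') ⊆ Set.Ioo (y₀ - δ') (y₀ + δ') :=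
    Set.Ioo_subset_Ioo (by linarith [min_le_right δ δ']) (by linarith [min_le_right δ δ'])
  refine ⟨min δ δ', fun y => Real.arsinh (h y * ‖u y‖), θ, θ', lt_min hδ hδ', hm.trans hsub,
    Real.contDiff_arsinh.comp_contDiffOn (hh.contDiffOn.mul (hn.mono hm')), hθ.mono hm,
    hθ'.mono hm', fun y hy => ⟨?_, ?_⟩⟩
  · have h1 := hab y (hsub (hm hy))
    have h2 : ‖a y‖ = Real.cosh (Real.arsinh (h y * ‖u y‖)) := by
      rw [Real.cosh_arsinh]
      rw [hbu y (hsub (hm hy)), Complex.normSq_eq_norm_sq, Complex.normSq_eq_norm_sq,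
        norm_smul, mul_pow, Real.norm_eq_abs, sq_abs] at h1
      rw [show 1 + (h y * ‖u y‖) ^ 2 = ‖a y‖ ^ 2 by rw [mul_pow]; linarith,
        Real.sqrt_sq (norm_nonneg _)]
    rw [← h2]
    exact (haθ y (hm hy)).2
  · rw [Real.sinh_arsinh, hbu y (hsub (hm hy)), Complex.real_smul]
    conv_lhs => rw [(hbθ y (hm' hy)).2]
    push_cast; ring

/-! ### Linear algebra of the neutral scalar product -/

/-- The coordinate plane, in which the local coordinates `(x, y)` take their values. -/
abbrev Plane := EuclideanSpace ℝ (Fin 2)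

lemma J1_mulVec (v : Fin 4 → ℝ) : J1 *ᵥ v = ![-v 1, v 0, -v 3, v 2] := by
  ext i; fin_cases i <;> simp [J1, Matrix.mulVec, dotProduct, Fin.sum_univ_four]

lemma J2_mulVec (v : Fin 4 → ℝ) : J2 *ᵥ v = ![v 2, -v 3, v 0, -v 1] := by
  ext i; fin_cases i <;> simp [J2, Matrix.mulVec, dotProduct, Fin.sum_univ_four]

lemma J3_mulVec (v : Fin 4 → ℝ) : J3 *ᵥ v = ![v 3, v 2, v 1, v 0] := by
  ext i; fin_cases i <;> simp [J3, Matrix.mulVec, dotProduct, Fin.sum_univ_four]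

lemma J1_J1 (v : Fin 4 → ℝ) : J1 *ᵥ (J1 *ᵥ v) = -v := by
  ext i; fin_cases i <;> simp [J1_mulVec]

lemma g0_comm (u v : Fin 4 → ℝ) : g0 u v = g0 v u := by simp only [g0]; ring

lemma g0_add_left (u v w : Fin 4 → ℝ) : g0 (u + v) w = g0 u w + g0 v w := by
  simp only [g0, Pi.add_apply]; ring

lemma g0_sub_left (u v w : Fin 4 → ℝ) : g0 (u - v) w = g0 u w - g0 v w := by
  simp only [g0, Pi.sub_apply]; ring

lemma g0_neg_left (u w : Fin 4 → ℝ) : g0 (-u) w = -g0 u w := by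
  simp only [g0, Pi.neg_apply]; ring

lemma g0_smul_left (c : ℝ) (u w : Fin 4 → ℝ) : g0 (c • u) w = c * g0 u w := by
  simp only [g0, Pi.smul_apply, smul_eq_mul]; ring

lemma g0_add_right (u v w : Fin 4 → ℝ) : g0 u (v + w) = g0 u v + g0 u w := by
  simp only [g0, Pi.add_apply]; ring

lemma g0_sub_right (u v w : Fin 4 → ℝ) : g0 u (v - w) = g0 u v - g0 u w := by
  simp only [g0, Pi.sub_apply]; ring

lemma g0_neg_right (u w : Fin 4 → ℝ) : g0 u (-w) = -g0 u w := by
  simp only [g0, Pi.neg_apply]; ring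

lemma g0_smul_right (c : ℝ) (u w : Fin 4 → ℝ) : g0 u (c • w) = c * g0 u w := by
  simp only [g0, Pi.smul_apply, smul_eq_mul]; ring

lemma g0_J1_J1 (u v : Fin 4 → ℝ) : g0 (J1 *ᵥ u) (J1 *ᵥ v) = g0 u v := by
  simp only [g0, J1_mulVec]; simp; ring

lemma g0_J1_left (u v : Fin 4 → ℝ) : g0 (J1 *ᵥ u) v = -g0 u (J1 *ᵥ v) := by
  simp only [g0, J1_mulVec]; simp; ring

lemma g0_J1_self (u : Fin 4 → ℝ) : g0 u (J1 *ᵥ u) = 0 := by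
  simp only [g0, J1_mulVec]; simp; ring

/-- Expansion of a vector in the `g0`-orthogonal basis `f, J₁f, n, J₁n`. -/
lemma orthogonal_expansion {r L : ℝ} (hL : L ≠ 0) {f n : Fin 4 → ℝ}
    (hff : r ^ 2 * g0 f f = -1) (hfn : g0 f n = 0) (hjfn : g0 f (J1 *ᵥ n) = 0)
    (hnn : g0 n n = L) (v : Fin 4 → ℝ) :
    v = -(r ^ 2 * g0 v f) • f - (r ^ 2 * g0 v (J1 *ᵥ f)) • (J1 *ᵥ f)
      + (g0 v n / L) • n + (g0 v (J1 *ᵥ n) / L) • (J1 *ᵥ n) := by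
  -- If `R` has rows `f, J₁f, n, J₁n`, orthogonality gives a right inverse of `R`, and the
  -- expansion says that it is also a left inverse.
  let R : Matrix (Fin 4) (Fin 4) ℝ := Matrix.of ![f, J1 *ᵥ f, n, J1 *ᵥ n]
  let S : Matrix (Fin 4) (Fin 4) ℝ := eps * Rᵀ * Matrix.diagonal ![-r ^ 2, -r ^ 2, L⁻¹, L⁻¹]
  have hRS : R * S = 1 := by
    have hS : ∀ i j, (R * S) i j = g0 (R i) (R j) * (![-r ^ 2, -r ^ 2, L⁻¹, L⁻¹] : Fin 4 → ℝ) j := by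
      intro i j
      simp only [S, ← Matrix.mul_assoc]
      rw [Matrix.mul_diagonal]
      congr 1
      simp only [eps, Matrix.mul_apply, Matrix.diagonal_apply, Fin.sum_univ_four, g0,
        Matrix.transpose_apply]
      simp
      ring
    have hr0 : R 0 = f := rfl
    have hr1 : R 1 = J1 *ᵥ f := rfl
    have hr2 : R 2 = n := rfl
    have hr3 : R 3 = J1 *ᵥ n := rfl
    have hnf : g0 n f = 0 := by rw [g0_comm, hfn]
    have hnjf : g0 n (J1 *ᵥ f) = 0 := by rw [g0_comm, g0_J1_left, hjfn, neg_zero]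
    ext i j
    rw [hS]
    fin_cases i <;> fin_cases j <;>
      simp [-Matrix.mulVec_mulVec, hr0, hr1, hr2, hr3, g0_J1_left, J1_J1, g0_neg_right,
        g0_J1_self, hfn, hjfn, hnf, hnjf, hnn, hL] <;>
      linarith
  have hSR : S * R = 1 := mul_eq_one_comm.1 hRS
  have h : v = v ᵥ* S ᵥ* R := by rw [Matrix.vecMul_vecMul, hSR, Matrix.vecMul_one]
  have hvS : ∀ j, (v ᵥ* S) j = g0 v (R j) * (![-r ^ 2, -r ^ 2, L⁻¹, L⁻¹] : Fin 4 → ℝ) j := by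
    intro j
    simp only [S]
    rw [← Matrix.vecMul_vecMul, Matrix.vecMul_diagonal]
    congr 1
    simp only [Matrix.vecMul, dotProduct, eps, Matrix.mul_apply,
      Matrix.diagonal_apply, Fin.sum_univ_four, g0, Matrix.transpose_apply]
    simp
    ring
  conv_lhs => rw [h]
  ext i
  simp only [Matrix.vecMul, dotProduct, Fin.sum_univ_four] at hvS ⊢
  rw [hvS, hvS, hvS, hvS, show R 0 = f from rfl, show R 1 = J1 *ᵥ f from rfl,
    show R 2 = n from rfl, show R 3 = J1 *ᵥ n from rfl]
  simp [-Matrix.mulVec_mulVec]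
  ring

/-! ### Local description of helix surfaces -/

/-- A surface patch `f : U → ℝ⁴₂` in the quadric `r² ⟨f, f⟩ = -1` together with the horizontal part
`n` of its normal field: `n` is `g0`-orthogonal to `f` and to the Hopf direction `J₁f`, has constant
square `lam + ν²`, and `n - lam ν τ r J₁f` spans the `g0`-orthogonal complement of the tangent
plane. With `r = √κ / 2` and `n = N + lam ν E₁` this says that the patch is a helix surface, up to
its being an immersion. -/
structure HelixPatch (r τ lam ν : ℝ) (U : Set Plane) (f n : Plane → Fin 4 → ℝ) : Prop where
  isOpen : IsOpen U
  smooth_f : ContDiffOn ℝ ∞ f U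
  smooth_n : ContDiffOn ℝ ∞ n U
  quadric : ∀ z ∈ U, r ^ 2 * g0 (f z) (f z) = -1
  orthogonal : ∀ z ∈ U, g0 (f z) (n z) = 0
  orthogonal_J1 : ∀ z ∈ U, g0 (f z) (J1 *ᵥ n z) = 0
  unit : ∀ z ∈ U, g0 (n z) (n z) = lam + ν ^ 2
  tangent : ∀ z ∈ U, ∀ v, g0 (fderiv ℝ f z v) (n z - (lam * ν * τ * r) • (J1 *ᵥ f z)) = 0

/-- The field `T = E₁ - ν N`, in terms of the position `f` and the horizontal part `n` of `N`. -/
noncomputable def horizT (r τ lam ν : ℝ) (f n : Fin 4 → ℝ) : Fin 4 → ℝ :=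
  (lam * (lam + ν ^ 2) * r / τ) • (J1 *ᵥ f) - ν • n

lemma HasDerivAt.g0 {u v : ℝ → Fin 4 → ℝ} {u' v' : Fin 4 → ℝ} {t : ℝ}
    (hu : HasDerivAt u u' t) (hv : HasDerivAt v v' t) :
    HasDerivAt (fun t => g0 (u t) (v t)) (g0 u' (v t) + g0 (u t) v') t := by
  have hu' := hasDerivAt_pi.1 hu
  have hv' := hasDerivAt_pi.1 hv
  have h := ((((hu' 0).mul (hv' 0)).add ((hu' 1).mul (hv' 1))).sub ((hu' 2).mul (hv' 2))).sub
    ((hu' 3).mul (hv' 3))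
  refine h.congr_deriv ?_
  simp only [AntiDeSitter.g0]
  ring

/-- A smooth function restricted to a line. -/
lemma hasDerivAt_line {G : Type*} [NormedAddCommGroup G] [NormedSpace ℝ G] {U : Set Plane}
    (hU : IsOpen U) {u : Plane → G} (hu : ContDiffOn ℝ ∞ u U) {z : Plane} (hz : z ∈ U) (v : Plane) :
    HasDerivAt (fun t : ℝ => u (z + t • v)) (fderiv ℝ u z v) 0 :=
  ((hu.contDiffAt (hU.mem_nhds hz)).differentiableAt (by simp)).hasFDerivAt.hasLineDerivAt v

lemma eventually_line_mem {U : Set Plane} (hU : IsOpen U) {z : Plane} (hz : z ∈ U) (v : Plane) :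
    ∀ᶠ t : ℝ in nhds 0, z + t • v ∈ U := by
  have : ContinuousAt (fun t : ℝ => z + t • v) 0 := by fun_prop
  exact this.eventually (hU.mem_nhds (by simpa using hz))

/-- The product rule for a constant scalar product. -/
lemma g0_fderiv_of_const {U : Set Plane} (hU : IsOpen U) {u w : Plane → Fin 4 → ℝ}
    (hu : ContDiffOn ℝ ∞ u U) (hw : ContDiffOn ℝ ∞ w U) {c : ℝ}
    (h : ∀ z ∈ U, g0 (u z) (w z) = c) {z : Plane} (hz : z ∈ U) (v : Plane) :
    g0 (fderiv ℝ u z v) (w z) + g0 (u z) (fderiv ℝ w z v) = 0 := by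
  have h1 := HasDerivAt.g0 (hasDerivAt_line hU hu hz v) (hasDerivAt_line hU hw hz v)
  have h2 : HasDerivAt (fun t : ℝ => g0 (u (z + t • v)) (w (z + t • v))) 0 0 :=
    (hasDerivAt_const 0 c).congr_of_eventuallyEq
      ((eventually_line_mem hU hz v).mono fun t ht => h _ ht)
  simpa using h1.unique h2

/-- `J₁` as a continuous linear map. -/
noncomputable def J1L : (Fin 4 → ℝ) →L[ℝ] (Fin 4 → ℝ) :=
  LinearMap.toContinuousLinearMap (Matrix.mulVecLin J1)

lemma contDiffOn_J1 {U : Set Plane} {u : Plane → Fin 4 → ℝ} (hu : ContDiffOn ℝ ∞ u U) :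
    ContDiffOn ℝ ∞ (fun z => J1 *ᵥ u z) U := J1L.contDiff.comp_contDiffOn hu

lemma fderiv_J1 {u : Plane → Fin 4 → ℝ} {z : Plane} (hu : DifferentiableAt ℝ u z) (v : Plane) :
    fderiv ℝ (fun z => J1 *ᵥ u z) z v = J1 *ᵥ fderiv ℝ u z v := by
  have := (J1L.hasFDerivAt.comp z hu.hasFDerivAt).fderiv
  exact congrArg (fun A => A v) this

lemma contDiffOn_fderiv_apply {G : Type*} [NormedAddCommGroup G] [NormedSpace ℝ G] {U : Set Plane}
    (hU : IsOpen U) {u : Plane → G} (hu : ContDiffOn ℝ ∞ u U) (v : Plane) :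
    ContDiffOn ℝ ∞ (fun z => fderiv ℝ u z v) U :=
  (hu.fderiv_of_isOpen hU (by simp)).clm_apply contDiffOn_const

lemma fderiv_fderiv_comm {G : Type*} [NormedAddCommGroup G] [NormedSpace ℝ G] {U : Set Plane}
    (hU : IsOpen U) {u : Plane → G} (hu : ContDiffOn ℝ ∞ u U) {z : Plane} (hz : z ∈ U)
    (v w : Plane) :
    fderiv ℝ (fun z => fderiv ℝ u z v) z w = fderiv ℝ (fun z => fderiv ℝ u z w) z v := by
  have hs : IsSymmSndFDerivAt ℝ u z :=
    (hu.contDiffAt (hU.mem_nhds hz)).isSymmSndFDerivAt (by simp; exact WithTop.coe_le_coe.2 le_top)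
  have hd : DifferentiableAt ℝ (fderiv ℝ u) z :=
    ((hu.fderiv_of_isOpen hU (m := ∞) (by simp)).contDiffAt (hU.mem_nhds hz)).differentiableAt
      (by simp)
  have h : ∀ v w, fderiv ℝ (fun z => fderiv ℝ u z v) z w = fderiv ℝ (fderiv ℝ u) z w v := by
    intro v w
    rw [fderiv_clm_apply hd (differentiableAt_const v)]
    simp
  rw [h, h, hs]

namespace HelixPatch

variable {r τ lam ν : ℝ} {U : Set Plane} {f n : Plane → Fin 4 → ℝ}

lemma differentiableAt_f (h : HelixPatch r τ lam ν U f n) {z : Plane} (hz : z ∈ U) :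
    DifferentiableAt ℝ f z :=
  (h.smooth_f.contDiffAt (h.isOpen.mem_nhds hz)).differentiableAt (by simp)

lemma differentiableAt_n (h : HelixPatch r τ lam ν U f n) {z : Plane} (hz : z ∈ U) :
    DifferentiableAt ℝ n z :=
  (h.smooth_n.contDiffAt (h.isOpen.mem_nhds hz)).differentiableAt (by simp)

lemma g0_fderiv_f (h : HelixPatch r τ lam ν U f n) (hr : r ≠ 0) {z : Plane} (hz : z ∈ U)
    (v : Plane) : g0 (fderiv ℝ f z v) (f z) = 0 := by
  have h1 := g0_fderiv_of_const h.isOpen h.smooth_f h.smooth_f (c := -1 / r ^ 2)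
    (fun z hz => by rw [← h.quadric z hz]; field_simp) hz v
  rw [g0_comm (f z)] at h1
  linarith

lemma g0_fderiv_n_f (h : HelixPatch r τ lam ν U f n) {z : Plane} (hz : z ∈ U) (v : Plane) :
    g0 (fderiv ℝ n z v) (f z) = -g0 (fderiv ℝ f z v) (n z) := by
  have h1 := g0_fderiv_of_const h.isOpen h.smooth_f h.smooth_n h.orthogonal hz v
  rw [g0_comm (f z)] at h1
  linarith

lemma g0_fderiv_n_J1f (h : HelixPatch r τ lam ν U f n) {z : Plane} (hz : z ∈ U) (v : Plane) :
    g0 (fderiv ℝ n z v) (J1 *ᵥ f z) = g0 (fderiv ℝ f z v) (J1 *ᵥ n z) := by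
  have h1 := g0_fderiv_of_const h.isOpen h.smooth_f (contDiffOn_J1 h.smooth_n)
    h.orthogonal_J1 hz v
  rw [fderiv_J1 (h.differentiableAt_n hz), ← neg_eq_iff_eq_neg.2 (g0_J1_left (f z) _),
    g0_comm (J1 *ᵥ f z)] at h1
  linarith

lemma g0_fderiv_n (h : HelixPatch r τ lam ν U f n) {z : Plane} (hz : z ∈ U) (v : Plane) :
    g0 (fderiv ℝ n z v) (n z) = 0 := by
  have h1 := g0_fderiv_of_const h.isOpen h.smooth_n h.smooth_n h.unit hz v
  rw [g0_comm (n z)] at h1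
  linarith

lemma g0_fderiv_f_n (h : HelixPatch r τ lam ν U f n) {z : Plane} (hz : z ∈ U) (v : Plane) :
    g0 (fderiv ℝ f z v) (n z) = lam * ν * τ * r * g0 (fderiv ℝ f z v) (J1 *ᵥ f z) := by
  have h1 := h.tangent z hz v
  rw [g0_sub_right, g0_smul_right] at h1
  linarith

/-- The tangent plane is spanned by `T` and `JT = -J₁n`. -/
lemma fderiv_f_eq (h : HelixPatch r τ lam ν U f n) (hr : r ≠ 0) (hτ : τ ≠ 0)
    (hlam : lam ^ 2 = 1) (hν : ν ≠ 0) (hL : lam + ν ^ 2 ≠ 0) {z : Plane} (hz : z ∈ U) (v : Plane) :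
    fderiv ℝ f z v =
      -(g0 (fderiv ℝ f z v) (n z) / (ν * (lam + ν ^ 2))) • horizT r τ lam ν (f z) (n z)
      + -(g0 (fderiv ℝ f z v) (J1 *ᵥ n z) / (lam + ν ^ 2)) • -(J1 *ᵥ n z) := by
  have hlam0 : lam ≠ 0 := by rintro rfl; simp at hlam
  have h1 := orthogonal_expansion hL (h.quadric z hz) (h.orthogonal z hz) (h.orthogonal_J1 z hz)
    (h.unit z hz) (fderiv ℝ f z v)
  rw [h.g0_fderiv_f hr hz v] at h1
  have h2 := h.g0_fderiv_f_n hz v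
  have h3 : g0 (fderiv ℝ f z v) (n z) / (ν * (lam + ν ^ 2)) *
      (lam * (lam + ν ^ 2) * r / τ) = r ^ 2 * g0 (fderiv ℝ f z v) (J1 *ᵥ f z) := by
    rw [h2]; field_simp; rw [hlam]; ring
  have h4 : g0 (fderiv ℝ f z v) (n z) / (ν * (lam + ν ^ 2)) * ν =
      g0 (fderiv ℝ f z v) (n z) / (lam + ν ^ 2) := by field_simp
  conv_lhs => rw [h1]
  rw [horizT, smul_sub, smul_smul, smul_smul, neg_mul, neg_mul, h3, h4]
  simp only [mul_zero, neg_zero, zero_smul, neg_smul, smul_neg]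
  abel

/-- Symmetry of the second derivative of `f`, paired with the conormal `n - lam ν τ r J₁f`: this
is the symmetry of the second fundamental form. -/
lemma g0_fderiv_symm (h : HelixPatch r τ lam ν U f n) {z : Plane} (hz : z ∈ U) (v w : Plane) :
    g0 (fderiv ℝ f z v) (fderiv ℝ n z w - (lam * ν * τ * r) • (J1 *ᵥ fderiv ℝ f z w)) =
      g0 (fderiv ℝ f z w) (fderiv ℝ n z v - (lam * ν * τ * r) • (J1 *ᵥ fderiv ℝ f z v)) := by
  have hm : ContDiffOn ℝ ∞ (fun z => n z - (lam * ν * τ * r) • (J1 *ᵥ f z)) U :=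
    h.smooth_n.sub ((contDiffOn_J1 h.smooth_f).const_smul _)
  have key : ∀ v w, g0 (fderiv ℝ (fun z => fderiv ℝ f z v) z w)
      (n z - (lam * ν * τ * r) • (J1 *ᵥ f z)) + g0 (fderiv ℝ f z v) (fderiv ℝ n z w -
        (lam * ν * τ * r) • (J1 *ᵥ fderiv ℝ f z w)) = 0 := by
    intro v w
    have h1 := g0_fderiv_of_const h.isOpen (contDiffOn_fderiv_apply h.isOpen h.smooth_f v) hm
      (fun z hz => h.tangent z hz v) hz w
    have h2 : fderiv ℝ (fun z => n z - (lam * ν * τ * r) • (J1 *ᵥ f z)) z w =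
        fderiv ℝ n z w - (lam * ν * τ * r) • (J1 *ᵥ fderiv ℝ f z w) := by
      have hJ : DifferentiableAt ℝ (fun z => J1 *ᵥ f z) z :=
        ((contDiffOn_J1 h.smooth_f).contDiffAt (h.isOpen.mem_nhds hz)).differentiableAt (by simp)
      rw [fderiv_fun_sub (h.differentiableAt_n hz) (hJ.fun_const_smul (lam * ν * τ * r)),
        fderiv_fun_const_smul hJ]
      simp [fderiv_J1 (h.differentiableAt_f hz)]
    rwa [h2] at h1
  have h1 := key v w
  have h2 := key w v
  rw [fderiv_fderiv_comm h.isOpen h.smooth_f hz w v] at h2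
  linarith

/-- The derivative of the horizontal part of the normal along `T`. -/
lemma fderiv_n_eq (h : HelixPatch r τ lam ν U f n)
    (hL : lam + ν ^ 2 ≠ 0) {z : Plane} (hz : z ∈ U) {v w : Plane}
    (hv : fderiv ℝ f z v = horizT r τ lam ν (f z) (n z)) (hw : fderiv ℝ f z w = -(J1 *ᵥ n z)) :
    fderiv ℝ n z v = -(ν * (lam + ν ^ 2) * r ^ 2) • f z
      + (lam * (lam + ν ^ 2) * r / τ - 2 * ν * (lam * ν * τ * r)) • (J1 *ᵥ n z) := by
  have hfn := h.orthogonal z hz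
  have hnf : g0 (n z) (f z) = 0 := by rw [g0_comm, hfn]
  have hfJn := h.orthogonal_J1 z hz
  have hJnf : g0 (J1 *ᵥ n z) (f z) = 0 := by rw [g0_comm, hfJn]
  have hJfn : g0 (J1 *ᵥ f z) (n z) = 0 := by rw [g0_J1_left, hfJn, neg_zero]
  have hnJf : g0 (n z) (J1 *ᵥ f z) = 0 := by rw [g0_comm, hJfn]
  have hnn := h.unit z hz
  have h1 := orthogonal_expansion hL (h.quadric z hz) hfn hfJn hnn (fderiv ℝ n z v)
  have a1 : g0 (fderiv ℝ n z v) (f z) = ν * (lam + ν ^ 2) := by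
    rw [h.g0_fderiv_n_f hz, hv, horizT, g0_sub_left, g0_smul_left, g0_smul_left, hJfn, hnn]; ring
  have a2 : g0 (fderiv ℝ n z v) (J1 *ᵥ f z) = 0 := by
    rw [h.g0_fderiv_n_J1f hz, hv, horizT, g0_sub_left, g0_smul_left, g0_smul_left, g0_J1_J1,
      hfn, g0_J1_self]; ring
  have a3 : g0 (fderiv ℝ n z v) (J1 *ᵥ n z) = 
      (lam + ν ^ 2) * (lam * (lam + ν ^ 2) * r / τ - 2 * ν * (lam * ν * τ * r)) := by
    have hs := h.g0_fderiv_symm hz w v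
    have b1 : g0 (fderiv ℝ n z w) (J1 *ᵥ f z) = -(lam + ν ^ 2) := by
      rw [h.g0_fderiv_n_J1f hz, hw, g0_neg_left, g0_J1_J1, hnn]
    have b2 : g0 (n z) (fderiv ℝ n z w) = 0 := by rw [g0_comm, h.g0_fderiv_n hz]
    rw [hw, hv, horizT, g0_comm (-(J1 *ᵥ n z)), g0_comm _ (fderiv ℝ n z w - _)] at hs
    simp only [Matrix.mulVec_sub, Matrix.mulVec_smul, Matrix.mulVec_neg, J1_J1, g0_sub_left,
      g0_sub_right, g0_neg_left, g0_neg_right, g0_smul_left, g0_smul_right, g0_J1_J1, hnJf,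
      hfJn, hnn, b1, b2, g0_comm (fderiv ℝ n z w) (n z)] at hs
    linear_combination -hs
  rw [h1, a1, a2, a3, h.g0_fderiv_n hz]
  rw [mul_div_cancel_left₀ _ hL]
  simp only [mul_zero, zero_smul, zero_div]
  ext i
  simp only [Pi.add_apply, Pi.sub_apply, Pi.smul_apply, smul_eq_mul, Pi.zero_apply]
  ring

end HelixPatch

/-! ### Complex coordinates -/

/-- The first complex coordinate `x₁ + i x₂` of `ℝ⁴ = ℂ²`, on which `J₁` acts as multiplication by
`i`. -/
noncomputable def zA : (Fin 4 → ℝ) →L[ℝ] ℂ := LinearMap.toContinuousLinearMap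
  { toFun := fun v => ⟨v 0, v 1⟩
    map_add' := fun _ _ => rfl
    map_smul' := fun c v => by simp [Complex.ext_iff] }

/-- The second complex coordinate `x₃ + i x₄`. -/
noncomputable def zB : (Fin 4 → ℝ) →L[ℝ] ℂ := LinearMap.toContinuousLinearMap
  { toFun := fun v => ⟨v 2, v 3⟩
    map_add' := fun _ _ => rfl
    map_smul' := fun c v => by simp [Complex.ext_iff] }

lemma zA_apply (v : Fin 4 → ℝ) : zA v = ⟨v 0, v 1⟩ := rfl

lemma zB_apply (v : Fin 4 → ℝ) : zB v = ⟨v 2, v 3⟩ := rfl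

lemma zA_J1 (v : Fin 4 → ℝ) : zA (J1 *ᵥ v) = Complex.I * zA v := by
  simp [zA_apply, J1_mulVec, Complex.ext_iff]

lemma zB_J1 (v : Fin 4 → ℝ) : zB (J1 *ᵥ v) = Complex.I * zB v := by
  simp [zB_apply, J1_mulVec, Complex.ext_iff]

lemma ext_zA_zB {u v : Fin 4 → ℝ} (hA : zA u = zA v) (hB : zB u = zB v) : u = v := by
  simp only [zA_apply, zB_apply, Complex.ext_iff] at hA hB
  ext i
  fin_cases i
  exacts [hA.1, hA.2, hB.1, hB.2]

/-- The Hermitian form of signature `(1, 1)` has real part `g0`. -/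
lemma hermitian_eq (u v : Fin 4 → ℝ) :
    zA u * conj (zA v) - zB u * conj (zB v) = g0 u v + g0 u (J1 *ᵥ v) * Complex.I := by
  simp only [zA_apply, zB_apply, g0, J1_mulVec]
  apply Complex.ext <;> simp <;> ring

/-- The complex number `c` for which the horizontal vector `n` at `f` is `c` times `E₂`,
where `i` acts as `J₁`. -/
noncomputable def phase (r : ℝ) (f n : Fin 4 → ℝ) : ℂ := r * (zB f * zA n - zA f * zB n)

lemma horizontal_eq {r : ℝ} {f n : Fin 4 → ℝ} (hff : r ^ 2 * g0 f f = -1) (hfn : g0 f n = 0)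
    (hfJn : g0 f (J1 *ᵥ n) = 0) :
    zA n = phase r f n * r * conj (zB f) ∧ zB n = phase r f n * r * conj (zA f) := by
  have h1 := hermitian_eq f f
  have h2 := congrArg conj (hermitian_eq f n)
  rw [g0_J1_self] at h1
  rw [hfn, hfJn] at h2
  simp only [map_sub, map_mul, Complex.conj_conj, Complex.ofReal_zero, zero_mul, add_zero,
    map_zero] at h1 h2
  have h3 : (r : ℂ) ^ 2 * (g0 f f : ℝ) = -1 := by exact_mod_cast hff
  rw [← h1] at h3
  simp only [phase]
  constructor
  · linear_combination zA n * h3 - (r : ℂ) ^ 2 * zA f * h2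
  · linear_combination zB n * h3 - (r : ℂ) ^ 2 * zB f * h2

lemma normSq_phase {r : ℝ} {f n : Fin 4 → ℝ} (hff : r ^ 2 * g0 f f = -1) (hfn : g0 f n = 0)
    (hfJn : g0 f (J1 *ᵥ n) = 0) : Complex.normSq (phase r f n) = g0 n n := by
  obtain ⟨hA, hB⟩ := horizontal_eq hff hfn hfJn
  have h1 := hermitian_eq f f
  have h2 := hermitian_eq n n
  rw [g0_J1_self] at h1 h2
  have h3 : (r : ℂ) ^ 2 * (g0 f f : ℝ) = -1 := by exact_mod_cast hff
  apply Complex.ofReal_injective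
  rw [← Complex.mul_conj]
  simp only [Complex.ofReal_zero, zero_mul, add_zero] at h1 h2
  rw [← h2]
  rw [← h1] at h3
  rw [hA, hB]
  simp only [map_mul, Complex.conj_conj, Complex.conj_ofReal]
  linear_combination (phase r f n * conj (phase r f n)) * h3

namespace HelixPatch

variable {r τ lam ν : ℝ} {U : Set Plane} {f n : Plane → Fin 4 → ℝ}

lemma contDiffOn_phase (h : HelixPatch r τ lam ν U f n) :
    ContDiffOn ℝ ∞ (fun z => phase r (f z) (n z)) U := by
  have h1 := zA.contDiff.comp_contDiffOn h.smooth_f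
  have h2 := zB.contDiff.comp_contDiffOn h.smooth_f
  have h3 := zA.contDiff.comp_contDiffOn h.smooth_n
  have h4 := zB.contDiff.comp_contDiffOn h.smooth_n
  exact contDiffOn_const.mul ((h2.mul h3).sub (h1.mul h4))

/-- The derivative of the phase of the horizontal normal. -/
lemma fderiv_phase (h : HelixPatch r τ lam ν U f n) (hr : r ≠ 0) (hL : lam + ν ^ 2 ≠ 0)
    {z : Plane} (hz : z ∈ U) (v : Plane) :
    fderiv ℝ (fun z => phase r (f z) (n z)) z v =
      Complex.I * ((g0 (fderiv ℝ n z v) (J1 *ᵥ n z) / (lam + ν ^ 2)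
        - r ^ 2 * g0 (fderiv ℝ f z v) (J1 *ᵥ f z) : ℝ) : ℂ) * phase r (f z) (n z) := by
  have hf := hasDerivAt_line h.isOpen h.smooth_f hz v
  have hn := hasDerivAt_line h.isOpen h.smooth_n hz v
  have h1 := (zA.hasFDerivAt.comp_hasDerivAt (0 : ℝ) hf)
  have h2 := (zB.hasFDerivAt.comp_hasDerivAt (0 : ℝ) hf)
  have h3 := (zA.hasFDerivAt.comp_hasDerivAt (0 : ℝ) hn)
  have h4 := (zB.hasFDerivAt.comp_hasDerivAt (0 : ℝ) hn)
  have h5 := ((h2.mul h3).sub (h1.mul h4)).const_mul (r : ℂ)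
  rw [(hasDerivAt_line h.isOpen h.contDiffOn_phase hz v).unique h5]
  simp only [Function.comp_apply, zero_smul, add_zero]
  have e1 := orthogonal_expansion hL (h.quadric z hz) (h.orthogonal z hz) (h.orthogonal_J1 z hz)
    (h.unit z hz) (fderiv ℝ f z v)
  have e2 := orthogonal_expansion hL (h.quadric z hz) (h.orthogonal z hz) (h.orthogonal_J1 z hz)
    (h.unit z hz) (fderiv ℝ n z v)
  rw [h.g0_fderiv_f hr hz] at e1
  rw [h.g0_fderiv_n hz] at e2
  have e1A := congrArg zA e1
  have e1B := congrArg zB e1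
  have e2A := congrArg zA e2
  have e2B := congrArg zB e2
  simp only [map_add, map_sub, map_smul, zA_J1, zB_J1, Complex.real_smul] at e1A e1B e2A e2B
  rw [e1A, e1B, e2A, e2B, phase]
  push_cast
  ring

end HelixPatch

/-! ### The explicit flow along the lines of `T` -/

lemma conj_cis (t : ℝ) : conj (cis t) = cis (-t) := by
  rw [cis, cis, ← Complex.exp_conj]
  simp

lemma cis_neg_mul (t : ℝ) : cis (-t) * cis t = 1 := by
  rw [cis, cis, ← Complex.exp_add]
  simp

lemma cis_two_mul (t : ℝ) : cis (2 * t) = cis t ^ 2 := by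
  rw [cis, cis, ← Complex.exp_nat_mul]
  push_cast
  ring_nf

lemma normSq_cis (t : ℝ) : Complex.normSq (cis t) = 1 := by
  apply Complex.ofReal_injective
  rw [← Complex.mul_conj, conj_cis, mul_comm, cis_neg_mul, Complex.ofReal_one]

lemma hasDerivAt_cis (t : ℝ) : HasDerivAt cis (Complex.I * cis t) t := by
  have h := ((Complex.ofRealCLM.hasDerivAt (x := t)).mul_const Complex.I).cexp
  refine h.congr_deriv ?_
  simp [cis, mul_comm]

lemma contDiff_cis : ContDiff ℝ ∞ cis :=
  ((Complex.ofRealCLM.contDiff).mul contDiff_const).cexp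

/-- In complex coordinates, and with `c` the phase of the horizontal normal at `(p, q)`, the point
reached from `(p, q)` after the time `x` along the integral curve of `T` has the complex coordinates
`transport x c p q` and `transport x c q p`. -/
noncomputable def transport (r α β k l : ℝ) (x : ℝ) (c p q : ℂ) : ℂ :=
  cis (α * x) * ((Real.cosh (β * x) + Complex.I * k * l * Real.sinh (β * x)) * p
    - l * Real.sinh (β * x) * c * r * conj q)

/-- The pairing of a tangent vector `(p', q')` at the point `(p, q)` with the conormal
`n - k J₁f` of a helix surface, where `c` is the phase of the horizontal normal `n`. -/
noncomputable def conormal (r k : ℝ) (c p q p' q' : ℂ) : ℝ :=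
  (conj c * r * (q * p' - p * q')).re - k * (p' * conj p - q' * conj q).im

section Transport

variable {r α β k l : ℝ}

lemma cosh_sq_sub_sinh_sq_complex (t : ℝ) :
    (Real.cosh t : ℂ) ^ 2 - (Real.sinh t : ℂ) ^ 2 = 1 := by
  exact_mod_cast Real.cosh_sq_sub_sinh_sq t

lemma relation_complex {c : ℂ} (hk : l ^ 2 * (r ^ 2 * Complex.normSq c - k ^ 2) = 1) :
    (l : ℂ) ^ 2 * ((r : ℂ) ^ 2 * (c * conj c) - (k : ℂ) ^ 2) = 1 := by
  rw [Complex.mul_conj]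
  exact_mod_cast hk

lemma transport_transport_neg (x : ℝ) {c : ℂ}
    (hk : l ^ 2 * (r ^ 2 * Complex.normSq c - k ^ 2) = 1) (p q : ℂ) :
    transport r α β k l x (cis (2 * (-(α * x))) * c)
      (transport r α β k l (-x) c p q) (transport r α β k l (-x) c q p) = p := by
  have h1 := cosh_sq_sub_sinh_sq_complex (β * x)
  have h2 := relation_complex hk
  have h3 := cis_neg_mul (α * x)
  simp only [transport, mul_neg β, Real.cosh_neg, Real.sinh_neg]
  rw [cis_two_mul]
  simp only [map_mul, map_sub, map_add, conj_cis, Complex.conj_ofReal, Complex.conj_conj,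
    map_neg, Complex.conj_I, neg_neg, Complex.ofReal_neg, mul_neg]
  have hI : Complex.I ^ 2 = -1 := Complex.I_sq
  generalize cis (α * x) = e at *
  generalize cis (-(α * x)) = e' at *
  generalize (Real.cosh (β * x) : ℂ) = C at *
  generalize (Real.sinh (β * x) : ℂ) = S at *
  generalize conj c = c' at *
  generalize conj p = p' at *
  generalize conj q = q' at *
  generalize Complex.I = I at *
  linear_combination ((C ^ 2 - I ^ 2 * (k * l) ^ 2 * S ^ 2) * p
      - e' * e * ((C + I * k * l * S) * l * S * c * r * q')
      - (e' * e + 1) * (l ^ 2 * S ^ 2 * r ^ 2 * c * c' * p)) * h3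
    + p * h1 - S ^ 2 * p * h2 - k ^ 2 * l ^ 2 * S ^ 2 * p * hI

lemma normSq_transport (x : ℝ) {c : ℂ}
    (hk : l ^ 2 * (r ^ 2 * Complex.normSq c - k ^ 2) = 1) (p q : ℂ) :
    Complex.normSq (transport r α β k l x c p q) - Complex.normSq (transport r α β k l x c q p) =
      Complex.normSq p - Complex.normSq q := by
  have h1 := Real.cosh_sq_sub_sinh_sq (β * x)
  simp only [transport, map_mul, normSq_cis, one_mul]
  rw [Complex.normSq_apply] at hk
  simp only [Complex.normSq_apply, Complex.mul_re, Complex.mul_im, Complex.add_re,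
    Complex.add_im, Complex.sub_re, Complex.sub_im, Complex.ofReal_re, Complex.ofReal_im,
    Complex.I_re, Complex.I_im, Complex.conj_re, Complex.conj_im]
  generalize Real.cosh (β * x) = C at *
  generalize Real.sinh (β * x) = S at *
  linear_combination (p.re * p.re + p.im * p.im - (q.re * q.re + q.im * q.im)) *
    (h1 - S ^ 2 * hk)

lemma conormal_rotate (t : ℝ) (c p q p' q' : ℂ) :
    conormal r k (cis (2 * t) * c) (cis t * p) (cis t * q) (cis t * p') (cis t * q') =
      conormal r k c p q p' q' := by
  have h := cis_neg_mul t
  have h1 : conj (cis (2 * t) * c) * r * (cis t * q * (cis t * p') - cis t * p * (cis t * q')) =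
      conj c * r * (q * p' - p * q') := by
    rw [cis_two_mul, map_mul, map_pow, conj_cis]
    linear_combination (conj c * r * (q * p' - p * q')) * (cis (-t) * cis t + 1) * h
  have h2 : cis t * p' * conj (cis t * p) - cis t * q' * conj (cis t * q) =
      p' * conj p - q' * conj q := by
    simp only [map_mul, conj_cis]
    linear_combination (p' * conj p - q' * conj q) * h
  rw [conormal, conormal, h1, h2]

/-- The flow respects the conormal directions. This is why the tangency condition along a whole line
of `T` is a single condition on the parameter `y`. -/
lemma conormal_transport (x : ℝ) {c : ℂ}
    (hk : l ^ 2 * (r ^ 2 * Complex.normSq c - k ^ 2) = 1) (p q p' q' : ℂ) :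
    conormal r k (cis (2 * (α * x)) * c) (transport r α β k l x c p q)
      (transport r α β k l x c q p) (transport r α β k l x c p' q')
      (transport r α β k l x c q' p') = conormal r k c p q p' q' := by
  have h1 := Real.cosh_sq_sub_sinh_sq (β * x)
  simp only [transport, conormal_rotate]
  rw [Complex.normSq_apply] at hk
  simp only [conormal, Complex.mul_re, Complex.mul_im, Complex.add_re,
    Complex.add_im, Complex.sub_re, Complex.sub_im, Complex.ofReal_re, Complex.ofReal_im,
    Complex.I_re, Complex.I_im, Complex.conj_re, Complex.conj_im]
  generalize Real.cosh (β * x) = C at *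
  generalize Real.sinh (β * x) = S at *
  linear_combination ((c.re * r * (q.re * p'.re - q.im * p'.im - (p.re * q'.re - p.im * q'.im))
      + c.im * r * (q.re * p'.im + q.im * p'.re - (p.re * q'.im + p.im * q'.re)))
    - k * (p'.im * p.re - p'.re * p.im - (q'.im * q.re - q'.re * q.im))) * (h1 - S ^ 2 * hk)

/-- The flow equation for `transport`. -/
lemma hasDerivAt_transport {ν : ℝ} (hβ : β * l = ν) (x : ℝ) {c : ℂ}
    (hk : l ^ 2 * (r ^ 2 * Complex.normSq c - k ^ 2) = 1) (p q : ℂ) :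
    HasDerivAt (fun x => transport r α β k l x c p q)
      (Complex.I * (α + ν * k) * transport r α β k l x c p q
        - ν * (cis (2 * (α * x)) * c) * r * conj (transport r α β k l x c q p)) x := by
  have hC : HasDerivAt (fun x : ℝ => (Real.cosh (β * x) : ℂ)) ((Real.sinh (β * x) * β : ℝ) : ℂ) x :=
    (((hasDerivAt_id x).const_mul β).cosh.congr_deriv (by simp)).ofReal_comp
  have hS : HasDerivAt (fun x : ℝ => (Real.sinh (β * x) : ℂ)) ((Real.cosh (β * x) * β : ℝ) : ℂ) x :=
    (((hasDerivAt_id x).const_mul β).sinh.congr_deriv (by simp)).ofReal_comp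
  have he : HasDerivAt (fun x : ℝ => cis (α * x)) ((α : ℂ) * (Complex.I * cis (α * x))) x := by
    have := (hasDerivAt_cis (α * x)).scomp x ((hasDerivAt_id x).const_mul α)
    exact this.congr_deriv (by simp)
  have h := he.fun_mul (((hC.fun_add (hS.const_mul (Complex.I * k * l))).mul_const p).fun_sub
    ((((hS.const_mul (l : ℂ)).mul_const c).mul_const (r : ℂ)).mul_const (conj q)))
  refine h.congr_deriv ?_
  have h1 := cosh_sq_sub_sinh_sq_complex (β * x)
  have h2 := relation_complex hk
  have h3 := cis_neg_mul (α * x)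
  subst hβ
  clear h he hC hS hk
  simp only [transport]
  rw [cis_two_mul]
  simp only [map_mul, map_sub, map_add, conj_cis, Complex.conj_ofReal, Complex.conj_conj,
    Complex.conj_I]
  push_cast at *
  have hI : Complex.I ^ 2 = -1 := Complex.I_sq
  generalize cis (α * x) = e at *
  generalize cis (-(α * x)) = e' at *
  generalize Complex.cosh (β * x) = C at *
  generalize Complex.sinh (β * x) = S at *
  generalize conj c = c' at *
  generalize conj p = p' at *
  generalize conj q = q' at *
  generalize Complex.I = I at *
  linear_combination β * l * e * c * r * ((C - I * k * l * S) * q' - l * S * c' * r * p) * h3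
    - e * β * S * p * h2 - e * β * l ^ 2 * k ^ 2 * S * p * hI

/-- `transport (-x)` undoes the flow: along a solution of the flow equation the initial values
recovered in this way are constant. -/
lemma hasDerivAt_transport_neg {ν : ℝ} (hβ : β * l = ν) {x : ℝ → ℝ} {c F G : ℝ → ℂ} {t : ℝ}
    (hk : l ^ 2 * (r ^ 2 * Complex.normSq (c t) - k ^ 2) = 1)
    (hx : HasDerivAt x 1 t) (hc : HasDerivAt c (Complex.I * (2 * α) * c t) t)
    (hF : HasDerivAt F (Complex.I * (α + ν * k) * F t - ν * c t * r * conj (G t)) t)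
    (hG : HasDerivAt G (Complex.I * (α + ν * k) * G t - ν * c t * r * conj (F t)) t) :
    HasDerivAt (fun s => transport r α β k l (-(x s)) (c s) (F s) (G s)) 0 t := by
  have hβx : HasDerivAt (fun s => β * -(x s)) (-β) t := by
    simpa using hx.neg.const_mul β
  have hC : HasDerivAt (fun s : ℝ => (Real.cosh (β * -(x s)) : ℂ))
      ((Real.sinh (β * -(x t)) * -β : ℝ) : ℂ) t := hβx.cosh.ofReal_comp
  have hS : HasDerivAt (fun s : ℝ => (Real.sinh (β * -(x s)) : ℂ))
      ((Real.cosh (β * -(x t)) * -β : ℝ) : ℂ) t := hβx.sinh.ofReal_comp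
  have he : HasDerivAt (fun s : ℝ => cis (α * -(x s))) (-α * (Complex.I * cis (α * -(x t)))) t := by
    have := (hasDerivAt_cis (α * -(x t))).scomp t (hx.neg.const_mul α)
    exact this.congr_deriv (by simp)
  have h := he.fun_mul (((hC.fun_add (hS.const_mul (Complex.I * k * l))).fun_mul hF).fun_sub
    ((((hS.const_mul (l : ℂ)).fun_mul hc).mul_const (r : ℂ)).fun_mul hG.star))
  refine h.congr_deriv ?_
  have h2 := relation_complex hk
  subst hβ
  clear h he hC hS hk hF hG hc hβx
  simp only [RCLike.star_def, map_mul, map_sub, map_add, Complex.conj_ofReal, Complex.conj_conj,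
    Complex.conj_I]
  push_cast at *
  have hI : Complex.I ^ 2 = -1 := Complex.I_sq
  generalize cis (α * -(x t)) = e at *
  generalize Complex.cosh (β * -(x t)) = C at *
  generalize Complex.sinh (β * -(x t)) = S at *
  generalize conj (c t) = c' at *
  generalize c t = c at *
  generalize conj (F t) = F' at *
  generalize conj (G t) = G' at *
  generalize Complex.I = I at *
  linear_combination β * e * S * F t * h2 + e * β * l ^ 2 * k ^ 2 * S * F t * hI

end Transport

/-! ### The matrices `A` and the curve `γ` in complex coordinates -/

lemma cis_eq (t : ℝ) : cis t = ⟨Real.cos t, Real.sin t⟩ := by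
  rw [cis]
  apply Complex.ext
  · rw [Complex.exp_ofReal_mul_I_re]
  · rw [Complex.exp_ofReal_mul_I_im]

/-- The entry `a` of the complex matrix `A = (a, b; ω b̄, ω ā)`. -/
noncomputable def polarA (x1 x2 : ℝ) : ℂ := Real.cosh x1 * cis x2

/-- The entry `b` of the complex matrix `A = (a, b; ω b̄, ω ā)`. -/
noncomputable def polarB (x1 x3 : ℝ) : ℂ := Real.sinh x1 * cis x3

/-- The determinant `ω` of the complex matrix `A = (a, b; ω b̄, ω ā)`. -/
noncomputable def omega (x0 : ℝ) : ℂ := -Complex.I * cis x0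

lemma normSq_omega (x0 : ℝ) : Complex.normSq (omega x0) = 1 := by
  rw [omega, map_mul, normSq_cis]; simp

lemma normSq_polar (x1 x2 x3 : ℝ) :
    Complex.normSq (polarA x1 x2) - Complex.normSq (polarB x1 x3) = 1 := by
  rw [polarA, polarB, map_mul, map_mul, normSq_cis, normSq_cis, Complex.normSq_ofReal,
    Complex.normSq_ofReal]
  linarith [Real.cosh_sq_sub_sinh_sq x1]

lemma zA_matA (x0 x1 x2 x3 : ℝ) (v : Fin 4 → ℝ) :
    zA (matA x0 x1 x2 x3 *ᵥ v) = polarA x1 x2 * zA v + polarB x1 x3 * zB v := by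
  simp only [zA_apply, zB_apply, matA, polarA, polarB, cis_eq, row1, row3, J1_mulVec, J2_mulVec,
    J3_mulVec, Matrix.mulVec, dotProduct, Fin.sum_univ_four]
  generalize Real.sinh x1 = S
  generalize Real.cosh x1 = C
  apply Complex.ext <;> simp <;> ring

lemma zB_matA (x0 x1 x2 x3 : ℝ) (v : Fin 4 → ℝ) :
    zB (matA x0 x1 x2 x3 *ᵥ v) =
      omega x0 * (conj (polarB x1 x3) * zA v + conj (polarA x1 x2) * zB v) := by
  simp only [zA_apply, zB_apply, matA, polarA, polarB, omega, cis_eq, row1, row3, J1_mulVec,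
    J2_mulVec, J3_mulVec, Matrix.mulVec, dotProduct, Fin.sum_univ_four]
  generalize Real.sinh x1 = S
  generalize Real.cosh x1 = C
  apply Complex.ext <;> simp <;> ring

lemma g0_matA (x0 x1 x2 x3 : ℝ) (u v : Fin 4 → ℝ) :
    g0 (matA x0 x1 x2 x3 *ᵥ u) (matA x0 x1 x2 x3 *ᵥ v) = g0 u v := by
  have h1 := hermitian_eq (matA x0 x1 x2 x3 *ᵥ u) (matA x0 x1 x2 x3 *ᵥ v)
  have h2 := hermitian_eq u v
  have h3 := congrArg (Complex.ofReal) (normSq_omega x0)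
  have h4 := congrArg (Complex.ofReal) (normSq_polar x1 x2 x3)
  simp only [Complex.ofReal_sub, Complex.ofReal_one, ← Complex.mul_conj] at h3 h4
  have h5 := congrArg Complex.re (h1.symm.trans (Eq.trans ?_ h2))
  · simpa using h5
  · rw [zA_matA, zB_matA, zA_matA, zB_matA]
    generalize polarA x1 x2 = a at *
    generalize polarB x1 x3 = b at *
    generalize omega x0 = w at *
    simp only [map_mul, map_add, Complex.conj_conj]
    linear_combination (zA u * conj (zA v) - zB u * conj (zB v)) * h4
      - (conj b * zA u + conj a * zB u) * (b * conj (zA v) + a * conj (zB v)) * h3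

lemma matA_isometry (x0 x1 x2 x3 : ℝ) :
    (matA x0 x1 x2 x3)ᵀ * eps * matA x0 x1 x2 x3 = eps := by
  have key : ∀ (A : Matrix (Fin 4) (Fin 4) ℝ) (i j : Fin 4),
      (Aᵀ * eps * A) i j = g0 (A *ᵥ Pi.single i 1) (A *ᵥ Pi.single j 1) := by
    intro A i j
    simp only [Matrix.mulVec_single_one, g0, Matrix.mul_apply, eps, Matrix.diagonal_apply,
      Fin.sum_univ_four, Matrix.transpose_apply, Matrix.col_apply]
    simp
    ring
  ext i j
  rw [key, g0_matA]
  have h := key 1 i j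
  simp only [Matrix.transpose_one, one_mul, mul_one, Matrix.one_mulVec] at h
  exact h.symm

lemma matA_commute (x0 x1 x2 x3 : ℝ) :
    matA x0 x1 x2 x3 * J1 = J1 * matA x0 x1 x2 x3 := by
  apply Matrix.ext_of_mulVec_single
  intro i
  rw [← Matrix.mulVec_mulVec, ← Matrix.mulVec_mulVec]
  apply ext_zA_zB
  · rw [zA_matA, zA_J1, zB_J1, zA_J1, zA_matA]; ring
  · rw [zB_matA, zA_J1, zB_J1, zB_J1, zB_matA]; ring

/-- The constant `ν / β` in the flow of `T`. -/
noncomputable def flowConst (κ τ lam ν : ℝ) : ℝ := ν / helixBeta κ τ lam ν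

section Constants

variable {κ τ lam ν : ℝ}

lemma lam_sq (hlam : lam = 1 ∨ lam = -1) : lam ^ 2 = 1 := by
  rcases hlam with rfl | rfl <;> norm_num

lemma lam_add_sq_pos (hB : helixB τ lam ν < 0) : 0 < lam + ν ^ 2 := by
  rw [helixB] at hB
  nlinarith [sq_nonneg (ν * τ)]

lemma half_sqrt_pos (hκ : 0 < κ) : 0 < √κ / 2 := by positivity

lemma sqrt_sq_eq (hκ : 0 < κ) (hlam : lam = 1 ∨ lam = -1) (hB : helixB τ lam ν < 0) :
    (√(-(κ * helixB τ lam ν)) / 2) ^ 2 =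
      (√κ / 2) ^ 2 * (lam + ν ^ 2) - (lam * ν * τ * (√κ / 2)) ^ 2 := by
  rw [div_pow, Real.sq_sqrt (by nlinarith), mul_pow, div_pow, Real.sq_sqrt hκ.le]
  simp only [mul_pow, lam_sq hlam, helixB]
  ring

lemma sqrt_neg_pos (hκ : 0 < κ) (hB : helixB τ lam ν < 0) : 0 < √(-(κ * helixB τ lam ν)) :=
  Real.sqrt_pos.2 (by nlinarith)

lemma helixBeta_pos (hκ : 0 < κ) (hν : ν ≠ 0) (hB : helixB τ lam ν < 0) :
    0 < helixBeta κ τ lam ν := by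
  have := sqrt_neg_pos hκ hB
  rw [helixBeta]
  positivity

lemma beta_mul_flowConst (hκ : 0 < κ) (hν : ν ≠ 0) (hB : helixB τ lam ν < 0) :
    helixBeta κ τ lam ν * flowConst κ τ lam ν = ν := by
  rw [flowConst, mul_div_cancel₀ _ (helixBeta_pos hκ hν hB).ne']

lemma flowConst_sq (hκ : 0 < κ) (hlam : lam = 1 ∨ lam = -1) (hν : ν ≠ 0)
    (hB : helixB τ lam ν < 0) :
    flowConst κ τ lam ν ^ 2 *
      ((√κ / 2) ^ 2 * (lam + ν ^ 2) - (lam * ν * τ * (√κ / 2)) ^ 2) = 1 := by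
  have h1 := sqrt_neg_pos hκ hB
  rw [← sqrt_sq_eq hκ hlam hB, flowConst, helixBeta, div_pow, mul_pow, sq_abs]
  field_simp

lemma helixAlpha_add (hτ : 0 < τ) (hlam : lam = 1 ∨ lam = -1) :
    helixAlpha κ τ lam ν + ν * (lam * ν * τ * (√κ / 2)) =
      lam * (lam + ν ^ 2) * (√κ / 2) / τ := by
  rcases hlam with rfl | rfl <;> rw [helixAlpha, helixB] <;> field_simp <;> ring

lemma helixAlpha_ne_zero (hκ : 0 < κ) (hτ : 0 < τ) (hlam : lam = 1 ∨ lam = -1)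
    (hB : helixB τ lam ν < 0) : helixAlpha κ τ lam ν ≠ 0 := by
  have h1 := half_sqrt_pos hκ
  have h2 : lam ≠ 0 := by rcases hlam with rfl | rfl <;> norm_num
  rw [helixAlpha]
  exact mul_ne_zero (by linarith) (div_ne_zero hB.ne (mul_ne_zero h2 hτ.ne'))

end Constants

/-- The phase at `x = 0` of the horizontal normal along `A γ(x)`. -/
noncomputable def initialPhase (lam ν ξ : ℝ) : ℂ :=
  ((-(ν / |ν|) * √(lam + ν ^ 2) : ℝ) : ℂ) * omega ξ

lemma normSq_initialPhase {τ lam ν : ℝ} (hν : ν ≠ 0) (hB : helixB τ lam ν < 0) (ξ : ℝ) :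
    Complex.normSq (initialPhase lam ν ξ) = lam + ν ^ 2 := by
  have h := lam_add_sq_pos hB
  rw [initialPhase, map_mul, normSq_omega, Complex.normSq_ofReal, mul_one]
  have h1 : (ν / |ν|) * (ν / |ν|) = 1 := by
    rw [div_mul_div_comm, abs_mul_abs_self, div_self (mul_ne_zero hν hν)]
  calc _ = ((ν / |ν|) * (ν / |ν|)) * (√(lam + ν ^ 2) * √(lam + ν ^ 2)) := by ring
    _ = _ := by rw [h1, Real.mul_self_sqrt h.le, one_mul]

section Gamma

variable {κ τ lam ν : ℝ}

lemma zA_helixGamma (x : ℝ) : zA (helixGamma κ τ lam ν x) =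
    ((2 * √(lam + ν ^ 2) / √(-(κ * helixB τ lam ν)) : ℝ) : ℂ) *
      (cis (helixAlpha κ τ lam ν * x) * Real.sinh (helixBeta κ τ lam ν * x)) := by
  simp only [zA_apply, helixGamma, cis_eq]
  apply Complex.ext
  · simp only [Complex.re_ofReal_mul, Complex.re_mul_ofReal]; simp; ring
  · simp only [Complex.im_ofReal_mul, Complex.im_mul_ofReal]; simp; ring

lemma zB_helixGamma (x : ℝ) : zB (helixGamma κ τ lam ν x) =
    cis (helixAlpha κ τ lam ν * x) * (((2 / √κ : ℝ) : ℂ) * Real.cosh (helixBeta κ τ lam ν * x) +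
      ((2 * lam * τ * |ν| / √(-(κ * helixB τ lam ν)) : ℝ) : ℂ) * Complex.I *
        Real.sinh (helixBeta κ τ lam ν * x)) := by
  simp only [zB_apply, helixGamma, cis_eq]
  apply Complex.ext
  · simp only [Complex.mul_re, Complex.mul_im, Complex.add_re, Complex.add_im, Complex.ofReal_re,
      Complex.ofReal_im, Complex.I_re, Complex.I_im]
    simp; ring
  · simp only [Complex.mul_re, Complex.mul_im, Complex.add_re, Complex.add_im, Complex.ofReal_re,
      Complex.ofReal_im, Complex.I_re, Complex.I_im]
    simp; ring

/-- `A γ(x)` is the flow line of `T` through `A γ(0)`, with the initial phase determined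
by `det A`. -/
lemma matA_helixGamma (hκ : 0 < κ) (hν : ν ≠ 0) (hB : helixB τ lam ν < 0)
    (ξ x1 x2 x3 x : ℝ) :
    zA (matA ξ x1 x2 x3 *ᵥ helixGamma κ τ lam ν x) =
      transport (√κ / 2) (helixAlpha κ τ lam ν) (helixBeta κ τ lam ν) (lam * ν * τ * (√κ / 2))
        (flowConst κ τ lam ν) x (initialPhase lam ν ξ) (polarB x1 x3 / (√κ / 2 : ℝ))
        (omega ξ * conj (polarA x1 x2) / (√κ / 2 : ℝ)) ∧
    zB (matA ξ x1 x2 x3 *ᵥ helixGamma κ τ lam ν x) =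
      transport (√κ / 2) (helixAlpha κ τ lam ν) (helixBeta κ τ lam ν) (lam * ν * τ * (√κ / 2))
        (flowConst κ τ lam ν) x (initialPhase lam ν ξ)
        (omega ξ * conj (polarA x1 x2) / (√κ / 2 : ℝ)) (polarB x1 x3 / (√κ / 2 : ℝ)) := by
  have hw := sqrt_neg_pos hκ hB
  have hκ' : 0 < √κ := Real.sqrt_pos.2 hκ
  have hν' : |ν| ≠ 0 := abs_ne_zero.2 hν
  have hs : (2 * √(lam + ν ^ 2) / √(-(κ * helixB τ lam ν)) : ℝ) =
      flowConst κ τ lam ν * ((ν / |ν|) * √(lam + ν ^ 2)) := by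
    rw [flowConst, helixBeta]
    field_simp
    rw [sq_abs, mul_comm]
  have ht : (2 * lam * τ * |ν| / √(-(κ * helixB τ lam ν)) : ℝ) =
      (lam * ν * τ * (√κ / 2)) * flowConst κ τ lam ν / (√κ / 2) := by
    rw [flowConst, helixBeta]
    field_simp
    rw [sq_abs]
  have hr : (2 / √κ : ℝ) = 1 / (√κ / 2) := by field_simp
  have hw1 := congrArg (Complex.ofReal) (normSq_omega ξ)
  rw [← Complex.mul_conj, Complex.ofReal_one] at hw1
  have hr0 : ((√κ / 2 : ℝ) : ℂ) ≠ 0 := by exact_mod_cast (half_sqrt_pos hκ).ne'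
  rw [zA_matA, zB_matA, zA_helixGamma, zB_helixGamma, hs, ht, hr]
  simp only [transport, initialPhase, neg_mul, Complex.ofReal_neg, map_div₀, map_mul, Complex.conj_conj, Complex.conj_ofReal]
  generalize √κ / 2 = r at *
  generalize flowConst κ τ lam ν = l at *
  generalize (ν / |ν|) * √(lam + ν ^ 2) = s at *
  push_cast
  constructor
  · field_simp
    linear_combination (-(l * s * Complex.sinh (helixBeta κ τ lam ν * x) * r *
      cis (helixAlpha κ τ lam ν * x) * polarA x1 x2)) * hw1
  · field_simp
    ring

end Gamma

/-! ### The differential constraint -/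

lemma hasDerivAt_polarA {ξ₁ ξ₂ : ℝ → ℝ} {d₁ d₂ y : ℝ} (h₁ : HasDerivAt ξ₁ d₁ y)
    (h₂ : HasDerivAt ξ₂ d₂ y) : HasDerivAt (fun y => polarA (ξ₁ y) (ξ₂ y))
      ((Real.sinh (ξ₁ y) * d₁ + Complex.I * Real.cosh (ξ₁ y) * d₂) * cis (ξ₂ y)) y := by
  have h3 : HasDerivAt (fun y => cis (ξ₂ y)) ((d₂ : ℂ) * (Complex.I * cis (ξ₂ y))) y :=
    (hasDerivAt_cis (ξ₂ y)).scomp y h₂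
  refine (h₁.cosh.ofReal_comp.fun_mul h3).congr_deriv ?_
  push_cast
  ring

lemma hasDerivAt_polarB {ξ₁ ξ₃ : ℝ → ℝ} {d₁ d₃ y : ℝ} (h₁ : HasDerivAt ξ₁ d₁ y)
    (h₃ : HasDerivAt ξ₃ d₃ y) : HasDerivAt (fun y => polarB (ξ₁ y) (ξ₃ y))
      ((Real.cosh (ξ₁ y) * d₁ + Complex.I * Real.sinh (ξ₁ y) * d₃) * cis (ξ₃ y)) y := by
  have h3 : HasDerivAt (fun y => cis (ξ₃ y)) ((d₃ : ℂ) * (Complex.I * cis (ξ₃ y))) y :=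
    (hasDerivAt_cis (ξ₃ y)).scomp y h₃
  refine (h₁.sinh.ofReal_comp.fun_mul h3).congr_deriv ?_
  push_cast
  ring

/-- The differential constraint says that the derivative of `A γ(0)` is orthogonal to the
conormal. -/
lemma constraint_iff {κ τ lam ν : ℝ} (hκ : 0 < κ) (hν : ν ≠ 0) (ξ : ℝ) {ξ₁ ξ₂ ξ₃ : ℝ → ℝ} {y : ℝ}
    (h₁ : DifferentiableAt ℝ ξ₁ y) (h₂ : DifferentiableAt ℝ ξ₂ y)
    (h₃ : DifferentiableAt ℝ ξ₃ y) :
    Constraint τ lam ν ξ₁ ξ₂ ξ₃ y ↔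
      conormal (√κ / 2) (lam * ν * τ * (√κ / 2)) (initialPhase lam ν ξ)
        (polarB (ξ₁ y) (ξ₃ y) / (√κ / 2 : ℝ))
        (omega ξ * conj (polarA (ξ₁ y) (ξ₂ y)) / (√κ / 2 : ℝ))
        (deriv (fun y => polarB (ξ₁ y) (ξ₃ y)) y / (√κ / 2 : ℝ))
        (omega ξ * conj (deriv (fun y => polarA (ξ₁ y) (ξ₂ y)) y) / (√κ / 2 : ℝ)) = 0 := by
  have hr := half_sqrt_pos hκ
  generalize √κ / 2 = r at *
  rw [(hasDerivAt_polarA h₁.hasDerivAt h₂.hasDerivAt).deriv,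
    (hasDerivAt_polarB h₁.hasDerivAt h₃.hasDerivAt).deriv]
  have hω : conj (omega ξ) * omega ξ = 1 := by
    rw [mul_comm, Complex.mul_conj, normSq_omega, Complex.ofReal_one]
  have hr0 : (r : ℂ) ≠ 0 := by exact_mod_cast hr.ne'
  have h1 : conj (initialPhase lam ν ξ) * omega ξ = ((-(ν / |ν|) * √(lam + ν ^ 2) : ℝ) : ℂ) := by
    rw [initialPhase, map_mul, Complex.conj_ofReal, mul_assoc, hω, mul_one]
  have hν1 : ν * (ν / |ν|) = |ν| := by
    have : |ν| ≠ 0 := abs_ne_zero.2 hν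
    field_simp
    rw [sq_abs]
  rw [Constraint, conormal]
  have h2 : ∀ a b a' b' : ℂ, conj (initialPhase lam ν ξ) * r *
      (omega ξ * conj a / r * (b' / r) -
        b / r * (omega ξ * conj a' / r)) =
      ((-(ν / |ν|) * √(lam + ν ^ 2) / r : ℝ) : ℂ) * (conj a * b' - b * conj a') := by
    intro a b a' b'
    rw [Complex.ofReal_div, ← h1]
    field_simp
  have h3 : ∀ a b a' b' : ℂ, b' / r * conj (b / r) -
      omega ξ * conj a' / r * conj (omega ξ * conj a / r) =
      ((1 / r ^ 2 : ℝ) : ℂ) * (b' * conj b - conj a' * a) := by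
    intro a b a' b'
    simp only [map_div₀, map_mul, Complex.conj_ofReal, Complex.conj_conj]
    push_cast at hr0 ⊢
    field_simp
    linear_combination (-conj a' * a) * hω
  rw [h2, h3, Complex.re_ofReal_mul, Complex.im_ofReal_mul]
  generalize deriv ξ₁ y = d₁
  generalize deriv ξ₂ y = d₂
  generalize deriv ξ₃ y = d₃
  generalize ξ₁ y = x₁
  generalize ξ₂ y = x₂
  generalize ξ₃ y = x₃
  simp only [polarA, polarB, cis_eq, Real.cos_sub, Real.sin_sub, Real.sinh_two_mul]
  have hc := Real.cosh_sq_sub_sinh_sq x₁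
  have hs₂ := Real.sin_sq_add_cos_sq x₂
  have hs₃ := Real.sin_sq_add_cos_sq x₃
  generalize Real.cosh x₁ = C at *
  generalize Real.sinh x₁ = S at *
  generalize Real.cos x₂ = c₂ at *
  generalize Real.sin x₂ = s₂ at *
  generalize Real.cos x₃ = c₃ at *
  generalize Real.sin x₃ = s₃ at *
  simp only [map_mul, Complex.conj_ofReal, Complex.mul_re, Complex.mul_im, Complex.add_re,
    Complex.add_im, Complex.sub_re, Complex.sub_im, Complex.ofReal_re, Complex.ofReal_im,
    Complex.I_re, Complex.I_im, Complex.conj_re, Complex.conj_im]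
  have key : ∀ X Y : ℝ, X = -2 * r * ν * Y → (X = 0 ↔ Y = 0) := by
    rintro X Y rfl
    simp [hr.ne', hν]
  apply key
  generalize ν / |ν| = σ at *
  rw [← hν1]
  generalize √(lam + ν ^ 2) = q at *
  field_simp
  linear_combination (-σ * q * (c₂ * c₃ + s₂ * s₃) * d₁) * hc
    - lam * τ * ν * C ^ 2 * d₂ * hs₂ - lam * τ * ν * S ^ 2 * d₃ * hs₃

/-! ### Helix form of a patch in adapted coordinates -/

/-- The tangency condition in complex coordinates. -/
lemma conormal_eq {r k : ℝ} {f n : Fin 4 → ℝ} (hff : r ^ 2 * g0 f f = -1) (hfn : g0 f n = 0)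
    (hfJn : g0 f (J1 *ᵥ n) = 0) (v : Fin 4 → ℝ) :
    g0 v (n - k • (J1 *ᵥ f)) = conormal r k (phase r f n) (zA f) (zB f) (zA v) (zB v) := by
  obtain ⟨hA, hB⟩ := horizontal_eq hff hfn hfJn
  have h1 := congrArg Complex.re (hermitian_eq v n)
  have h2 := congrArg Complex.im (hermitian_eq v f)
  rw [hA, hB] at h1
  rw [g0_sub_right, g0_smul_right, conormal]
  simp only [Complex.add_re, Complex.add_im, Complex.ofReal_re, Complex.ofReal_im,
    Complex.re_ofReal_mul, Complex.im_ofReal_mul, Complex.I_re, Complex.I_im, mul_zero, mul_one,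
    add_zero, zero_add] at h1 h2
  rw [← h1, ← h2]
  simp only [map_mul, Complex.conj_conj, Complex.conj_ofReal]
  ring_nf

lemma hasDerivAt_transport_initial {r α β k l x : ℝ} {c : ℂ} {p q : ℝ → ℂ} {p' q' : ℂ} {y : ℝ}
    (hp : HasDerivAt p p' y) (hq : HasDerivAt q q' y) :
    HasDerivAt (fun y => transport r α β k l x c (p y) (q y)) (transport r α β k l x c p' q') y :=
  ((hp.const_mul _).sub (hq.star.const_mul _)).const_mul _

lemma contDiffOn_transport_neg {E : Type*} [NormedAddCommGroup E] [NormedSpace ℝ E]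
    {r α β k l : ℝ} {U : Set E} {c F G : E → ℂ} {x : E → ℝ} (hx : ContDiffOn ℝ ∞ x U)
    (hc : ContDiffOn ℝ ∞ c U) (hF : ContDiffOn ℝ ∞ F U) (hG : ContDiffOn ℝ ∞ G U) :
    ContDiffOn ℝ ∞ (fun z => transport r α β k l (-(x z)) (c z) (F z) (G z)) U := by
  have h1 : ContDiffOn ℝ ∞ (fun z => cis (α * -(x z))) U :=
    contDiff_cis.comp_contDiffOn (contDiffOn_const.mul hx.neg)
  have h2 : ContDiffOn ℝ ∞ (fun z => (Real.cosh (β * -(x z)) : ℂ)) U :=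
    Complex.ofRealCLM.contDiff.comp_contDiffOn
      (Real.contDiff_cosh.comp_contDiffOn (contDiffOn_const.mul hx.neg))
  have h3 : ContDiffOn ℝ ∞ (fun z => (Real.sinh (β * -(x z)) : ℂ)) U :=
    Complex.ofRealCLM.contDiff.comp_contDiffOn
      (Real.contDiff_sinh.comp_contDiffOn (contDiffOn_const.mul hx.neg))
  have h4 : ContDiffOn ℝ ∞ (fun z => conj (G z)) U := Complex.conjCLE.contDiff.comp_contDiffOn hG
  exact h1.mul (((h2.add (contDiffOn_const.mul h3)).mul hF).sub
    ((((contDiffOn_const.mul h3).mul hc).mul contDiffOn_const).mul h4))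

lemma exists_initialPhase {lam ν : ℝ} (hν : ν ≠ 0) (hL : 0 < lam + ν ^ 2) {c : ℂ}
    (hc : Complex.normSq c = lam + ν ^ 2) : ∃ ξ, initialPhase lam ν ξ = c := by
  set s : ℝ := -(ν / |ν|) * √(lam + ν ^ 2) with hs
  have hs2 : s ^ 2 = lam + ν ^ 2 := by
    have h1 : |ν| ≠ 0 := abs_ne_zero.2 hν
    rw [hs, mul_pow, Real.sq_sqrt hL.le, neg_sq, div_pow, sq_abs, div_self (pow_ne_zero 2 hν),
      one_mul]
  have hs0 : s ≠ 0 := by rintro h; rw [h] at hs2; norm_num at hs2; linarith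
  have hs0' : (s : ℂ) ≠ 0 := by exact_mod_cast hs0
  have hu : ‖Complex.I * (c / s)‖ = 1 := by
    have : ‖Complex.I * (c / s)‖ ^ 2 = 1 := by
      rw [← Complex.normSq_eq_norm_sq, map_mul, map_div₀, hc, Complex.normSq_ofReal, ← pow_two, hs2,
        div_self hL.ne']
      simp
    nlinarith [norm_nonneg (Complex.I * (c / s))]
  refine ⟨Complex.arg (Complex.I * (c / s)), ?_⟩
  have h := Complex.norm_mul_exp_arg_mul_I (Complex.I * (c / s))
  rw [hu, Complex.ofReal_one, one_mul] at h
  rw [initialPhase, omega, cis, h, ← hs]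
  field_simp
  rw [Complex.I_sq]; ring

lemma plane_eq (z : Plane) : z = !₂[z 0, z 1] := by
  ext i; fin_cases i <;> rfl

lemma exists_box {U : Set Plane} (hU : IsOpen U) {z : Plane} (hz : z ∈ U) :
    ∃ δ > 0, ∀ x ∈ Set.Ioo (z 0 - δ) (z 0 + δ), ∀ y ∈ Set.Ioo (z 1 - δ) (z 1 + δ),
      (!₂[x, y] : Plane) ∈ U := by
  have hc : Continuous (fun p : ℝ × ℝ => (!₂[p.1, p.2] : Plane)) := by fun_prop
  have hmem : (fun p : ℝ × ℝ => (!₂[p.1, p.2] : Plane)) ⁻¹' U ∈ nhds (z 0, z 1) :=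
    (hU.preimage hc).mem_nhds (by
      change (!₂[z 0, z 1] : Plane) ∈ U
      rwa [← plane_eq])
  obtain ⟨δ, hδ, hsub⟩ := Metric.mem_nhds_iff.1 hmem
  refine ⟨δ, hδ, fun x hx y hy => ?_⟩
  have : (x, y) ∈ Metric.ball (z 0, z 1) δ := by
    rw [← ball_prod_same, Real.ball_eq_Ioo, Real.ball_eq_Ioo]
    exact ⟨hx, hy⟩
  exact hsub this

lemma mk_add_smul_single_zero (x y t : ℝ) :
    (!₂[x, y] : Plane) + t • EuclideanSpace.single 0 1 = !₂[x + t, y] := by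
  ext i; fin_cases i <;> simp

lemma mk_add_smul_single_one (x y t : ℝ) :
    (!₂[x, y] : Plane) + t • EuclideanSpace.single 1 1 = !₂[x, y + t] := by
  ext i; fin_cases i <;> simp

lemma hasDerivAt_mk_fst {G : Type*} [NormedAddCommGroup G] [NormedSpace ℝ G] {U : Set Plane}
    (hU : IsOpen U) {u : Plane → G} (hu : ContDiffOn ℝ ∞ u U) {x y : ℝ}
    (hz : (!₂[x, y] : Plane) ∈ U) :
    HasDerivAt (fun x => u !₂[x, y]) (fderiv ℝ u !₂[x, y] (EuclideanSpace.single 0 1)) x := by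
  have h := hasDerivAt_line hU hu hz (EuclideanSpace.single 0 1)
  simp only [mk_add_smul_single_zero] at h
  have h2 := HasDerivAt.comp_sub_const x x (f := fun t => u !₂[x + t, y]) (by rwa [sub_self])
  simpa using h2

lemma hasDerivAt_mk_snd {G : Type*} [NormedAddCommGroup G] [NormedSpace ℝ G] {U : Set Plane}
    (hU : IsOpen U) {u : Plane → G} (hu : ContDiffOn ℝ ∞ u U) {x y : ℝ}
    (hz : (!₂[x, y] : Plane) ∈ U) :
    HasDerivAt (fun y => u !₂[x, y]) (fderiv ℝ u !₂[x, y] (EuclideanSpace.single 1 1)) y := by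
  have h := hasDerivAt_line hU hu hz (EuclideanSpace.single 1 1)
  simp only [mk_add_smul_single_one] at h
  have h2 := HasDerivAt.comp_sub_const y y (f := fun t => u !₂[x, y + t]) (by rwa [sub_self])
  simpa using h2

/-- A patch in coordinates with `∂ₓ = T` in which the phase of the horizontal normal does not depend
on `y` is in helix form. -/
lemma HelixPatch.hasHelixForm {κ τ lam ν : ℝ} (hκ : 0 < κ) (hτ : 0 < τ)
    (hlam : lam = 1 ∨ lam = -1) (hν : ν ≠ 0) (hB : helixB τ lam ν < 0) {U : Set Plane}
    {f n : Plane → Fin 4 → ℝ} (h : HelixPatch (√κ / 2) τ lam ν U f n)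
    (hx : ∀ z ∈ U, fderiv ℝ f z (EuclideanSpace.single 0 1) =
      horizT (√κ / 2) τ lam ν (f z) (n z))
    (hy : ∀ z ∈ U, fderiv ℝ f z (EuclideanSpace.single 1 1) ≠ 0) {c₀ : ℂ}
    (hc : ∀ z ∈ U, phase (√κ / 2) (f z) (n z) = cis (2 * (helixAlpha κ τ lam ν * z 0)) * c₀)
    {z₀ : Plane} (hz₀ : z₀ ∈ U) :
    ∃ V : Set Plane, IsOpen V ∧ z₀ ∈ V ∧ V ⊆ U ∧
      HasHelixForm κ τ lam ν f (OpenPartialHomeomorph.refl Plane) V := by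
  have hL := lam_add_sq_pos hB
  have hr := half_sqrt_pos hκ
  have hr0 : ((√κ / 2 : ℝ) : ℂ) ≠ 0 := by exact_mod_cast hr.ne'
  have hnorm : ∀ z ∈ U, Complex.normSq (phase (√κ / 2) (f z) (n z)) = lam + ν ^ 2 := fun z hz => by
    rw [normSq_phase (h.quadric z hz) (h.orthogonal z hz) (h.orthogonal_J1 z hz), h.unit z hz]
  have hc₀ : Complex.normSq c₀ = lam + ν ^ 2 := by
    have h1 := hnorm z₀ hz₀
    rwa [hc z₀ hz₀, map_mul, normSq_cis, one_mul] at h1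
  obtain ⟨ξ, hξ⟩ := exists_initialPhase hν hL hc₀
  have hcon := flowConst_sq hκ hlam hν hB
  have hα := helixAlpha_add (κ := κ) (ν := ν) hτ hlam
  have hβ := beta_mul_flowConst hκ hν hB
  set r := √κ / 2
  set α := helixAlpha κ τ lam ν
  set β := helixBeta κ τ lam ν
  set k := lam * ν * τ * r
  set l := flowConst κ τ lam ν
  set c : Plane → ℂ := fun z => phase r (f z) (n z) with hcdef
  set F : Plane → ℂ := fun z => zA (f z) with hFdef
  set G : Plane → ℂ := fun z => zB (f z) with hGdef
  have hF : ContDiffOn ℝ ∞ F U := zA.contDiff.comp_contDiffOn h.smooth_f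
  have hG : ContDiffOn ℝ ∞ G U := zB.contDiff.comp_contDiffOn h.smooth_f
  have hcs : ContDiffOn ℝ ∞ c U := h.contDiffOn_phase
  have hk₀ : l ^ 2 * (r ^ 2 * Complex.normSq c₀ - k ^ 2) = 1 := by rw [hc₀]; exact hcon
  have hk : ∀ z ∈ U, l ^ 2 * (r ^ 2 * Complex.normSq (c z) - k ^ 2) = 1 := fun z hz => by
    rw [hcdef]
    simp only
    rw [hnorm z hz]; exact hcon
  -- The initial values, recovered at every point of the patch.
  let P : Plane → ℂ := fun z => transport r α β k l (-(z 0)) (c z) (F z) (G z)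
  let Q : Plane → ℂ := fun z => transport r α β k l (-(z 0)) (c z) (G z) (F z)
  have hx0 : ContDiffOn ℝ ∞ (fun z : Plane => z 0) U := by fun_prop
  have hP : ContDiffOn ℝ ∞ P U := contDiffOn_transport_neg hx0 hcs hF hG
  have hQ : ContDiffOn ℝ ∞ Q U := contDiffOn_transport_neg hx0 hcs hG hF
  have hFP : ∀ z ∈ U, F z = transport r α β k l (z 0) c₀ (P z) (Q z) := by
    intro z hz
    have h1 := transport_transport_neg (α := α) (β := β) (z 0) (hk z hz) (F z) (G z)
    have h2 : cis (2 * -(α * z 0)) * c z = c₀ := by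
      simp only [hcdef, hc z hz]
      rw [← mul_assoc, mul_neg, cis_neg_mul, one_mul]
    rw [h2] at h1
    exact h1.symm
  have hGP : ∀ z ∈ U, G z = transport r α β k l (z 0) c₀ (Q z) (P z) := by
    intro z hz
    have h1 := transport_transport_neg (α := α) (β := β) (z 0) (hk z hz) (G z) (F z)
    have h2 : cis (2 * -(α * z 0)) * c z = c₀ := by
      simp only [hcdef, hc z hz]
      rw [← mul_assoc, mul_neg, cis_neg_mul, one_mul]
    rw [h2] at h1
    exact h1.symm
  have hPQ : ∀ z ∈ U, r ^ 2 * (Complex.normSq (Q z) - Complex.normSq (P z)) = 1 := by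
    intro z hz
    have h1 := normSq_transport (α := α) (β := β) (-(z 0)) (hk z hz) (F z) (G z)
    have h2 := congrArg Complex.re (hermitian_eq (f z) (f z))
    rw [Complex.mul_conj, Complex.mul_conj, g0_J1_self] at h2
    simp at h2
    have h3 := h.quadric z hz
    rw [← h2] at h3
    simp only [P, Q]
    linear_combination (-r ^ 2) * h1 - h3
  obtain ⟨δ, hδ, hbox⟩ := exists_box h.isOpen hz₀
  have hx₀ : z₀ 0 ∈ Set.Ioo (z₀ 0 - δ) (z₀ 0 + δ) := by constructor <;> linarith
  have hy₀ : z₀ 1 ∈ Set.Ioo (z₀ 1 - δ) (z₀ 1 + δ) := by constructor <;> linarith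
  -- They do not change along the lines of `T`.
  have hflow : ∀ x ∈ Set.Ioo (z₀ 0 - δ) (z₀ 0 + δ), ∀ y ∈ Set.Ioo (z₀ 1 - δ) (z₀ 1 + δ),
      HasDerivAt (fun x => P !₂[x, y]) 0 x ∧ HasDerivAt (fun x => Q !₂[x, y]) 0 x := by
    intro x hx' y hy'
    have hz := hbox x hx' y hy'
    have hA := hx _ hz
    obtain ⟨hnA, hnB⟩ := horizontal_eq (h.quadric _ hz) (h.orthogonal _ hz) (h.orthogonal_J1 _ hz)
    have hf' := hasDerivAt_mk_fst h.isOpen h.smooth_f hz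
    rw [hA] at hf'
    have d1 : HasDerivAt (fun x => F !₂[x, y]) (Complex.I * (α + ν * k) * F !₂[x, y] -
        ν * c !₂[x, y] * r * conj (G !₂[x, y])) x := by
      refine (zA.hasFDerivAt.comp_hasDerivAt x hf').congr_deriv ?_
      rw [horizT, ← hα, map_sub, map_smul, map_smul, zA_J1, hnA, Complex.real_smul,
        Complex.real_smul]
      push_cast; ring
    have d2 : HasDerivAt (fun x => G !₂[x, y]) (Complex.I * (α + ν * k) * G !₂[x, y] -
        ν * c !₂[x, y] * r * conj (F !₂[x, y])) x := by
      refine (zB.hasFDerivAt.comp_hasDerivAt x hf').congr_deriv ?_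
      rw [horizT, ← hα, map_sub, map_smul, map_smul, zB_J1, hnB, Complex.real_smul,
        Complex.real_smul]
      push_cast; ring
    have d3 : HasDerivAt (fun x => c !₂[x, y]) (Complex.I * (2 * α) * c !₂[x, y]) x := by
      have e1 : HasDerivAt (fun x => cis (2 * (α * x)) * c₀)
          (Complex.I * (2 * α) * (cis (2 * (α * x)) * c₀)) x := by
        have e2 := ((hasDerivAt_cis (2 * (α * x))).scomp x
          (((hasDerivAt_id x).const_mul α).const_mul 2)).mul_const c₀
        refine e2.congr_deriv ?_
        rw [Complex.real_smul]; push_cast; ring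
      have e3 : c !₂[x, y] = cis (2 * (α * x)) * c₀ := hc _ hz
      rw [← e3] at e1
      refine e1.congr_of_eventuallyEq ?_
      filter_upwards [isOpen_Ioo.mem_nhds hx'] with x' hx''
      exact hc _ (hbox x' hx'' y hy')
    exact ⟨hasDerivAt_transport_neg hβ (x := id) (c := fun x => c !₂[x, y])
        (F := fun x => F !₂[x, y]) (G := fun x => G !₂[x, y]) (hk _ hz) (hasDerivAt_id x) d3 d1 d2,
      hasDerivAt_transport_neg hβ (x := id) (c := fun x => c !₂[x, y])
        (F := fun x => G !₂[x, y]) (G := fun x => F !₂[x, y]) (hk _ hz) (hasDerivAt_id x) d3 d2 d1⟩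
  have hconst : ∀ x ∈ Set.Ioo (z₀ 0 - δ) (z₀ 0 + δ), ∀ y ∈ Set.Ioo (z₀ 1 - δ) (z₀ 1 + δ),
      P !₂[x, y] = P !₂[z₀ 0, y] ∧ Q !₂[x, y] = Q !₂[z₀ 0, y] := by
    intro x hx' y hy'
    constructor
    · exact isOpen_Ioo.is_const_of_deriv_eq_zero isPreconnected_Ioo
        (f := fun x => P !₂[x, y])
        (fun x hx => (hflow x hx y hy').1.differentiableAt.differentiableWithinAt)
        (fun x hx => (hflow x hx y hy').1.deriv) hx' hx₀
    · exact isOpen_Ioo.is_const_of_deriv_eq_zero isPreconnected_Ioo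
        (f := fun x => Q !₂[x, y])
        (fun x hx => (hflow x hx y hy').2.differentiableAt.differentiableWithinAt)
        (fun x hx => (hflow x hx y hy').2.deriv) hx' hx₀
  let p : ℝ → ℂ := fun y => P !₂[z₀ 0, y]
  let q : ℝ → ℂ := fun y => Q !₂[z₀ 0, y]
  have hmk : ContDiff ℝ ∞ (fun y : ℝ => (!₂[z₀ 0, y] : Plane)) := by
    rw [contDiff_euclidean]
    intro i
    fin_cases i
    · exact contDiff_const
    · exact contDiff_id
  have hp : ContDiffOn ℝ ∞ p (Set.Ioo (z₀ 1 - δ) (z₀ 1 + δ)) :=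
    hP.comp hmk.contDiffOn fun y hy' => hbox _ hx₀ y hy'
  have hq : ContDiffOn ℝ ∞ q (Set.Ioo (z₀ 1 - δ) (z₀ 1 + δ)) :=
    hQ.comp hmk.contDiffOn fun y hy' => hbox _ hx₀ y hy'
  have hder : ∀ {u : ℝ → ℂ}, ContDiffOn ℝ ∞ u (Set.Ioo (z₀ 1 - δ) (z₀ 1 + δ)) →
      ∀ y ∈ Set.Ioo (z₀ 1 - δ) (z₀ 1 + δ), HasDerivAt u (deriv u y) y := fun hu y hy' =>
    ((hu.contDiffAt (isOpen_Ioo.mem_nhds hy')).differentiableAt (by simp)).hasDerivAt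
  -- The derivative of the patch in the direction of `y`, in terms of the initial values.
  have hFy : ∀ y ∈ Set.Ioo (z₀ 1 - δ) (z₀ 1 + δ),
      zA (fderiv ℝ f !₂[z₀ 0, y] (EuclideanSpace.single 1 1)) =
        transport r α β k l (z₀ 0) c₀ (deriv p y) (deriv q y) ∧
      zB (fderiv ℝ f !₂[z₀ 0, y] (EuclideanSpace.single 1 1)) =
        transport r α β k l (z₀ 0) c₀ (deriv q y) (deriv p y) := by
    intro y hy'
    have hz := hbox _ hx₀ y hy'
    have hf' := hasDerivAt_mk_snd h.isOpen h.smooth_f hz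
    have hev := isOpen_Ioo.mem_nhds hy'
    constructor
    · refine (zA.hasFDerivAt.comp_hasDerivAt y hf').unique
        ((hasDerivAt_transport_initial (hder hp y hy') (hder hq y hy')).congr_of_eventuallyEq ?_)
      filter_upwards [hev] with y' hy''
      exact hFP _ (hbox _ hx₀ y' hy'')
    · refine (zB.hasFDerivAt.comp_hasDerivAt y hf').unique
        ((hasDerivAt_transport_initial (hder hq y hy') (hder hp y hy')).congr_of_eventuallyEq ?_)
      filter_upwards [hev] with y' hy''
      exact hGP _ (hbox _ hx₀ y' hy'')
  have hconormal : ∀ y ∈ Set.Ioo (z₀ 1 - δ) (z₀ 1 + δ),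
      conormal r k c₀ (p y) (q y) (deriv p y) (deriv q y) = 0 := by
    intro y hy'
    have hz := hbox _ hx₀ y hy'
    have h1 := h.tangent _ hz (EuclideanSpace.single 1 1)
    rw [conormal_eq (h.quadric _ hz) (h.orthogonal _ hz) (h.orthogonal_J1 _ hz),
      (hFy y hy').1, (hFy y hy').2, hc _ hz] at h1
    have h2 := hFP _ hz
    have h3 := hGP _ hz
    simp only [hFdef, hGdef] at h2 h3
    rw [h2, h3] at h1
    rwa [← conormal_transport (α := α) (β := β) (z₀ 0) hk₀]
  have hpq0 : p (z₀ 1) = 0 → deriv p (z₀ 1) ≠ 0 := by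
    intro hp0 hp1
    apply hy z₀ hz₀
    -- Here the conormal condition gives `Im (q' q̄) = 0`, and `|q|² - |p|²` is constant.
    have hq1 : deriv q (z₀ 1) = 0 := by
      have hne : ∀ y ∈ Set.Ioo (z₀ 1 - δ) (z₀ 1 + δ),
          q y * conj (q y) - p y * conj (p y) = ((1 / r ^ 2 : ℝ) : ℂ) := by
        intro y hy'
        have e1 := hPQ _ (hbox _ hx₀ y hy')
        rw [Complex.mul_conj, Complex.mul_conj, ← Complex.ofReal_sub, ← e1]
        congr 1
        simp only [p, q]
        field_simp
      have d1 := (((hder hq _ hy₀).fun_mul (hder hq _ hy₀).star).fun_sub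
        ((hder hp _ hy₀).fun_mul (hder hp _ hy₀).star))
      have d2 := (d1.congr_of_eventuallyEq (f₁ := fun _ => ((1 / r ^ 2 : ℝ) : ℂ)) (by
        filter_upwards [isOpen_Ioo.mem_nhds hy₀] with y hy'
        exact (hne y hy').symm)).unique (hasDerivAt_const _ _)
      have e2 := hne _ hy₀
      have e3 := hconormal _ hy₀
      rw [hp0, hp1] at e3 d2
      rw [hp0] at e2
      have hlam0 : lam ≠ 0 := by rcases hlam with rfl | rfl <;> norm_num
      have hk0 : k ≠ 0 := mul_ne_zero (mul_ne_zero (mul_ne_zero hlam0 hν) hτ.ne') hr.ne'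
      have him : (deriv q (z₀ 1) * conj (q (z₀ 1))).im = 0 := by
        simp [conormal, hk0] at e3 ⊢
        linarith
      have hre : (deriv q (z₀ 1) * conj (q (z₀ 1))).re = 0 := by
        have e4 := congrArg Complex.re d2
        simp at e4 ⊢
        linarith
      have hz : deriv q (z₀ 1) * conj (q (z₀ 1)) = 0 := Complex.ext hre him
      rcases mul_eq_zero.1 hz with e5 | e5
      · exact e5
      · rw [e5] at e2
        exfalso
        have e6 : (1 / r ^ 2 : ℝ) = 0 := by
          apply Complex.ofReal_injective
          rw [← e2]; simp
        have : 0 < 1 / r ^ 2 := by positivity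
        linarith
    have h1 := hFy _ hy₀
    rw [hp1, hq1, ← plane_eq] at h1
    apply ext_zA_zB
    · rw [h1.1]; simp [transport]
    · rw [h1.2]; simp [transport]
  obtain ⟨δ', ξ₁, ξ₂, ξ₃, hδ', hsub, h₁, h₂, h₃, hpolar⟩ :=
    exists_hyperbolic_polar hy₀ (a := fun y => omega ξ * (r * conj (q y))) (b := fun y => r * p y)
      (contDiffOn_const.mul (contDiffOn_const.mul (Complex.conjCLE.contDiff.comp_contDiffOn hq)))
      (contDiffOn_const.mul hp)
      (by
        intro y hy'
        have h1 := hPQ _ (hbox _ hx₀ y hy')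
        simp only [map_mul, normSq_omega, Complex.normSq_ofReal, Complex.normSq_conj]
        simp only [p, q]
        linarith)
      (by
        intro h0
        have h1 : p (z₀ 1) = 0 := by simpa [hr0] using h0
        rw [deriv_const_mul _ (hder hp _ hy₀).differentiableAt]
        exact mul_ne_zero hr0 (hpq0 h1))
  have hω : conj (omega ξ) * omega ξ = 1 := by
    rw [mul_comm, Complex.mul_conj, normSq_omega, Complex.ofReal_one]
  have hpB : ∀ y ∈ Set.Ioo (z₀ 1 - δ') (z₀ 1 + δ'), polarB (ξ₁ y) (ξ₃ y) = r * p y :=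
    fun y hy' => (hpolar y hy').2.symm
  have hqA : ∀ y ∈ Set.Ioo (z₀ 1 - δ') (z₀ 1 + δ'),
      polarA (ξ₁ y) (ξ₂ y) = omega ξ * (r * conj (q y)) :=
    fun y hy' => (hpolar y hy').1.symm
  have hq_eq : ∀ w : ℂ, omega ξ * conj (omega ξ * (r * conj w)) / (r : ℝ) = w := by
    intro w
    simp only [map_mul, Complex.conj_conj, Complex.conj_ofReal]
    field_simp
    linear_combination w * hω
  refine ⟨{z | z 0 ∈ Set.Ioo (z₀ 0 - δ) (z₀ 0 + δ) ∧ z 1 ∈ Set.Ioo (z₀ 1 - δ') (z₀ 1 + δ')},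
    ?_, ?_, ?_, z₀ 1 - δ', z₀ 1 + δ', ξ, ξ₁, ξ₂, ξ₃, h₁, h₂, h₃, ?_, ?_⟩
  · exact (isOpen_Ioo.preimage (by fun_prop : Continuous fun z : Plane => z 0)).inter
      (isOpen_Ioo.preimage (by fun_prop : Continuous fun z : Plane => z 1))
  · exact ⟨hx₀, by constructor <;> linarith⟩
  · rintro z ⟨hz0, hz1⟩
    rw [plane_eq z]
    exact hbox _ hz0 _ (hsub hz1)
  · intro y hy'
    refine ⟨matA_isometry _ _ _ _, matA_commute _ _ _ _, ?_⟩
    have hdiff : ∀ {u : ℝ → ℝ}, ContDiffOn ℝ ∞ u (Set.Ioo (z₀ 1 - δ') (z₀ 1 + δ')) →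
        DifferentiableAt ℝ u y := fun hu =>
      (hu.contDiffAt (isOpen_Ioo.mem_nhds hy')).differentiableAt (by simp)
    rw [constraint_iff hκ hν ξ (hdiff h₁) (hdiff h₂) (hdiff h₃), hξ, hpB y hy', hqA y hy']
    have e1 : deriv (fun y => polarB (ξ₁ y) (ξ₃ y)) y = r * deriv p y := by
      rw [← deriv_const_mul _ (hder hp _ (hsub hy')).differentiableAt]
      apply Filter.EventuallyEq.deriv_eq
      filter_upwards [isOpen_Ioo.mem_nhds hy'] with y' hy'' using hpB y' hy''
    have e2 : deriv (fun y => polarA (ξ₁ y) (ξ₂ y)) y = omega ξ * (r * conj (deriv q y)) := by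
      have e3 := (((hder hq _ (hsub hy')).star.const_mul (r : ℂ)).const_mul (omega ξ))
      rw [← RCLike.star_def, ← e3.deriv]
      apply Filter.EventuallyEq.deriv_eq
      filter_upwards [isOpen_Ioo.mem_nhds hy'] with y' hy'' using hqA y' hy''
    rw [e1, e2, hq_eq, hq_eq, mul_div_cancel_left₀ _ hr0, mul_div_cancel_left₀ _ hr0]
    exact hconormal y (hsub hy')
  · rintro z ⟨hz0, hz1⟩
    refine ⟨hz1, ?_⟩
    have hzU : z ∈ U := by
      rw [plane_eq z]
      exact hbox _ hz0 _ (hsub hz1)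
    obtain ⟨e1, e2⟩ := hconst _ hz0 _ (hsub hz1)
    rw [← plane_eq z] at e1 e2
    obtain ⟨m1, m2⟩ := matA_helixGamma (lam := lam) (τ := τ) hκ hν hB ξ (ξ₁ (z 1)) (ξ₂ (z 1))
      (ξ₃ (z 1)) (z 0)
    rw [hpB _ hz1, hqA _ hz1, hξ, hq_eq, mul_div_cancel_left₀ _ hr0] at m1 m2
    apply ext_zA_zB
    · exact ((hFP z hzU).trans (by rw [e1, e2])).trans m1.symm
    · exact ((hGP z hzU).trans (by rw [e1, e2])).trans m2.symm

/-! ### The Berger-like metric and the horizontal part of the normal -/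

section Pointwise

variable {κ τ lam ν : ℝ}

lemma half_sqrt_sq (hκ : 0 < κ) : (√κ / 2) ^ 2 = κ / 4 := by
  rw [div_pow, Real.sq_sqrt hκ.le]; norm_num

lemma mem_adS_iff (hκ : 0 < κ) (q : Fin 4 → ℝ) :
    q ∈ adS κ ↔ (√κ / 2) ^ 2 * g0 q q = -1 := by
  rw [adS, Set.mem_ofPred_eq, half_sqrt_sq hκ]
  constructor
  · intro h; rw [h]; field_simp
  · intro h; field_simp; linarith

lemma g0_X1_X1 {q : Fin 4 → ℝ} (hq : (√κ / 2) ^ 2 * g0 q q = -1) :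
    g0 (X1 κ q) (X1 κ q) = -1 := by
  rw [X1, g0_smul_left, g0_smul_right, g0_J1_J1, ← hq]; ring

lemma g0_self_X1 (q : Fin 4 → ℝ) : g0 q (X1 κ q) = 0 := by
  rw [X1, g0_smul_right, g0_J1_self, mul_zero]

lemma gτ_E1 (hτ : 0 < τ) {q : Fin 4 → ℝ} (hq : (√κ / 2) ^ 2 * g0 q q = -1) (v : Fin 4 → ℝ) :
    gτ κ τ q v (E1 κ τ q) = τ * g0 v (X1 κ q) := by
  rw [gτ, E1, g0_smul_right, g0_smul_left, g0_X1_X1 hq]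
  field_simp
  ring

lemma gτ_of_g0_X1_eq_zero {q v w : Fin 4 → ℝ} (hw : g0 w (X1 κ q) = 0) :
    gτ κ τ q v w = g0 v w := by
  rw [gτ, hw, mul_zero, add_zero]

lemma gτ_sub_left (q u v w : Fin 4 → ℝ) : gτ κ τ q (u - v) w = gτ κ τ q u w - gτ κ τ q v w := by
  simp only [gτ, g0_sub_left]; ring

lemma gτ_smul_left (c : ℝ) (q u w : Fin 4 → ℝ) : gτ κ τ q (c • u) w = c * gτ κ τ q u w := by
  simp only [gτ, g0_smul_left]; ring

/-- For a unit normal `N = n - lam ν E₁`, the metric conditions on `N` amount to the conditions on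
its horizontal part `n`. -/
lemma normal_iff (hτ : 0 < τ) (hlam : lam = 1 ∨ lam = -1) {q N n : Fin 4 → ℝ}
    (hq : (√κ / 2) ^ 2 * g0 q q = -1) (hn : n = N + (lam * ν) • E1 κ τ q) :
    (g0 q N = 0 ∧ gτ κ τ q N N = lam ∧ lam * gτ κ τ q N (E1 κ τ q) = ν) ↔
      (g0 q n = 0 ∧ g0 q (J1 *ᵥ n) = 0 ∧ g0 n n = lam + ν ^ 2) := by
  have hl := lam_sq hlam
  have hX := g0_X1_X1 hq
  have hqX := g0_self_X1 (κ := κ) q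
  have hr : √κ / 2 ≠ 0 := by
    rintro h; rw [h] at hq; norm_num at hq
  have hJ : √κ / 2 * g0 q (J1 *ᵥ n) = -(g0 N (X1 κ q) - lam * ν * τ⁻¹) := by
    have : √κ / 2 * g0 q (J1 *ᵥ n) = -g0 n (X1 κ q) := by
      rw [g0_comm n, X1, g0_smul_left, g0_J1_left]; ring
    rw [this, hn, g0_add_left, g0_smul_left, E1, g0_smul_left, hX]; ring
  have h1 : g0 q n = g0 q N := by
    rw [hn, g0_add_right, g0_smul_right, E1, g0_smul_right, hqX]; ring
  have h2 : g0 n n = g0 N N + 2 * (lam * ν * τ⁻¹) * g0 N (X1 κ q) - (lam * ν * τ⁻¹) ^ 2 := by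
    rw [hn]
    simp only [g0_add_left, g0_add_right, g0_smul_left, g0_smul_right, E1, hX,
      g0_comm (X1 κ q) N]
    ring
  rw [h1, h2, gτ_E1 hτ hq, gτ]
  constructor
  · rintro ⟨a, b, c⟩
    have hNX : g0 N (X1 κ q) = lam * ν * τ⁻¹ := by
      field_simp
      linear_combination lam * c - τ * g0 N (X1 κ q) * hl
    refine ⟨a, ?_, ?_⟩
    · rw [hNX, sub_self, neg_zero] at hJ
      exact (mul_eq_zero.1 hJ).resolve_left hr
    · rw [hNX] at b ⊢
      have : τ * τ⁻¹ = 1 := mul_inv_cancel₀ hτ.ne'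
      linear_combination b + ν ^ 2 * hl + lam ^ 2 * ν ^ 2 * (τ * τ⁻¹ + 1) * this
  · rintro ⟨a, b, c⟩
    have hNX : g0 N (X1 κ q) = lam * ν * τ⁻¹ := by
      rw [b, mul_zero] at hJ; linarith
    have : τ * τ⁻¹ = 1 := mul_inv_cancel₀ hτ.ne'
    refine ⟨a, ?_, ?_⟩
    · rw [hNX] at c ⊢
      linear_combination c - ν ^ 2 * hl - lam ^ 2 * ν ^ 2 * (τ * τ⁻¹ + 1) * this
    · rw [hNX]
      linear_combination lam ^ 2 * ν * this + ν * hl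

/-- The form `g_τ(·, N)` is the `g0`-product with `n - lam ν τ (√κ / 2) J₁q`, which is therefore
conormal to the surface. -/
lemma gτ_normal (hτ : 0 < τ) {q N n : Fin 4 → ℝ}
    (hq : (√κ / 2) ^ 2 * g0 q q = -1) (hn : n = N + (lam * ν) • E1 κ τ q)
    (hfJn : g0 q (J1 *ᵥ n) = 0) (v : Fin 4 → ℝ) :
    gτ κ τ q v N = g0 v (n - (lam * ν * τ * (√κ / 2)) • (J1 *ᵥ q)) := by
  have hJ : g0 (J1 *ᵥ q) n = 0 := by rw [g0_J1_left, hfJn, neg_zero]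
  have hN : N = n - (lam * ν) • E1 κ τ q := by rw [hn]; abel
  have hNX : g0 N (X1 κ q) = lam * ν * τ⁻¹ := by
    have h1 : g0 n (X1 κ q) = 0 := by rw [g0_comm, X1, g0_smul_left, hJ, mul_zero]
    rw [hN, g0_sub_left, g0_smul_left, E1, g0_smul_left, g0_X1_X1 hq, h1]; ring
  have hX : g0 v (J1 *ᵥ q) * (√κ / 2) = g0 v (X1 κ q) := by rw [X1, g0_smul_right]; ring
  rw [gτ, hNX, g0_sub_right, g0_smul_right]
  have h2 : g0 v N = g0 v n - lam * ν * τ⁻¹ * g0 v (X1 κ q) := by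
    rw [hN, g0_sub_right, g0_smul_right, E1, g0_smul_right]; ring
  have : τ * τ⁻¹ = 1 := mul_inv_cancel₀ hτ.ne'
  rw [h2]
  linear_combination (lam * ν * τ) * hX - lam * ν * τ * g0 v (X1 κ q) * this

lemma J1_J2 (q : Fin 4 → ℝ) : J1 *ᵥ (J2 *ᵥ q) = J3 *ᵥ q := by
  ext i; fin_cases i <;> simp [J1_mulVec, J2_mulVec, J3_mulVec]

lemma horizT_eq (hlam : lam = 1 ∨ lam = -1) {q N n : Fin 4 → ℝ}
    (hn : n = N + (lam * ν) • E1 κ τ q) :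
    horizT (√κ / 2) τ lam ν q n = E1 κ τ q - ν • N := by
  have hl := lam_sq hlam
  have hl' : lam * (lam + ν ^ 2) * (√κ / 2) / τ = (1 + lam * ν ^ 2) * (τ⁻¹ * (√κ / 2)) := by
    rw [← hl]; ring
  rw [horizT, hl', hn, E1, X1]
  module

/-- `JT = N ∧ T` is `-J₁n`. -/
lemma wedge_eq (hτ : 0 < τ) {q N n : Fin 4 → ℝ}
    (hq : (√κ / 2) ^ 2 * g0 q q = -1) (hn : n = N + (lam * ν) • E1 κ τ q)
    (hfn : g0 q n = 0) (hfJn : g0 q (J1 *ᵥ n) = 0) :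
    wedge κ τ q N (E1 κ τ q - ν • N) = -(J1 *ᵥ n) := by
  have e22 : g0 (E2 κ q) (E2 κ q) = 1 := by
    have : g0 (J2 *ᵥ q) (J2 *ᵥ q) = -g0 q q := by
      simp only [g0, J2_mulVec]; simp; ring
    rw [E2, g0_smul_left, g0_smul_right, this]; linarith
  have hJE : J1 *ᵥ E2 κ q = E3 κ q := by rw [E2, E3, Matrix.mulVec_smul, J1_J2]
  have h2q : g0 q (E2 κ q) = 0 := by
    rw [E2, g0_smul_right]
    have : g0 q (J2 *ᵥ q) = 0 := by simp only [g0, J2_mulVec]; simp; ring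
    rw [this, mul_zero]
  have h3q : g0 q (E3 κ q) = 0 := by
    rw [E3, g0_smul_right]
    have : g0 q (J3 *ᵥ q) = 0 := by simp only [g0, J3_mulVec]; simp; ring
    rw [this, mul_zero]
  have h2X : g0 (E2 κ q) (X1 κ q) = 0 := by
    rw [X1, g0_smul_right]
    have := g0_J1_left (E2 κ q) q
    rw [hJE, g0_comm, h3q] at this
    rw [← neg_eq_zero, ← mul_neg, ← this, mul_zero]
  have h3X : g0 (E3 κ q) (X1 κ q) = 0 := by
    rw [X1, g0_smul_right, ← hJE, g0_J1_J1, g0_comm, h2q, mul_zero]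
  have hexp := orthogonal_expansion one_ne_zero hq h2q (by rw [hJE, h3q]) e22 n
  have hnJ : g0 n (J1 *ᵥ q) = 0 := by rw [g0_comm, g0_J1_left, hfJn, neg_zero]
  rw [hJE, g0_comm n q, hfn, hnJ] at hexp
  simp only [mul_zero, neg_zero, zero_smul, sub_zero, zero_add, div_one] at hexp
  have hEE : gτ κ τ q (E1 κ τ q) (E1 κ τ q) = -1 := by
    rw [gτ_E1 hτ hq, E1, g0_smul_left, g0_X1_X1 hq]; field_simp
  have hE2 : gτ κ τ q (E1 κ τ q) (E2 κ q) = 0 := by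
    rw [gτ_of_g0_X1_eq_zero h2X, E1, g0_smul_left, g0_comm, h2X, mul_zero]
  have hE3 : gτ κ τ q (E1 κ τ q) (E3 κ q) = 0 := by
    rw [gτ_of_g0_X1_eq_zero h3X, E1, g0_smul_left, g0_comm, h3X, mul_zero]
  have hN2 : gτ κ τ q N (E2 κ q) = g0 n (E2 κ q) := by
    rw [gτ_of_g0_X1_eq_zero h2X, hn, g0_add_left, g0_smul_left, E1, g0_smul_left,
      g0_comm (X1 κ q), h2X]; ring
  have hN3 : gτ κ τ q N (E3 κ q) = g0 n (E3 κ q) := by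
    rw [gτ_of_g0_X1_eq_zero h3X, hn, g0_add_left, g0_smul_left, E1, g0_smul_left,
      g0_comm (X1 κ q), h3X]; ring
  have hJn : J1 *ᵥ n = g0 n (E2 κ q) • E3 κ q - g0 n (E3 κ q) • E2 κ q := by
    conv_lhs => rw [hexp]
    rw [Matrix.mulVec_add, Matrix.mulVec_smul, Matrix.mulVec_smul, hJE, ← hJE, J1_J1]
    module
  rw [wedge, hJn]
  simp only [gτ_sub_left, gτ_smul_left, hEE, hE2, hE3, hN2, hN3]
  module

end Pointwise

/-! ### Helix surfaces and their patches -/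

section

variable {M : Type*} {κ τ lam ν : ℝ} {F N : M → (Fin 4 → ℝ)}

/-- The horizontal part `N + lam ν E₁` of the normal field: since `g_τ(E₁, E₁) = -1` and
`lam g_τ(N, E₁) = ν`, it is orthogonal to the Hopf direction. -/
noncomputable def horizontalNormal (κ τ lam ν : ℝ) (F N : M → (Fin 4 → ℝ)) (p : M) : Fin 4 → ℝ :=
  N p + (lam * ν) • E1 κ τ (F p)

lemma tangentT_eq (hlam : lam = 1 ∨ lam = -1) (p : M) :
    tangentT κ τ ν F N p = horizT (√κ / 2) τ lam ν (F p) (horizontalNormal κ τ lam ν F N p) :=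
  (horizT_eq hlam rfl).symm

/-- The helix form can be checked on the representation `F ∘ e.symm` of `F` in local coordinates. -/
lemma HasHelixForm.of_comp_symm [TopologicalSpace M] {e : OpenPartialHomeomorph M Plane}
    {V : Set Plane}
    (h : HasHelixForm κ τ lam ν (F ∘ e.symm) (OpenPartialHomeomorph.refl Plane) V) :
    HasHelixForm κ τ lam ν F e (e.source ∩ e ⁻¹' V) := by
  obtain ⟨c, d, ξ, ξ₁, ξ₂, ξ₃, h₁, h₂, h₃, hA, hV⟩ := h
  refine ⟨c, d, ξ, ξ₁, ξ₂, ξ₃, h₁, h₂, h₃, hA, fun q hq => ?_⟩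
  have h := hV (e q) hq.2
  simp only [OpenPartialHomeomorph.refl_apply, Function.comp_apply, e.left_inv hq.1] at h
  exact h

end

section Manifold

variable {M : Type*} [TopologicalSpace M] [ChartedSpace Plane M]
  {κ τ lam ν : ℝ} {F N : M → (Fin 4 → ℝ)}

/-- The derivative of a map in local coordinates, and its derivative as a map on the manifold, agree
up to a linear isomorphism. -/
lemma exists_fderiv_comp_symm [IsManifold (𝓡 2) ∞ M]
    {e : OpenPartialHomeomorph M Plane} (he : e ∈ IsManifold.maximalAtlas (𝓡 2) ∞ M)
    (hF : ContMDiff (𝓡 2) 𝓘(ℝ, Fin 4 → ℝ) ∞ F) {z : Plane} (hz : z ∈ e.target) :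
    ∃ A : Plane → TangentSpace (𝓡 2) (e.symm z), Function.Injective A ∧
      ∀ v, fderiv ℝ (F ∘ e.symm) z v = mfderiv (𝓡 2) 𝓘(ℝ, Fin 4 → ℝ) F (e.symm z) (A v) := by
  have hed : e.MDifferentiable (𝓡 2) (𝓡 2) :=
    ⟨(contMDiffOn_of_mem_maximalAtlas he).mdifferentiableOn (by simp),
      (contMDiffOn_symm_of_mem_maximalAtlas he).mdifferentiableOn (by simp)⟩
  refine ⟨mfderiv (𝓡 2) (𝓡 2) e.symm z, hed.symm.mfderiv_injective hz, fun v => ?_⟩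
  rw [← mfderiv_eq_fderiv, mfderiv_comp z ((hF _).mdifferentiableAt (by simp))
    (hed.mdifferentiableAt_symm hz)]
  rfl

lemma contDiffOn_comp_symm [IsManifold (𝓡 2) ∞ M]
    {e : OpenPartialHomeomorph M Plane} (he : e ∈ IsManifold.maximalAtlas (𝓡 2) ∞ M)
    (hF : ContMDiff (𝓡 2) 𝓘(ℝ, Fin 4 → ℝ) ∞ F) : ContDiffOn ℝ ∞ (F ∘ e.symm) e.target := by
  rw [← contMDiffOn_iff_contDiffOn]
  exact hF.comp_contMDiffOn (contMDiffOn_symm_of_mem_maximalAtlas he)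

lemma IsHelixSurface.normal_iff (h : IsHelixSurface κ τ lam ν F N) (hκ : 0 < κ) (hτ : 0 < τ)
    (hlam : lam = 1 ∨ lam = -1) (p : M) :
    (√κ / 2) ^ 2 * g0 (F p) (F p) = -1 ∧ g0 (F p) (horizontalNormal κ τ lam ν F N p) = 0 ∧
      g0 (F p) (J1 *ᵥ horizontalNormal κ τ lam ν F N p) = 0 ∧
      g0 (horizontalNormal κ τ lam ν F N p) (horizontalNormal κ τ lam ν F N p) = lam + ν ^ 2 := by
  have hq := (mem_adS_iff hκ _).1 (h.mem p)
  exact ⟨hq, (AntiDeSitter.normal_iff hτ hlam hq rfl).1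
    ⟨h.normal_tangent p, h.normal_unit p, h.angle p⟩⟩

lemma IsHelixSurface.helixPatch [IsManifold (𝓡 2) ∞ M]
    (h : IsHelixSurface κ τ lam ν F N) (hκ : 0 < κ) (hτ : 0 < τ) (hlam : lam = 1 ∨ lam = -1)
    {e : OpenPartialHomeomorph M Plane} (he : e ∈ IsManifold.maximalAtlas (𝓡 2) ∞ M) :
    HelixPatch (√κ / 2) τ lam ν e.target (F ∘ e.symm)
        (horizontalNormal κ τ lam ν F N ∘ e.symm) where
  isOpen := e.open_target
  smooth_f := contDiffOn_comp_symm he h.smooth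
  smooth_n := (contDiffOn_comp_symm he h.smooth_normal).add
    ((((contDiffOn_J1 (contDiffOn_comp_symm he h.smooth)).const_smul (√κ / 2)).const_smul
      τ⁻¹).const_smul (lam * ν))
  quadric z _ := (h.normal_iff hκ hτ hlam _).1
  orthogonal z _ := (h.normal_iff hκ hτ hlam _).2.1
  orthogonal_J1 z _ := (h.normal_iff hκ hτ hlam _).2.2.1
  unit z _ := (h.normal_iff hκ hτ hlam _).2.2.2
  tangent z hz v := by
    obtain ⟨A, -, hA⟩ := exists_fderiv_comp_symm he h.smooth hz
    obtain ⟨h1, h2, h3, h4⟩ := h.normal_iff hκ hτ hlam (e.symm z)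
    rw [hA]
    exact (gτ_normal hτ h1 rfl h3 _).symm.trans (h.normal_orthogonal _ _)

lemma IsHelixSurface.fderiv_injective [IsManifold (𝓡 2) ∞ M]
    (h : IsHelixSurface κ τ lam ν F N)
    {e : OpenPartialHomeomorph M Plane} (he : e ∈ IsManifold.maximalAtlas (𝓡 2) ∞ M)
    {z : Plane} (hz : z ∈ e.target) : Function.Injective (fderiv ℝ (F ∘ e.symm) z) := by
  obtain ⟨A, hAi, hA⟩ := exists_fderiv_comp_symm he h.smooth hz
  intro v w hvw
  rw [hA, hA] at hvw
  exact hAi (h.immersion _ hvw)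

lemma IsHelixSurface.tangentJT_eq (h : IsHelixSurface κ τ lam ν F N) (hκ : 0 < κ) (hτ : 0 < τ)
    (hlam : lam = 1 ∨ lam = -1) (p : M) :
    tangentJT κ τ ν F N p = -(J1 *ᵥ horizontalNormal κ τ lam ν F N p) := by
  obtain ⟨h1, h2, h3, h4⟩ := h.normal_iff hκ hτ hlam p
  exact wedge_eq hτ h1 rfl h2 h3

end Manifold

/-! ### The phase in adapted coordinates -/

namespace HelixPatch

variable {r τ lam ν : ℝ} {U : Set Plane} {f n : Plane → Fin 4 → ℝ}

/-- The phase of the horizontal normal turns at constant speed along the lines of `T`. -/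
lemma fderiv_phase_T (h : HelixPatch r τ lam ν U f n) (hr : r ≠ 0) (hL : lam + ν ^ 2 ≠ 0)
    {z : Plane} (hz : z ∈ U) {v w : Plane}
    (hv : fderiv ℝ f z v = horizT r τ lam ν (f z) (n z)) (hw : fderiv ℝ f z w = -(J1 *ᵥ n z)) :
    fderiv ℝ (fun z => phase r (f z) (n z)) z v =
      Complex.I * ((2 * (lam * (lam + ν ^ 2) * r / τ - ν * (lam * ν * τ * r)) : ℝ) : ℂ) *
        phase r (f z) (n z) := by
  rw [h.fderiv_phase hr hL hz, h.fderiv_n_eq hL hz hv hw, hv, horizT]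
  congr 3
  have h1 : g0 (n z) (J1 *ᵥ f z) = 0 := by
    rw [g0_comm, g0_J1_left, h.orthogonal_J1 z hz, neg_zero]
  have h2 := h.quadric z hz
  rw [g0_add_left, g0_sub_left, g0_smul_left, g0_smul_left, g0_smul_left, g0_smul_left,
    g0_J1_J1, g0_J1_J1, h.orthogonal_J1 z hz, h.unit z hz, h1]
  rw [show r ^ 2 * (lam * (lam + ν ^ 2) * r / τ * g0 (f z) (f z) - ν * 0) =
    (r ^ 2 * g0 (f z) (f z)) * (lam * (lam + ν ^ 2) * r / τ) by ring, h2]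
  field_simp
  ring

/-- In coordinates with `∂ₓ = T` and `∂_y = a T + b JT`, the equality of the mixed second
derivatives relates the rotation of the phase in the direction of `y` to `∂ₓ b`. -/
lemma fderiv_phase_y (h : HelixPatch r τ lam ν U f n) (hr : r ≠ 0) (hν : ν ≠ 0)
    (hL : lam + ν ^ 2 ≠ 0) {a b : Plane → ℝ} (ha : ContDiffOn ℝ ∞ a U) (hb : ContDiffOn ℝ ∞ b U)
    (hb0 : ∀ z ∈ U, b z ≠ 0)
    (hx : ∀ z ∈ U, fderiv ℝ f z (EuclideanSpace.single 0 1) = horizT r τ lam ν (f z) (n z))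
    (hy : ∀ z ∈ U, fderiv ℝ f z (EuclideanSpace.single 1 1) =
      a z • horizT r τ lam ν (f z) (n z) + b z • -(J1 *ᵥ n z)) {z : Plane} (hz : z ∈ U) :
    fderiv ℝ (fun z => phase r (f z) (n z)) z (EuclideanSpace.single 1 1) =
      Complex.I * ((2 * (lam * (lam + ν ^ 2) * r / τ - ν * (lam * ν * τ * r)) * a z
        + fderiv ℝ b z (EuclideanSpace.single 0 1) / ν : ℝ) : ℂ) * phase r (f z) (n z) := by
  set e₀ : Plane := EuclideanSpace.single 0 1
  set e₁ : Plane := EuclideanSpace.single 1 1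
  have hw : fderiv ℝ f z ((b z)⁻¹ • (e₁ - a z • e₀)) = -(J1 *ᵥ n z) := by
    rw [map_smul, map_sub, map_smul, hx z hz, hy z hz, add_sub_cancel_left, smul_smul,
      inv_mul_cancel₀ (hb0 z hz), one_smul]
  have hnx := h.fderiv_n_eq hL hz (hx z hz) hw
  have hsymm := fderiv_fderiv_comm h.isOpen h.smooth_f hz e₀ e₁
  have hline : ∀ {G : Type} [NormedAddCommGroup G] [NormedSpace ℝ G] {u w : Plane → G},
      (∀ z ∈ U, u z = w z) → fderiv ℝ u z = fderiv ℝ w z := fun huw =>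
    Filter.EventuallyEq.fderiv_eq (by
      filter_upwards [h.isOpen.mem_nhds hz] with z hz using huw z hz)
  rw [hline hx, hline hy] at hsymm
  -- Both sides of the symmetry relation are computed along lines.
  have dJf : ∀ v, HasDerivAt (fun t : ℝ => J1 *ᵥ f (z + t • v)) (J1 *ᵥ fderiv ℝ f z v) 0 := by
    intro v
    have h1 := hasDerivAt_line h.isOpen (contDiffOn_J1 h.smooth_f) hz v
    rwa [fderiv_J1 (h.differentiableAt_f hz)] at h1
  have dJn : ∀ v, HasDerivAt (fun t : ℝ => J1 *ᵥ n (z + t • v)) (J1 *ᵥ fderiv ℝ n z v) 0 := by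
    intro v
    have h1 := hasDerivAt_line h.isOpen (contDiffOn_J1 h.smooth_n) hz v
    rwa [fderiv_J1 (h.differentiableAt_n hz)] at h1
  have dT : ∀ v, HasDerivAt (fun t : ℝ => horizT r τ lam ν (f (z + t • v)) (n (z + t • v)))
      (horizT r τ lam ν (fderiv ℝ f z v) (fderiv ℝ n z v)) 0 := fun v =>
    ((dJf v).fun_const_smul (lam * (lam + ν ^ 2) * r / τ)).fun_sub
      ((hasDerivAt_line h.isOpen h.smooth_n hz v).fun_const_smul ν)
  have hTs : ContDiffOn ℝ ∞ (fun z => horizT r τ lam ν (f z) (n z)) U :=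
    ((contDiffOn_J1 h.smooth_f).const_smul _).sub (h.smooth_n.const_smul ν)
  have e1 : fderiv ℝ (fun z => horizT r τ lam ν (f z) (n z)) z e₁ =
      horizT r τ lam ν (fderiv ℝ f z e₁) (fderiv ℝ n z e₁) :=
    (hasDerivAt_line h.isOpen hTs hz e₁).unique (dT e₁)
  have e2 : fderiv ℝ (fun z => a z • horizT r τ lam ν (f z) (n z) + b z • -(J1 *ᵥ n z)) z e₀ =
      (a z • horizT r τ lam ν (fderiv ℝ f z e₀) (fderiv ℝ n z e₀) +
        fderiv ℝ a z e₀ • horizT r τ lam ν (f z) (n z)) +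
      (b z • -(J1 *ᵥ fderiv ℝ n z e₀) + fderiv ℝ b z e₀ • -(J1 *ᵥ n z)) := by
    have hs : ContDiffOn ℝ ∞
        (fun z => a z • horizT r τ lam ν (f z) (n z) + b z • -(J1 *ᵥ n z)) U :=
      (ha.smul hTs).add (hb.smul (contDiffOn_J1 h.smooth_n).neg)
    have h1 := (((hasDerivAt_line h.isOpen ha hz e₀).fun_smul (dT e₀)).fun_add
      ((hasDerivAt_line h.isOpen hb hz e₀).fun_smul (dJn e₀).fun_neg))
    have h2 := (hasDerivAt_line h.isOpen hs hz e₀).unique h1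
    rw [h2]
    simp
  rw [e1, e2] at hsymm
  have h3 := congrArg (fun v => g0 v (J1 *ᵥ n z)) hsymm
  have hfn := h.orthogonal z hz
  have hfJn := h.orthogonal_J1 z hz
  have hJfn : g0 (J1 *ᵥ f z) (n z) = 0 := by rw [g0_J1_left, hfJn, neg_zero]
  have hnn := h.unit z hz
  have hnJ := g0_J1_self (n z)
  have hnJf : g0 (n z) (J1 *ᵥ f z) = 0 := by rw [g0_comm, hJfn]
  have hff := h.quadric z hz
  simp only [horizT, hnx, hx z hz, hy z hz, Matrix.mulVec_add, Matrix.mulVec_sub,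
    Matrix.mulVec_smul, Matrix.mulVec_neg, J1_J1, g0_add_left, g0_sub_left, g0_neg_left,
    g0_smul_left, g0_J1_J1, hfn, hfJn, hnn, hnJ] at h3
  rw [h.fderiv_phase hr hL hz]
  congr 3
  rw [hy z hz, horizT]
  have hJnJf : g0 (J1 *ᵥ n z) (J1 *ᵥ f z) = 0 := by rw [g0_J1_J1, g0_comm, hfn]
  simp only [g0_add_left, g0_sub_left, g0_neg_left, g0_smul_left, g0_J1_J1 (f z), hnJf, hJnJf]
  have h4 : ν * g0 (fderiv ℝ n z e₁) (J1 *ᵥ n z) = a z * ν * (lam + ν ^ 2) *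
      (lam * (lam + ν ^ 2) * r / τ - 2 * ν * (lam * ν * τ * r)) +
      fderiv ℝ b z e₀ * (lam + ν ^ 2) := by
    linear_combination -h3
  have h5 : g0 (fderiv ℝ n z e₁) (J1 *ᵥ n z) / (lam + ν ^ 2) = a z *
      (lam * (lam + ν ^ 2) * r / τ - 2 * ν * (lam * ν * τ * r)) + fderiv ℝ b z e₀ / ν := by
    rw [div_eq_iff hL]
    apply mul_left_cancel₀ hν
    linear_combination h4 - (lam + ν ^ 2) * mul_div_cancel₀ (fderiv ℝ b z e₀) hν
  rw [h5]
  linear_combination (-(a z * (lam * (lam + ν ^ 2) * r / τ))) * hff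

end HelixPatch

/-- A function on the plane whose partial derivatives vanish on a ball is constant there. -/
lemma eq_of_partial_eq_zero {u : Plane → ℂ} {z₀ : Plane} {ε : ℝ}
    (hu : ContDiffOn ℝ ∞ u (Metric.ball z₀ ε))
    (h0 : ∀ z ∈ Metric.ball z₀ ε, fderiv ℝ u z (EuclideanSpace.single 0 1) = 0)
    (h1 : ∀ z ∈ Metric.ball z₀ ε, fderiv ℝ u z (EuclideanSpace.single 1 1) = 0)
    {z : Plane} (hz : z ∈ Metric.ball z₀ ε) (hz₀ : z₀ ∈ Metric.ball z₀ ε) : u z = u z₀ := by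
  refine Metric.isOpen_ball.is_const_of_fderiv_eq_zero (𝕜 := ℝ)
    (convex_ball z₀ ε).isPreconnected
    (hu.differentiableOn (by simp)) (fun w hw => ?_) hz hz₀
  have key : ∀ v : Plane, fderiv ℝ u w v = 0 := by
    intro v
    have hv : v = v 0 • EuclideanSpace.single 0 1 + v 1 • EuclideanSpace.single 1 1 := by
      ext i; fin_cases i <;> simp
    rw [hv, map_add, map_smul, map_smul, h0 w hw, h1 w hw]
    simp
  ext v
  exact key v

/-! ### Adapted coordinates -/

namespace HelixPatch

section

variable {r τ lam ν : ℝ} {U : Set Plane} {f n : Plane → Fin 4 → ℝ}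

lemma mono (h : HelixPatch r τ lam ν U f n) {V : Set Plane} (hV : IsOpen V) (hVU : V ⊆ U) :
    HelixPatch r τ lam ν V f n where
  isOpen := hV
  smooth_f := h.smooth_f.mono hVU
  smooth_n := h.smooth_n.mono hVU
  quadric z hz := h.quadric z (hVU hz)
  orthogonal z hz := h.orthogonal z (hVU hz)
  orthogonal_J1 z hz := h.orthogonal_J1 z (hVU hz)
  unit z hz := h.unit z (hVU hz)
  tangent z hz := h.tangent z (hVU hz)

lemma g0_horizT_J1 (h : HelixPatch r τ lam ν U f n) {z : Plane} (hz : z ∈ U) :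
    g0 (horizT r τ lam ν (f z) (n z)) (J1 *ᵥ n z) = 0 := by
  rw [horizT, g0_sub_left, g0_smul_left, g0_smul_left, g0_J1_J1, h.orthogonal z hz, g0_J1_self]
  ring

lemma g0_JT (h : HelixPatch r τ lam ν U f n) {z : Plane} (hz : z ∈ U) :
    g0 (-(J1 *ᵥ n z)) (J1 *ᵥ n z) = -(lam + ν ^ 2) := by
  rw [g0_neg_left, g0_J1_J1, h.unit z hz]

/-- The fields `T` and `JT` of an immersed patch come from vectors in the plane. -/
lemma exists_fderiv_eq (h : HelixPatch r τ lam ν U f n) (hr : r ≠ 0) (hτ : τ ≠ 0)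
    (hlam : lam ^ 2 = 1) (hν : ν ≠ 0) (hL : lam + ν ^ 2 ≠ 0) {z : Plane} (hz : z ∈ U)
    (hi : Function.Injective (fderiv ℝ f z)) :
    (∃ v, fderiv ℝ f z v = horizT r τ lam ν (f z) (n z)) ∧
      ∃ w, fderiv ℝ f z w = -(J1 *ᵥ n z) := by
  classical
  let S : Finset (Fin 4 → ℝ) := {horizT r τ lam ν (f z) (n z), -(J1 *ᵥ n z)}
  have hS : (S : Set (Fin 4 → ℝ)) = {horizT r τ lam ν (f z) (n z), -(J1 *ᵥ n z)} := by simp [S]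
  have hle : (fderiv ℝ f z : Plane →ₗ[ℝ] (Fin 4 → ℝ)).range ≤ Submodule.span ℝ (S : Set _) := by
    rintro _ ⟨v, rfl⟩
    rw [hS, Submodule.mem_span_pair]
    exact ⟨_, _, (h.fderiv_f_eq hr hτ hlam hν hL hz v).symm⟩
  have heq := Submodule.eq_of_le_of_finrank_le hle (by
    rw [LinearMap.finrank_range_of_inj hi, finrank_euclideanSpace_fin]
    exact (finrank_span_finset_le_card S).trans Finset.card_le_two)
  constructor
  · have : horizT r τ lam ν (f z) (n z) ∈ Submodule.span ℝ (S : Set (Fin 4 → ℝ)) :=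
      Submodule.subset_span (by simp [S])
    rw [← heq] at this
    exact this
  · have : -(J1 *ᵥ n z) ∈ Submodule.span ℝ (S : Set (Fin 4 → ℝ)) :=
      Submodule.subset_span (by simp [S])
    rw [← heq] at this
    exact this

end

section

variable {κ τ lam ν : ℝ} {U : Set Plane} {f n : Plane → Fin 4 → ℝ}

lemma fderiv_phase_T_alpha (hκ : 0 < κ) (hτ : 0 < τ)
    (hlam : lam = 1 ∨ lam = -1) (hB : helixB τ lam ν < 0)
    (h : HelixPatch (√κ / 2) τ lam ν U f n)
    {z : Plane} (hz : z ∈ U) {v w : Plane}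
    (hv : fderiv ℝ f z v = horizT (√κ / 2) τ lam ν (f z) (n z))
    (hw : fderiv ℝ f z w = -(J1 *ᵥ n z)) :
    fderiv ℝ (fun z => phase (√κ / 2) (f z) (n z)) z v =
      Complex.I * (2 * helixAlpha κ τ lam ν) * phase (√κ / 2) (f z) (n z) := by
  rw [h.fderiv_phase_T (half_sqrt_pos hκ).ne' (lam_add_sq_pos hB).ne' hz hv hw]
  have hα := helixAlpha_add (κ := κ) (ν := ν) hτ hlam
  rw [show 2 * (lam * (lam + ν ^ 2) * (√κ / 2) / τ - ν * (lam * ν * τ * (√κ / 2))) =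
    2 * helixAlpha κ τ lam ν by linear_combination -2 * hα]
  push_cast
  ring

lemma normSq_phase_eq (h : HelixPatch (√κ / 2) τ lam ν U f n) {z : Plane} (hz : z ∈ U) :
    Complex.normSq (phase (√κ / 2) (f z) (n z)) = lam + ν ^ 2 := by
  rw [normSq_phase (h.quadric z hz) (h.orthogonal z hz) (h.orthogonal_J1 z hz), h.unit z hz]

/-- In coordinates with `∂ₓ = T` and `∂_y = a T + b JT`, where `a` and `b` are such that the phase
does not depend on `y`, the patch is in helix form. -/
lemma hasHelixForm_of_coefficients (hκ : 0 < κ) (hτ : 0 < τ)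
    (hlam : lam = 1 ∨ lam = -1) (hν : ν ≠ 0) (hB : helixB τ lam ν < 0)
    (h : HelixPatch (√κ / 2) τ lam ν U f n)
    {a b : Plane → ℝ} (ha : ContDiffOn ℝ ∞ a U) (hb : ContDiffOn ℝ ∞ b U)
    (hb0 : ∀ z ∈ U, b z ≠ 0)
    (hx : ∀ z ∈ U, fderiv ℝ f z (EuclideanSpace.single 0 1) =
      horizT (√κ / 2) τ lam ν (f z) (n z))
    (hy : ∀ z ∈ U, fderiv ℝ f z (EuclideanSpace.single 1 1) =
      a z • horizT (√κ / 2) τ lam ν (f z) (n z) + b z • -(J1 *ᵥ n z))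
    (hab : ∀ z ∈ U, 2 * helixAlpha κ τ lam ν * a z
      + fderiv ℝ b z (EuclideanSpace.single 0 1) / ν = 0)
    {z₀ : Plane} (hz₀ : z₀ ∈ U) :
    ∃ V : Set Plane, IsOpen V ∧ z₀ ∈ V ∧ V ⊆ U ∧
      HasHelixForm κ τ lam ν f (OpenPartialHomeomorph.refl Plane) V := by
  have hr := (half_sqrt_pos hκ).ne'
  have hL := (lam_add_sq_pos hB).ne'
  have hα := helixAlpha_add (κ := κ) (ν := ν) hτ hlam
  set α := helixAlpha κ τ lam ν with hαdef
  obtain ⟨ε, hε, hball⟩ := Metric.isOpen_iff.1 h.isOpen z₀ hz₀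
  -- The phase with the rotation along `x` removed is locally constant.
  let u : Plane → ℂ := fun z => cis (-(2 * (α * z 0))) * phase (√κ / 2) (f z) (n z)
  have hu : ContDiffOn ℝ ∞ u U := by
    refine ContDiffOn.mul (contDiff_cis.comp_contDiffOn (f := fun z : Plane => -(2 * (α * z 0))) ?_)
      h.contDiffOn_phase
    fun_prop
  have hline : ∀ z ∈ U, ∀ v, fderiv ℝ u z v =
      cis (-(2 * (α * z 0))) * (fderiv ℝ (fun z => phase (√κ / 2) (f z) (n z)) z v -
        Complex.I * (2 * (α * v 0) : ℝ) * phase (√κ / 2) (f z) (n z)) := by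
    intro z hz v
    have h1 := hasDerivAt_line h.isOpen h.contDiffOn_phase hz v
    have h2 : HasDerivAt (fun t : ℝ => -(2 * (α * (z + t • v) 0))) (-(2 * (α * v 0))) 0 := by
      have : HasDerivAt (fun t : ℝ => z 0 + t * v 0) (1 * v 0) 0 :=
        ((hasDerivAt_id 0).mul_const (v 0)).const_add (z 0)
      simpa using ((this.const_mul α).const_mul 2).fun_neg
    have h3 := ((hasDerivAt_cis _).scomp (0 : ℝ) h2).fun_mul h1
    rw [(hasDerivAt_line h.isOpen hu hz v).unique h3]
    simp
    ring
  have hconst : ∀ z ∈ Metric.ball z₀ ε, u z = u z₀ := by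
    intro z hz
    refine eq_of_partial_eq_zero (hu.mono hball) (fun z hz => ?_) (fun z hz => ?_) hz
      (Metric.mem_ball_self hε)
    · have hz := hball hz
      have hw : fderiv ℝ f z ((b z)⁻¹ •
          (EuclideanSpace.single 1 1 - a z • EuclideanSpace.single 0 1)) = -(J1 *ᵥ n z) := by
        rw [map_smul, map_sub, map_smul, hx z hz, hy z hz, add_sub_cancel_left, smul_smul,
          inv_mul_cancel₀ (hb0 z hz), one_smul]
      rw [hline z hz, h.fderiv_phase_T_alpha hκ hτ hlam hB hz (hx z hz) hw]
      simp [← hαdef]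
    · have hz := hball hz
      rw [hline z hz, h.fderiv_phase_y hr hν hL ha hb hb0 hx hy hz]
      have : 2 * (lam * (lam + ν ^ 2) * (√κ / 2) / τ - ν * (lam * ν * τ * (√κ / 2))) * a z +
          fderiv ℝ b z (EuclideanSpace.single 0 1) / ν = 0 := by
        linear_combination hab z hz - 2 * a z * hα
      rw [this]
      simp
  obtain ⟨V, hV, hz, hVU, hform⟩ := HelixPatch.hasHelixForm hκ hτ hlam hν hB
    (h.mono Metric.isOpen_ball hball) (fun z hz => hx z (hball hz))
    (fun z hz h0 => by
      have h1 := congrArg (fun v => g0 v (J1 *ᵥ n z)) h0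
      rw [hy z (hball hz)] at h1
      simp only [g0_add_left, g0_smul_left, h.g0_horizT_J1 (hball hz), h.g0_JT (hball hz)] at h1
      have h2 : b z * (lam + ν ^ 2) = 0 := by
        have h3 : g0 0 (J1 *ᵥ n z) = 0 := by simp [g0]
        rw [h3] at h1
        linarith
      exact (mul_ne_zero (hb0 z (hball hz)) hL) h2)
    (c₀ := u z₀) (fun z hz => by
      rw [← hconst z hz]
      have h1 := cis_neg_mul (2 * (α * z 0))
      simp only [u]
      rw [← mul_assoc, mul_comm (cis _), h1, one_mul]) (Metric.mem_ball_self hε)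
  exact ⟨V, hV, hz, hVU.trans hball, hform⟩

end

end HelixPatch

/-- A smooth map of the plane with invertible derivative at a point is a diffeomorphism near it. -/
lemma exists_local_diffeomorphism {U : Set Plane} (hU : IsOpen U) {Ψ : Plane → Plane}
    (hΨ : ContDiffOn ℝ ∞ Ψ U) {z₀ : Plane} (hz₀ : z₀ ∈ U)
    (hi : Function.Injective (fderiv ℝ Ψ z₀)) :
    ∃ ψ : OpenPartialHomeomorph Plane Plane, (∀ z, ψ z = Ψ z) ∧ z₀ ∈ ψ.source ∧ ψ.source ⊆ U ∧
      ContDiffOn ℝ ∞ ψ ψ.source ∧ ContDiffOn ℝ ∞ ψ.symm ψ.target ∧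
      ∀ z ∈ ψ.source, Function.Injective (fderiv ℝ Ψ z) := by
  let A : Plane ≃L[ℝ] Plane :=
    (LinearEquiv.ofInjectiveEndo (fderiv ℝ Ψ z₀ : Plane →ₗ[ℝ] Plane) hi).toContinuousLinearEquiv
  have hA : (A : Plane →L[ℝ] Plane) = fderiv ℝ Ψ z₀ := by ext v : 1; rfl
  have hat : ∀ z ∈ U, ContDiffAt ℝ ∞ Ψ z := fun z hz => hΨ.contDiffAt (hU.mem_nhds hz)
  have hder : ∀ z ∈ U, HasFDerivAt Ψ (fderiv ℝ Ψ z) z := fun z hz =>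
    ((hat z hz).differentiableAt (by simp)).hasFDerivAt
  let O : Set Plane := U ∩ (fderiv ℝ Ψ) ⁻¹' Set.range
    (ContinuousLinearEquiv.toContinuousLinearMap : (Plane ≃L[ℝ] Plane) → (Plane →L[ℝ] Plane))
  have hO : IsOpen O := (hΨ.continuousOn_fderiv_of_isOpen hU (by simp)).isOpen_inter_preimage hU
    ContinuousLinearEquiv.isOpen
  let ψ₀ := (hat z₀ hz₀).toOpenPartialHomeomorph Ψ (f' := A) (by rw [hA]; exact hder z₀ hz₀)
    (by simp)
  have hsub : (ψ₀.restrOpen O hO).source ⊆ O := fun z hz => by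
    rw [ψ₀.restrOpen_source] at hz
    exact hz.2
  refine ⟨ψ₀.restrOpen O hO, fun z => rfl, ?_, fun z hz => (hsub hz).1,
    hΨ.mono fun z hz => (hsub hz).1, ?_, ?_⟩
  · rw [ψ₀.restrOpen_source]
    exact ⟨(hat z₀ hz₀).mem_toOpenPartialHomeomorph_source _ _, hz₀, A, hA⟩
  · intro w hw
    obtain ⟨hz, B, hB⟩ := hsub ((ψ₀.restrOpen O hO).map_target hw)
    refine (OpenPartialHomeomorph.contDiffAt_symm _ hw (f₀' := B) ?_
      (hat _ hz)).contDiffWithinAt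
    rw [hB]
    exact hder _ hz
  · intro z hz
    obtain ⟨-, B, hB⟩ := hsub hz
    rw [← hB]
    exact B.injective

lemma contDiff_transport (r α β k l : ℝ) (c : ℂ) :
    ContDiff ℝ ∞ (fun p : ℝ × ℂ × ℂ => transport r α β k l p.1 c p.2.1 p.2.2) := by
  have h := contDiffOn_transport_neg (r := r) (α := α) (β := β) (k := k) (l := l)
    (U := Set.univ) (x := fun p : ℝ × ℂ × ℂ => -p.1) (c := fun _ => c) (F := fun p => p.2.1)
    (G := fun p => p.2.2) contDiff_fst.neg.contDiffOn contDiffOn_const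
    contDiff_snd.fst.contDiffOn contDiff_snd.snd.contDiffOn
  simpa [contDiffOn_univ] using h

lemma hasDerivAt_transport_zero {r α β k l : ℝ} {c : ℂ} {x : ℝ → ℝ} {P Q : ℝ → ℂ} {t : ℝ}
    (hx : HasDerivAt x 0 t) (hP : HasDerivAt P 0 t) (hQ : HasDerivAt Q 0 t) :
    HasDerivAt (fun t => transport r α β k l (x t) c (P t) (Q t)) 0 t := by
  have h := (((contDiff_transport r α β k l c).differentiable (by simp))
    (x t, P t, Q t)).hasFDerivAt.comp_hasDerivAt t (hx.prodMk (hP.prodMk hQ))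
  refine h.congr_deriv ?_
  exact map_zero _

namespace HelixPatch

variable {κ τ lam ν : ℝ} {U : Set Plane} {f n : Plane → Fin 4 → ℝ}

/-- Near every point of an immersed patch there are coordinates with `∂ₓ = T` in which the phase of
the horizontal normal depends only on `x`. The phase itself provides the first coordinate, and the
initial values of the flow of `T`, which are constant along `T`, the second one. -/
lemma exists_coordinates (hκ : 0 < κ) (hτ : 0 < τ)
    (hlam : lam = 1 ∨ lam = -1) (hν : ν ≠ 0) (hB : helixB τ lam ν < 0)
    (h : HelixPatch (√κ / 2) τ lam ν U f n)
    (hi : ∀ z ∈ U, Function.Injective (fderiv ℝ f z)) {z₀ : Plane} (hz₀ : z₀ ∈ U) :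
    ∃ (ψ : OpenPartialHomeomorph Plane Plane) (c₀ : ℂ), z₀ ∈ ψ.source ∧ ψ.source ⊆ U ∧
      ContDiffOn ℝ ∞ ψ ψ.source ∧ ContDiffOn ℝ ∞ ψ.symm ψ.target ∧
      ∀ w ∈ ψ.target,
        fderiv ℝ (f ∘ ψ.symm) w (EuclideanSpace.single 0 1) =
          horizT (√κ / 2) τ lam ν (f (ψ.symm w)) (n (ψ.symm w)) ∧
        phase (√κ / 2) (f (ψ.symm w)) (n (ψ.symm w)) =
          cis (2 * (helixAlpha κ τ lam ν * w 0)) * c₀ := by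
  have hr := (half_sqrt_pos hκ).ne'
  have hL := (lam_add_sq_pos hB).ne'
  have hl := lam_sq hlam
  have hα := helixAlpha_add (κ := κ) (ν := ν) hτ hlam
  have hα0 := helixAlpha_ne_zero (ν := ν) hκ hτ hlam hB
  have hcon := flowConst_sq hκ hlam hν hB
  have hβ := beta_mul_flowConst hκ hν hB
  have hphT := fun {z} (hz : z ∈ U) {v w} hv hw =>
    h.fderiv_phase_T_alpha hκ hτ hlam hB hz (v := v) (w := w) hv hw
  have hnorm := fun {z} (hz : z ∈ U) => h.normSq_phase_eq hz
  have hVW := fun {z} (hz : z ∈ U) => h.exists_fderiv_eq hr hτ.ne' hl hν hL hz (hi z hz)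
  set r := √κ / 2
  set α := helixAlpha κ τ lam ν
  set β := helixBeta κ τ lam ν
  set k := lam * ν * τ * r
  set l := flowConst κ τ lam ν
  set c : Plane → ℂ := fun z => phase r (f z) (n z) with hcdef
  have hcs : ContDiffOn ℝ ∞ c U := h.contDiffOn_phase
  have hc0 : ∀ z ∈ U, c z ≠ 0 := fun z hz h0 => by
    have h1 := hnorm hz
    rw [show phase r (f z) (n z) = 0 from h0, map_zero] at h1
    exact hL h1.symm
  -- The first coordinate.
  let U₁ : Set Plane := U ∩ (fun z => c z / c z₀) ⁻¹' Complex.slitPlane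
  have hU₁ : IsOpen U₁ := (hcs.continuousOn.div_const _).isOpen_inter_preimage h.isOpen
    Complex.isOpen_slitPlane
  have hz₁ : z₀ ∈ U₁ := ⟨hz₀, by simp [div_self (hc0 z₀ hz₀)]⟩
  have hsub : U₁ ⊆ U := fun z hz => hz.1
  have h₁ := h.mono hU₁ hsub
  let x : Plane → ℝ := fun z => (Complex.log (c z / c z₀)).im / (2 * α)
  have hx : ContDiffOn ℝ ∞ x U₁ := by
    refine ContDiffOn.div_const ?_ _
    refine ContDiff.comp_contDiffOn (𝕜 := ℝ) (g := fun z : ℂ => z.im) Complex.imCLM.contDiff ?_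
    intro z hz
    have h2 : ContDiffAt ℝ ∞ Complex.log (c z / c z₀) :=
      (Complex.contDiffAt_log hz.2).restrict_scalars ℝ
    exact h2.comp_contDiffWithinAt z ((hcs.mono hsub).div_const _ z hz)
  have hcx : ∀ z ∈ U₁, c z = cis (2 * (α * x z)) * c z₀ := by
    intro z hz
    have h2 : 2 * (α * x z) = (Complex.log (c z / c z₀)).im := by
      simp only [x]; field_simp
    have h3 := Complex.norm_mul_exp_arg_mul_I (c z / c z₀)
    have h4 : ‖c z / c z₀‖ = 1 := by
      have h5 : ‖c z / c z₀‖ ^ 2 = 1 := by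
        rw [← Complex.normSq_eq_norm_sq, map_div₀, hnorm hz.1, hnorm hz₀, div_self hL]
      nlinarith [norm_nonneg (c z / c z₀)]
    rw [h4, Complex.ofReal_one, one_mul] at h3
    rw [h2, cis, Complex.log_im, h3, div_mul_cancel₀ _ (hc0 z₀ hz₀)]
  have hdx : ∀ z ∈ U₁, ∀ v, fderiv ℝ f z v = horizT r τ lam ν (f z) (n z) →
      fderiv ℝ x z v = 1 := by
    intro z hz v hv
    obtain ⟨w, hw⟩ := (hVW hz.1).2
    have h2 := hasDerivAt_line h.isOpen hcs hz.1 v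
    rw [hphT hz.1 hv hw] at h2
    have h3 := hasDerivAt_line hU₁ hx hz v
    have h4 := ((hasDerivAt_cis _).scomp (0 : ℝ) ((h3.const_mul α).const_mul 2)).mul_const (c z₀)
    have h5 := h2.unique (h4.congr_of_eventuallyEq (by
      filter_upwards [eventually_line_mem hU₁ hz v] with t ht using hcx _ ht))
    have h6 : c z = cis (2 * (α * x z)) * c z₀ := hcx z hz
    simp only [zero_smul, add_zero, Complex.real_smul] at h5
    have h7 : (2 * α * c z * Complex.I) * ((fderiv ℝ x z v : ℝ) : ℂ) =
        (2 * α * c z * Complex.I) * 1 := by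
      push_cast at h5
      have h8 : Complex.I * (2 * α) * c z = Complex.I * (2 * α) * phase r (f z) (n z) := rfl
      rw [← h8] at h5
      linear_combination -h5 + 2 * α * (fderiv ℝ x z v : ℝ) * Complex.I * h6
    have h9 : (2 * α * c z * Complex.I : ℂ) ≠ 0 := by
      have : (α : ℂ) ≠ 0 := by exact_mod_cast hα0
      exact mul_ne_zero (mul_ne_zero (mul_ne_zero two_ne_zero this) (hc0 z hz.1)) Complex.I_ne_zero
    exact_mod_cast mul_left_cancel₀ h9 h7
  -- The initial values of the flow, which do not change along `T`.
  let F : Plane → ℂ := fun z => zA (f z)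
  let G : Plane → ℂ := fun z => zB (f z)
  have hF : ContDiffOn ℝ ∞ F U₁ := zA.contDiff.comp_contDiffOn h₁.smooth_f
  have hG : ContDiffOn ℝ ∞ G U₁ := zB.contDiff.comp_contDiffOn h₁.smooth_f
  have hk : ∀ z ∈ U, l ^ 2 * (r ^ 2 * Complex.normSq (c z) - k ^ 2) = 1 := fun z hz => by
    rw [hcdef]
    simp only
    rw [hnorm hz]; exact hcon
  let P : Plane → ℂ := fun z => transport r α β k l (-(x z)) (c z) (F z) (G z)
  let Q : Plane → ℂ := fun z => transport r α β k l (-(x z)) (c z) (G z) (F z)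
  have hP : ContDiffOn ℝ ∞ P U₁ := contDiffOn_transport_neg hx (hcs.mono hsub) hF hG
  have hQ : ContDiffOn ℝ ∞ Q U₁ := contDiffOn_transport_neg hx (hcs.mono hsub) hG hF
  have hFP : ∀ z ∈ U₁, F z = transport r α β k l (x z) (c z₀) (P z) (Q z) ∧
      G z = transport r α β k l (x z) (c z₀) (Q z) (P z) := by
    intro z hz
    have h1 := transport_transport_neg (α := α) (β := β) (x z) (hk z hz.1) (F z) (G z)
    have h1' := transport_transport_neg (α := α) (β := β) (x z) (hk z hz.1) (G z) (F z)
    have h2 : cis (2 * -(α * x z)) * c z = c z₀ := by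
      rw [hcx z hz, ← mul_assoc, mul_neg, cis_neg_mul, one_mul]
    rw [h2] at h1 h1'
    exact ⟨h1.symm, h1'.symm⟩
  have hPV : ∀ z ∈ U₁, ∀ v, fderiv ℝ f z v = horizT r τ lam ν (f z) (n z) →
      fderiv ℝ P z v = 0 ∧ fderiv ℝ Q z v = 0 := by
    intro z hz v hv
    obtain ⟨w, hw⟩ := (hVW hz.1).2
    obtain ⟨hnA, hnB⟩ := horizontal_eq (h.quadric _ hz.1) (h.orthogonal _ hz.1)
      (h.orthogonal_J1 _ hz.1)
    have hz0 : z + (0 : ℝ) • v = z := by simp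
    have hf' := hasDerivAt_line hU₁ h₁.smooth_f hz v
    rw [hv] at hf'
    have dF : HasDerivAt (fun t : ℝ => F (z + t • v)) (Complex.I * (α + ν * k) *
        F (z + (0 : ℝ) • v) - ν * c (z + (0 : ℝ) • v) * r * conj (G (z + (0 : ℝ) • v))) 0 := by
      refine (zA.hasFDerivAt.comp_hasDerivAt 0 hf').congr_deriv ?_
      rw [hz0, horizT, ← hα, map_sub, map_smul, map_smul, zA_J1, hnA, Complex.real_smul,
        Complex.real_smul]
      push_cast; ring
    have dG : HasDerivAt (fun t : ℝ => G (z + t • v)) (Complex.I * (α + ν * k) *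
        G (z + (0 : ℝ) • v) - ν * c (z + (0 : ℝ) • v) * r * conj (F (z + (0 : ℝ) • v))) 0 := by
      refine (zB.hasFDerivAt.comp_hasDerivAt 0 hf').congr_deriv ?_
      rw [hz0, horizT, ← hα, map_sub, map_smul, map_smul, zB_J1, hnB, Complex.real_smul,
        Complex.real_smul]
      push_cast; ring
    have dx : HasDerivAt (fun t : ℝ => x (z + t • v)) 1 0 := by
      have h2 := hasDerivAt_line hU₁ hx hz v
      rwa [hdx z hz v hv] at h2
    have dc : HasDerivAt (fun t : ℝ => c (z + t • v))
        (Complex.I * (2 * α) * c (z + (0 : ℝ) • v)) 0 := by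
      have h2 := hasDerivAt_line h.isOpen hcs hz.1 v
      rw [hphT hz.1 hv hw] at h2
      rwa [hz0]
    have hk' : l ^ 2 * (r ^ 2 * Complex.normSq (c (z + (0 : ℝ) • v)) - k ^ 2) = 1 := by
      rw [hz0]; exact hk z hz.1
    exact ⟨(hasDerivAt_line hU₁ hP hz v).unique (hasDerivAt_transport_neg hβ
        (x := fun t => x (z + t • v)) (c := fun t => c (z + t • v)) (F := fun t => F (z + t • v))
        (G := fun t => G (z + t • v)) hk' dx dc dF dG),
      (hasDerivAt_line hU₁ hQ hz v).unique (hasDerivAt_transport_neg hβ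
        (x := fun t => x (z + t • v)) (c := fun t => c (z + t • v)) (F := fun t => G (z + t • v))
        (G := fun t => F (z + t • v)) hk' dx dc dG dF)⟩
  -- One of their real components is not constant in the direction `u` of the level line of `x`:
  -- otherwise the derivative of `f` in this direction would vanish.
  obtain ⟨⟨v₀, hv₀⟩, w₀, hw₀⟩ := hVW hz₀
  let u : Plane := w₀ - fderiv ℝ x z₀ w₀ • v₀
  have hxu : fderiv ℝ x z₀ u = 0 := by
    simp [u, hdx z₀ hz₁ v₀ hv₀]
  have hPQ : ¬(fderiv ℝ P z₀ u = 0 ∧ fderiv ℝ Q z₀ u = 0) := by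
    rintro ⟨hPu, hQu⟩
    have dx := hasDerivAt_line hU₁ hx hz₁ u
    have dP := hasDerivAt_line hU₁ hP hz₁ u
    have dQ := hasDerivAt_line hU₁ hQ hz₁ u
    have df := hasDerivAt_line hU₁ h₁.smooth_f hz₁ u
    rw [hxu] at dx
    rw [hPu] at dP
    rw [hQu] at dQ
    have hev := eventually_line_mem hU₁ hz₁ u
    have e1 : zA (fderiv ℝ f z₀ u) = zA 0 := by
      rw [map_zero]
      refine (zA.hasFDerivAt.comp_hasDerivAt 0 df).unique
        ((hasDerivAt_transport_zero (r := r) (α := α) (β := β) (k := k) (l := l) (c := c z₀)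
          dx dP dQ).congr_of_eventuallyEq ?_)
      filter_upwards [hev] with t ht using (hFP _ ht).1
    have e2 : zB (fderiv ℝ f z₀ u) = zB 0 := by
      rw [map_zero]
      refine (zB.hasFDerivAt.comp_hasDerivAt 0 df).unique
        ((hasDerivAt_transport_zero (r := r) (α := α) (β := β) (k := k) (l := l) (c := c z₀)
          dx dQ dP).congr_of_eventuallyEq ?_)
      filter_upwards [hev] with t ht using (hFP _ ht).2
    have e3 := ext_zA_zB e1 e2
    have e4 := congrArg (fun v => g0 v (J1 *ᵥ n z₀)) e3
    have e5 : g0 0 (J1 *ᵥ n z₀) = 0 := by simp [g0]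
    simp only [u, map_sub, map_smul, hw₀, hv₀, g0_sub_left, g0_smul_left, h.g0_JT hz₀,
      h.g0_horizT_J1 hz₀, e5] at e4
    apply hL
    linarith
  obtain ⟨y, hy, hyV, hyu⟩ : ∃ y : Plane → ℝ, ContDiffOn ℝ ∞ y U₁ ∧
      (∀ z ∈ U₁, ∀ v, fderiv ℝ f z v = horizT r τ lam ν (f z) (n z) → fderiv ℝ y z v = 0) ∧
      fderiv ℝ y z₀ u ≠ 0 := by
    have key : ∀ (φ : ℂ →L[ℝ] ℝ) {R : Plane → ℂ}, ContDiffOn ℝ ∞ R U₁ → ∀ z ∈ U₁, ∀ v,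
        fderiv ℝ (fun z => φ (R z)) z v = φ (fderiv ℝ R z v) := by
      intro φ R hR z hz v
      exact (hasDerivAt_line hU₁ (φ.contDiff.comp_contDiffOn hR) hz v).unique
        (φ.hasFDerivAt.comp_hasDerivAt 0 (hasDerivAt_line hU₁ hR hz v))
    have build : ∀ (φ : ℂ →L[ℝ] ℝ) {R : Plane → ℂ}, ContDiffOn ℝ ∞ R U₁ →
        (∀ z ∈ U₁, ∀ v, fderiv ℝ f z v = horizT r τ lam ν (f z) (n z) → fderiv ℝ R z v = 0) →
        φ (fderiv ℝ R z₀ u) ≠ 0 → ∃ y : Plane → ℝ, ContDiffOn ℝ ∞ y U₁ ∧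
      (∀ z ∈ U₁, ∀ v, fderiv ℝ f z v = horizT r τ lam ν (f z) (n z) → fderiv ℝ y z v = 0) ∧
      fderiv ℝ y z₀ u ≠ 0 := by
      intro φ R hR hRV hRu
      refine ⟨fun z => φ (R z), φ.contDiff.comp_contDiffOn hR, fun z hz v hv => ?_, ?_⟩
      · rw [key φ hR z hz, hRV z hz v hv, map_zero]
      · rwa [key φ hR z₀ hz₁]
    by_contra hno
    apply hPQ
    constructor
    · apply Complex.ext
      · by_contra h0
        exact hno (build Complex.reCLM hP (fun z hz v hv => (hPV z hz v hv).1) h0)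
      · by_contra h0
        exact hno (build Complex.imCLM hP (fun z hz v hv => (hPV z hz v hv).1) h0)
    · apply Complex.ext
      · by_contra h0
        exact hno (build Complex.reCLM hQ (fun z hz v hv => (hPV z hz v hv).2) h0)
      · by_contra h0
        exact hno (build Complex.imCLM hQ (fun z hz v hv => (hPV z hz v hv).2) h0)
  -- The map `(x, y)` is a local diffeomorphism at `z₀`, and `T` has components `(1, 0)`.
  let Ψ : Plane → Plane := fun z => !₂[x z, y z]
  have hΨ : ContDiffOn ℝ ∞ Ψ U₁ := by
    rw [contDiffOn_euclidean]
    intro i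
    fin_cases i
    · exact hx
    · exact hy
  have hΨd : ∀ z ∈ U₁, ∀ v, fderiv ℝ Ψ z v = !₂[fderiv ℝ x z v, fderiv ℝ y z v] := by
    intro z hz v
    have h2 := hasDerivAt_line hU₁ hΨ hz v
    have key : ∀ i, fderiv ℝ (fun z => Ψ z i) z v = fderiv ℝ Ψ z v i := fun i =>
      (hasDerivAt_line hU₁ (contDiffOn_euclidean.1 hΨ i) hz v).unique
        ((EuclideanSpace.proj (𝕜 := ℝ) i).hasFDerivAt.comp_hasDerivAt 0 h2)
    ext i
    rw [← key i]
    fin_cases i <;> rfl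
  have hinj : Function.Injective (fderiv ℝ Ψ z₀) := by
    rw [injective_iff_map_eq_zero]
    intro v hv
    rw [hΨd z₀ hz₁] at hv
    have e0 : fderiv ℝ x z₀ v = 0 := congrArg (fun w : Plane => w 0) hv
    have e1 : fderiv ℝ y z₀ v = 0 := congrArg (fun w : Plane => w 1) hv
    obtain ⟨a, b, hab⟩ : ∃ a b : ℝ, v = a • v₀ + b • w₀ := by
      have h2 := h.fderiv_f_eq hr hτ.ne' hl hν hL hz₀ v
      rw [← hv₀, ← hw₀, ← map_smul, ← map_smul, ← map_add] at h2
      exact ⟨_, _, hi z₀ hz₀ h2⟩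
    have hv' : v = (a + b * fderiv ℝ x z₀ w₀) • v₀ + b • u := by
      rw [hab]; simp only [u]; module
    rw [hv', map_add, map_smul, map_smul, hxu, hdx z₀ hz₁ v₀ hv₀] at e0
    rw [hv', map_add, map_smul, map_smul, hyV z₀ hz₁ v₀ hv₀] at e1
    simp only [smul_eq_mul, mul_one, mul_zero, add_zero, zero_add] at e0 e1
    have hb : b = 0 := (mul_eq_zero.1 e1).resolve_right hyu
    rw [hv', e0, hb]
    simp
  obtain ⟨ψ, hψ, hψ₀, hψU, hψs, hψt, hψi⟩ := exists_local_diffeomorphism hU₁ hΨ hz₁ hinj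
  refine ⟨ψ, c z₀, hψ₀, hψU.trans hsub, hψs, hψt, fun w hw => ?_⟩
  have hz : ψ.symm w ∈ ψ.source := ψ.map_target hw
  have hzU := hψU hz
  obtain ⟨v, hv⟩ := (hVW hzU.1).1
  have hwz : w = Ψ (ψ.symm w) := by rw [← hψ, ψ.right_inv hw]
  have hd := ((hψt.contDiffAt (ψ.open_target.mem_nhds hw)).differentiableAt (by simp)).hasFDerivAt
  have hΨz := ((hΨ.contDiffAt (hU₁.mem_nhds hzU)).differentiableAt (by simp)).hasFDerivAt
  have hsv : fderiv ℝ ψ.symm w (EuclideanSpace.single 0 1) = v := by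
    apply hψi _ hz
    have h2 : HasFDerivAt (Ψ ∘ ψ.symm) (ContinuousLinearMap.id ℝ Plane) w := by
      refine (hasFDerivAt_id w).congr_of_eventuallyEq ?_
      filter_upwards [ψ.open_target.mem_nhds hw] with w' hw'
      rw [Function.comp_apply, ← hψ, ψ.right_inv hw', id]
    have h3 := congrArg (fun A => A (EuclideanSpace.single 0 1)) ((hΨz.comp w hd).unique h2)
    refine Eq.trans h3 ?_
    rw [hΨd _ hzU, hdx _ hzU v hv, hyV _ hzU v hv]
    ext i
    fin_cases i <;> simp
  constructor
  · rw [((h₁.differentiableAt_f hzU).hasFDerivAt.comp w hd).fderiv]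
    change fderiv ℝ f (ψ.symm w) (fderiv ℝ ψ.symm w (EuclideanSpace.single 0 1)) = _
    rw [hsv, hv]
  · have h2 := hcx _ hzU
    have h3 : x (ψ.symm w) = w 0 := (congrArg (fun w : Plane => w 0) hwz).symm
    rw [h3] at h2
    exact h2

end HelixPatch

/-! ### Local coordinates on a helix surface -/

lemma contDiffOn_g0 {U : Set Plane} {u v : Plane → Fin 4 → ℝ} (hu : ContDiffOn ℝ ∞ u U)
    (hv : ContDiffOn ℝ ∞ v U) : ContDiffOn ℝ ∞ (fun z => g0 (u z) (v z)) U := by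
  have hu' := contDiffOn_pi.1 hu
  have hv' := contDiffOn_pi.1 hv
  exact ((((hu' 0).mul (hv' 0)).add ((hu' 1).mul (hv' 1))).sub ((hu' 2).mul (hv' 2))).sub
    ((hu' 3).mul (hv' 3))

lemma HasHelixForm.mono {M : Type*} [TopologicalSpace M] {κ τ lam ν : ℝ}
    {F : M → (Fin 4 → ℝ)} {e : OpenPartialHomeomorph M Plane} {V W : Set M}
    (h : HasHelixForm κ τ lam ν F e V) (hW : W ⊆ V) : HasHelixForm κ τ lam ν F e W := by
  obtain ⟨c, d, ξ, ξ₁, ξ₂, ξ₃, h₁, h₂, h₃, hA, hV⟩ := h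
  exact ⟨c, d, ξ, ξ₁, ξ₂, ξ₃, h₁, h₂, h₃, hA, fun q hq => hV q (hW hq)⟩

section

variable {M : Type*} [TopologicalSpace M] [ChartedSpace Plane M]
  {κ τ lam ν : ℝ} {F N : M → (Fin 4 → ℝ)}

variable [IsManifold (𝓡 2) ∞ M]

lemma restrOpen_mem_maximalAtlas {e : OpenPartialHomeomorph M Plane}
    (he : e ∈ IsManifold.maximalAtlas (𝓡 2) ∞ M) {V : Set M} (hV : IsOpen V) :
    e.restrOpen V hV ∈ IsManifold.maximalAtlas (𝓡 2) ∞ M := by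
  refine OpenPartialHomeomorph.mem_maximalAtlas_of_contMDiffOn _ ?_ ?_
  · exact (contMDiffOn_of_mem_maximalAtlas he).mono fun q hq => by
      rw [e.restrOpen_source] at hq; exact hq.1
  · refine (contMDiffOn_symm_of_mem_maximalAtlas he).mono fun z hz => ?_
    have h1 := (e.restrOpen V hV).map_target hz
    have h2 := (e.restrOpen V hV).right_inv hz
    rw [e.restrOpen_source] at h1
    rw [← h2]
    exact e.map_source h1.1

lemma trans_mem_maximalAtlas {e : OpenPartialHomeomorph M Plane}
    (he : e ∈ IsManifold.maximalAtlas (𝓡 2) ∞ M) {ψ : OpenPartialHomeomorph Plane Plane}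
    (hψ : ContDiffOn ℝ ∞ ψ ψ.source) (hψ' : ContDiffOn ℝ ∞ ψ.symm ψ.target) :
    e.trans ψ ∈ IsManifold.maximalAtlas (𝓡 2) ∞ M := by
  refine OpenPartialHomeomorph.mem_maximalAtlas_of_contMDiffOn _ ?_ ?_
  · exact (contMDiffOn_iff_contDiffOn.2 hψ).comp' (contMDiffOn_of_mem_maximalAtlas he)
  · rw [OpenPartialHomeomorph.trans_target]
    exact (contMDiffOn_symm_of_mem_maximalAtlas he).comp' (contMDiffOn_iff_contDiffOn.2 hψ')

namespace IsHelixSurface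

/-- Coordinates with `∂ₓ = T` form a local system, the coefficients of `∂_y` being read off from the
scalar products with `n` and `J₁n`. -/
lemma exists_isLocalSystem (h : IsHelixSurface κ τ lam ν F N) (hκ : 0 < κ) (hτ : 0 < τ)
    (hlam : lam = 1 ∨ lam = -1) (hν : ν ≠ 0) (hL : lam + ν ^ 2 ≠ 0)
    {e : OpenPartialHomeomorph M Plane} (he : e ∈ IsManifold.maximalAtlas (𝓡 2) ∞ M)
    (hx : ∀ z ∈ e.target, fderiv ℝ (F ∘ e.symm) z (EuclideanSpace.single 0 1) =
      horizT (√κ / 2) τ lam ν (F (e.symm z)) (horizontalNormal κ τ lam ν F N (e.symm z))) :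
    ∃ a b : Plane → ℝ, IsLocalSystem κ τ ν F N e a b := by
  have hp := h.helixPatch hκ hτ hlam he
  set f := F ∘ e.symm with hf
  set n := horizontalNormal κ τ lam ν F N ∘ e.symm with hn
  have hs := contDiffOn_fderiv_apply hp.isOpen hp.smooth_f (EuclideanSpace.single 1 1)
  refine ⟨fun z => -(g0 (fderiv ℝ f z (EuclideanSpace.single 1 1)) (n z) / (ν * (lam + ν ^ 2))),
    fun z => -(g0 (fderiv ℝ f z (EuclideanSpace.single 1 1)) (J1 *ᵥ n z) / (lam + ν ^ 2)),
    he, ((contDiffOn_g0 hs hp.smooth_n).div_const _).neg,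
    ((contDiffOn_g0 hs (contDiffOn_J1 hp.smooth_n)).div_const _).neg, fun p hpe => ?_,
    fun p hpe => ?_⟩
  · have h1 := hx (e p) (e.map_source hpe)
    rw [e.left_inv hpe, ← tangentT_eq hlam] at h1
    exact h1
  · have h1 := hp.fderiv_f_eq (half_sqrt_pos hκ).ne' hτ.ne' (lam_sq hlam) hν hL
      (e.map_source hpe) (EuclideanSpace.single 1 1)
    have h2 : n (e p) = horizontalNormal κ τ lam ν F N p := by
      rw [hn, Function.comp_apply, e.left_inv hpe]
    have h3 : f (e p) = F p := by rw [hf, Function.comp_apply, e.left_inv hpe]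
    rw [tangentT_eq hlam, h.tangentJT_eq hκ hτ hlam]
    rw [← h2, ← h3]
    exact h1

/-- Every point of a helix surface lies in adapted coordinates in which the position vector is in
helix form. -/
theorem exists_helixForm (h : IsHelixSurface κ τ lam ν F N) (hκ : 0 < κ) (hτ : 0 < τ)
    (hlam : lam = 1 ∨ lam = -1) (hν : ν ≠ 0) (hB : helixB τ lam ν < 0) (p : M) :
    ∃ (e : OpenPartialHomeomorph M Plane) (a b : Plane → ℝ), p ∈ e.source ∧
      IsLocalSystem κ τ ν F N e a b ∧ HasHelixForm κ τ lam ν F e e.source := by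
  have he₁ : chartAt Plane p ∈ IsManifold.maximalAtlas (𝓡 2) ∞ M :=
    IsManifold.chart_mem_maximalAtlas p
  have hp₁ := mem_chart_source Plane p
  set e₁ := chartAt Plane p
  obtain ⟨ψ, c₀, hψ₀, hψU, hψ, hψ', hcoord⟩ := (h.helixPatch hκ hτ hlam he₁).exists_coordinates
    hκ hτ hlam hν hB (fun z hz => h.fderiv_injective he₁ hz) (e₁.map_source hp₁)
  have he := trans_mem_maximalAtlas he₁ hψ hψ'
  have hpe : p ∈ (e₁.trans ψ).source := by
    rw [OpenPartialHomeomorph.trans_source]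
    exact ⟨hp₁, hψ₀⟩
  have htarget : ∀ z ∈ (e₁.trans ψ).target, z ∈ ψ.target := fun z hz => by
    rw [OpenPartialHomeomorph.trans_target] at hz
    exact hz.1
  obtain ⟨V, hV, hpV, hVsub, hform⟩ := (h.helixPatch hκ hτ hlam he).hasHelixForm hκ hτ hlam hν hB
    (fun z hz => (hcoord z (htarget z hz)).1)
    (fun z hz h0 => by
      have h1 := h.fderiv_injective he hz (h0.trans (map_zero _).symm)
      simpa using congrArg (fun w : Plane => w 1) h1)
    (fun z hz => (hcoord z (htarget z hz)).2) ((e₁.trans ψ).map_source hpe)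
  set e := e₁.trans ψ
  have hform' := HasHelixForm.of_comp_symm hform
  have hO := e.isOpen_inter_preimage hV
  have he' := restrOpen_mem_maximalAtlas he hO
  have hsub : ∀ z ∈ (e.restrOpen _ hO).target, z ∈ e.target := fun z hz => by
    have h1 := (e.restrOpen _ hO).map_target hz
    rw [e.restrOpen_source] at h1
    rw [← (e.restrOpen _ hO).right_inv hz]
    exact e.map_source h1.1
  obtain ⟨a, b, hab⟩ := h.exists_isLocalSystem hκ hτ hlam hν (lam_add_sq_pos hB).ne' he'
    (fun z hz => (hcoord z (htarget z (hsub z hz))).1)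
  refine ⟨e.restrOpen _ hO, a, b, ?_, hab, ?_⟩
  · rw [e.restrOpen_source]
    exact ⟨hpe, hpe, hpV⟩
  · refine HasHelixForm.mono (V := e.source ∩ e ⁻¹' V) hform' fun q hq => ?_
    rw [e.restrOpen_source] at hq
    exact hq.2

/-- For these coefficients `a` and `b` the phase of the horizontal normal does not depend on `y`, so
the given coordinates are already those of the helix form. -/
theorem helixForm_of_isLocalSystem (h : IsHelixSurface κ τ lam ν F N) (hκ : 0 < κ) (hτ : 0 < τ)
    (hlam : lam = 1 ∨ lam = -1) (hν : ν ≠ 0) (hB : helixB τ lam ν < 0)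
    {e : OpenPartialHomeomorph M Plane} {η : ℝ → ℝ}
    (he : IsLocalSystem κ τ ν F N e
      (fun z => -(lam * τ / √(-helixB τ lam ν)) *
        Real.sinh (η (z 1) + ν * √(-(κ * helixB τ lam ν)) * z 0))
      (fun z => Real.cosh (η (z 1) + ν * √(-(κ * helixB τ lam ν)) * z 0))) {p : M}
    (hp : p ∈ e.source) :
    ∃ V : Set M, IsOpen V ∧ p ∈ V ∧ V ⊆ e.source ∧ HasHelixForm κ τ lam ν F e V := by
  have hpatch := h.helixPatch hκ hτ hlam he.chart
  have hx : ∀ z ∈ e.target, fderiv ℝ (F ∘ e.symm) z (EuclideanSpace.single 0 1) =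
      horizT (√κ / 2) τ lam ν (F (e.symm z)) (horizontalNormal κ τ lam ν F N (e.symm z)) := by
    intro z hz
    have h1 := he.deriv_x _ (e.map_target hz)
    rw [tangentT_eq hlam, coordDeriv, e.right_inv hz] at h1
    exact h1
  have hy : ∀ z ∈ e.target, fderiv ℝ (F ∘ e.symm) z (EuclideanSpace.single 1 1) =
      (-(lam * τ / √(-helixB τ lam ν)) *
        Real.sinh (η (z 1) + ν * √(-(κ * helixB τ lam ν)) * z 0)) •
      horizT (√κ / 2) τ lam ν (F (e.symm z)) (horizontalNormal κ τ lam ν F N (e.symm z)) +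
      Real.cosh (η (z 1) + ν * √(-(κ * helixB τ lam ν)) * z 0) •
        -(J1 *ᵥ horizontalNormal κ τ lam ν F N (e.symm z)) := by
    intro z hz
    have h1 := he.deriv_y _ (e.map_target hz)
    rw [tangentT_eq hlam, h.tangentJT_eq hκ hτ hlam, coordDeriv, e.right_inv hz] at h1
    exact h1
  obtain ⟨V, hV, hpV, hVsub, hform⟩ := hpatch.hasHelixForm_of_coefficients hκ hτ hlam hν hB
    he.smooth_a he.smooth_b (fun z _ => (Real.cosh_pos _).ne') hx hy (fun z hz => by
      have h1 := hasDerivAt_line hpatch.isOpen he.smooth_b hz (EuclideanSpace.single 0 1)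
      have h2 : HasDerivAt (fun t : ℝ => η (z 1) + ν * √(-(κ * helixB τ lam ν)) * (z 0 + t))
          (ν * √(-(κ * helixB τ lam ν))) 0 := by
        simpa using (((hasDerivAt_id (0 : ℝ)).const_add (z 0)).const_mul
          (ν * √(-(κ * helixB τ lam ν)))).const_add (η (z 1))
      have h3 := h2.cosh
      simp at h1 h3
      rw [h1.unique h3]
      have hs : 0 < √(-helixB τ lam ν) := Real.sqrt_pos.2 (by linarith)
      have hs2 : √(-helixB τ lam ν) ^ 2 = -helixB τ lam ν := Real.sq_sqrt (by linarith)
      have hl := lam_sq hlam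
      have hlam0 : lam ≠ 0 := by rcases hlam with rfl | rfl <;> norm_num
      rw [helixAlpha, ← mul_neg, Real.sqrt_mul hκ.le]
      generalize Real.sinh _ = S
      generalize √(-helixB τ lam ν) = s at *
      have hBs : helixB τ lam ν = -s ^ 2 := by linarith
      rw [hBs]
      field_simp
      ring) (e.map_source hp)
  exact ⟨e.source ∩ e ⁻¹' V, e.isOpen_inter_preimage hV, ⟨hp, hpV⟩, Set.inter_subset_left,
    HasHelixForm.of_comp_symm hform⟩

end IsHelixSurface

end

/-! ### The surfaces `A(y) γ(x)` -/

/-- The horizontal vector of phase `c` at `q`, that is, `c` times `E₂` where `i` acts as `J₁`. -/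
noncomputable def horizontalVector (r : ℝ) (c : ℂ) (q : Fin 4 → ℝ) : Fin 4 → ℝ :=
  r • (c.re • (J2 *ᵥ q) + c.im • (J3 *ᵥ q))

section Pointwise

variable (r : ℝ) (c : ℂ) (q : Fin 4 → ℝ)

lemma zA_horizontalVector : zA (horizontalVector r c q) = c * r * conj (zB q) := by
  simp only [horizontalVector, zA_apply, zB_apply, J2_mulVec, J3_mulVec]
  apply Complex.ext <;> simp <;> ring

lemma zB_horizontalVector : zB (horizontalVector r c q) = c * r * conj (zA q) := by
  simp only [horizontalVector, zA_apply, zB_apply, J2_mulVec, J3_mulVec]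
  apply Complex.ext <;> simp <;> ring

lemma g0_horizontalVector : g0 q (horizontalVector r c q) = 0 ∧
    g0 q (J1 *ᵥ horizontalVector r c q) = 0 := by
  have h := hermitian_eq q (horizontalVector r c q)
  rw [zA_horizontalVector, zB_horizontalVector] at h
  have h' : (g0 q (horizontalVector r c q) +
      g0 q (J1 *ᵥ horizontalVector r c q) * Complex.I : ℂ) = 0 := by
    rw [← h]
    simp only [map_mul, Complex.conj_conj]
    ring
  have h1 := congrArg Complex.re h'
  have h2 := congrArg Complex.im h'
  simp at h1 h2
  exact ⟨h1, h2⟩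

variable {r q}

lemma phase_horizontalVector (hq : r ^ 2 * g0 q q = -1) :
    phase r q (horizontalVector r c q) = c := by
  have h := hermitian_eq q q
  rw [g0_J1_self] at h
  have h' : (r : ℂ) ^ 2 * (g0 q q : ℝ) = -1 := by exact_mod_cast hq
  rw [phase, zA_horizontalVector, zB_horizontalVector]
  simp only [Complex.ofReal_zero, zero_mul, add_zero] at h
  linear_combination (-c * r ^ 2) * h - c * h'

lemma g0_horizontalVector_self (hq : r ^ 2 * g0 q q = -1) :
    g0 (horizontalVector r c q) (horizontalVector r c q) = Complex.normSq c := by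
  have h := g0_horizontalVector r c q
  rw [← normSq_phase hq h.1 h.2, phase_horizontalVector c hq]

end Pointwise

section

variable {κ τ lam ν : ℝ} {J : Set ℝ} {ξ : ℝ} {ξ₁ ξ₂ ξ₃ : ℝ → ℝ} {Φ : Plane → Fin 4 → ℝ}
  {Ω : Set Plane}

/-- The surface `A(y) γ(x)` with the horizontal field of phase `exp (2 i α x)` times the initial
phase is a patch of the required kind: `∂ₓ` is `T` by the flow equation, and the condition on `∂_y` at
`x = 0`, which is the differential constraint, is transported by the flow. -/
lemma helixPatch_of_constraint (hκ : 0 < κ) (hτ : 0 < τ) (hlam : lam = 1 ∨ lam = -1)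
    (hν : ν ≠ 0) (hB : helixB τ lam ν < 0) (hJ : IsOpen J)
    (h₁ : ContDiffOn ℝ ∞ ξ₁ J) (h₂ : ContDiffOn ℝ ∞ ξ₂ J) (h₃ : ContDiffOn ℝ ∞ ξ₃ J)
    (hcon : ∀ y ∈ J, Constraint τ lam ν ξ₁ ξ₂ ξ₃ y)
    (hΦ : ∀ z, Φ z = matA ξ (ξ₁ (z 1)) (ξ₂ (z 1)) (ξ₃ (z 1)) *ᵥ helixGamma κ τ lam ν (z 0))
    (hΩ : IsOpen Ω) (hΩJ : ∀ z ∈ Ω, z 1 ∈ J) :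
    HelixPatch (√κ / 2) τ lam ν Ω Φ (fun z => horizontalVector (√κ / 2)
      (cis (2 * (helixAlpha κ τ lam ν * z 0)) * initialPhase lam ν ξ) (Φ z)) := by
  have hr := half_sqrt_pos hκ
  have hrne := hr.ne'
  have hl := lam_sq hlam
  have hα := helixAlpha_add (κ := κ) (ν := ν) hτ hlam
  have hβ := beta_mul_flowConst hκ hν hB
  have hc := normSq_initialPhase hν hB ξ
  have hflow := flowConst_sq hκ hlam hν hB
  have hγ := fun z : Plane => matA_helixGamma (lam := lam) (τ := τ) hκ hν hB ξ (ξ₁ (z 1))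
    (ξ₂ (z 1)) (ξ₃ (z 1)) (z 0)
  have hciff := fun {y} h₁ h₂ h₃ =>
    constraint_iff (κ := κ) (τ := τ) (lam := lam) hκ hν ξ (ξ₁ := ξ₁) (ξ₂ := ξ₂) (ξ₃ := ξ₃) (y := y)
      h₁ h₂ h₃
  simp only [← hΦ] at hγ
  set r := √κ / 2
  set α := helixAlpha κ τ lam ν
  set β := helixBeta κ τ lam ν
  set k := lam * ν * τ * r
  set l := flowConst κ τ lam ν
  set c₀ := initialPhase lam ν ξ
  have hk : l ^ 2 * (r ^ 2 * Complex.normSq c₀ - k ^ 2) = 1 := by rw [hc]; exact hflow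
  let P : ℝ → ℂ := fun y => polarB (ξ₁ y) (ξ₃ y) / r
  let Q : ℝ → ℂ := fun y => omega ξ * conj (polarA (ξ₁ y) (ξ₂ y)) / r
  have hA : ∀ z, zA (Φ z) = transport r α β k l (z 0) c₀ (P (z 1)) (Q (z 1)) := fun z => (hγ z).1
  have hB' : ∀ z, zB (Φ z) = transport r α β k l (z 0) c₀ (Q (z 1)) (P (z 1)) := fun z => (hγ z).2
  have hpB : ContDiffOn ℝ ∞ (fun y => polarB (ξ₁ y) (ξ₃ y)) J :=
    (Complex.ofRealCLM.contDiff.comp_contDiffOn (Real.contDiff_sinh.comp_contDiffOn h₁)).mul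
      (contDiff_cis.comp_contDiffOn h₃)
  have hpA : ContDiffOn ℝ ∞ (fun y => polarA (ξ₁ y) (ξ₂ y)) J :=
    (Complex.ofRealCLM.contDiff.comp_contDiffOn (Real.contDiff_cosh.comp_contDiffOn h₁)).mul
      (contDiff_cis.comp_contDiffOn h₂)
  have hP : ContDiffOn ℝ ∞ P J := hpB.div_const _
  have hQ : ContDiffOn ℝ ∞ Q J :=
    (contDiffOn_const.mul (Complex.conjCLE.contDiff.comp_contDiffOn hpA)).div_const _
  have hx0 : ContDiffOn ℝ ∞ (fun z : Plane => z 0) Ω := by fun_prop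
  have hx1 : ContDiffOn ℝ ∞ (fun z : Plane => z 1) Ω := by fun_prop
  have hAs : ContDiffOn ℝ ∞ (fun z => zA (Φ z)) Ω := by
    simp only [hA]
    exact (contDiff_transport r α β k l c₀).comp_contDiffOn
      (hx0.prodMk ((hP.comp hx1 hΩJ).prodMk (hQ.comp hx1 hΩJ)))
  have hBs : ContDiffOn ℝ ∞ (fun z => zB (Φ z)) Ω := by
    simp only [hB']
    exact (contDiff_transport r α β k l c₀).comp_contDiffOn
      (hx0.prodMk ((hQ.comp hx1 hΩJ).prodMk (hP.comp hx1 hΩJ)))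
  have hΦs : ContDiffOn ℝ ∞ Φ Ω := by
    rw [contDiffOn_pi]
    intro i
    fin_cases i
    · exact Complex.reCLM.contDiff.comp_contDiffOn hAs
    · exact Complex.imCLM.contDiff.comp_contDiffOn hAs
    · exact Complex.reCLM.contDiff.comp_contDiffOn hBs
    · exact Complex.imCLM.contDiff.comp_contDiffOn hBs
  have hquad : ∀ z, r ^ 2 * g0 (Φ z) (Φ z) = -1 := by
    intro z
    have e1 := congrArg Complex.re (hermitian_eq (Φ z) (Φ z))
    rw [Complex.mul_conj, Complex.mul_conj, g0_J1_self, hA, hB'] at e1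
    simp at e1
    have e2 := normSq_polar (ξ₁ (z 1)) (ξ₂ (z 1)) (ξ₃ (z 1))
    rw [← e1, normSq_transport (z 0) hk]
    simp only [P, Q, map_div₀, map_mul, normSq_omega, Complex.normSq_conj, Complex.normSq_ofReal]
    field_simp
    linarith
  let c : Plane → ℂ := fun z => cis (2 * (α * z 0)) * c₀
  let n : Plane → Fin 4 → ℝ := fun z => horizontalVector r (c z) (Φ z)
  have hcs : ContDiffOn ℝ ∞ c Ω :=
    (contDiff_cis.comp_contDiffOn (f := fun z : Plane => 2 * (α * z 0)) (by fun_prop)).mul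
      contDiffOn_const
  have hunit : ∀ z, g0 (n z) (n z) = lam + ν ^ 2 := fun z => by
    rw [g0_horizontalVector_self _ (hquad z), map_mul, normSq_cis, one_mul, hc]
  have hTx : ∀ z ∈ Ω, fderiv ℝ Φ z (EuclideanSpace.single 0 1) =
      horizT r τ lam ν (Φ z) (n z) := by
    intro z hz
    have d := hasDerivAt_line hΩ hΦs hz (EuclideanSpace.single 0 1)
    have hz0 : HasDerivAt (fun t : ℝ => z 0 + t) 1 0 := (hasDerivAt_id 0).const_add (z 0)
    apply ext_zA_zB
    · have d1 := (zA.hasFDerivAt.comp_hasDerivAt (0 : ℝ) d).unique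
        (((hasDerivAt_transport (α := α) hβ (z 0 + 0) hk (P (z 1)) (Q (z 1))).scomp (0 : ℝ)
          hz0).congr_of_eventuallyEq (Filter.Eventually.of_forall fun t => by
            simp [hA]))
      rw [d1, horizT, ← hα, map_sub, map_smul, map_smul, zA_J1, zA_horizontalVector, hA, hB']
      simp [c]
      ring
    · have d1 := (zB.hasFDerivAt.comp_hasDerivAt (0 : ℝ) d).unique
        (((hasDerivAt_transport (α := α) hβ (z 0 + 0) hk (Q (z 1)) (P (z 1))).scomp (0 : ℝ)
          hz0).congr_of_eventuallyEq (Filter.Eventually.of_forall fun t => by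
            simp [hB']))
      rw [d1, horizT, ← hα, map_sub, map_smul, map_smul, zB_J1, zB_horizontalVector, hA, hB']
      simp [c]
      ring
  have hx : ∀ z ∈ Ω,
      g0 (fderiv ℝ Φ z (EuclideanSpace.single 0 1)) (n z - k • (J1 *ᵥ Φ z)) = 0 := by
    intro z hz
    obtain ⟨e1, e2⟩ := g0_horizontalVector r (c z) (Φ z)
    have e3 : g0 (J1 *ᵥ Φ z) (n z) = 0 := by rw [g0_J1_left, e2, neg_zero]
    have e4 : g0 (n z) (J1 *ᵥ Φ z) = 0 := by rw [g0_comm, e3]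
    rw [hTx z hz, horizT]
    simp only [g0_sub_left, g0_sub_right, g0_smul_left, g0_smul_right, g0_J1_J1, e3, e4, hunit]
    have e5 := hquad z
    have e6 : lam * (lam + ν ^ 2) * r / τ * k = (lam + ν ^ 2) * ν * r ^ 2 := by
      have e7 : lam * (lam + ν ^ 2) * r / τ * k = lam ^ 2 * (lam + ν ^ 2) * ν * r ^ 2 * (τ / τ) := by
        simp only [k]; ring
      rw [e7, hl, div_self hτ.ne']; ring
    linear_combination (-g0 (Φ z) (Φ z)) * e6 - ν * (lam + ν ^ 2) * e5
  have hy : ∀ z ∈ Ω,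
      g0 (fderiv ℝ Φ z (EuclideanSpace.single 1 1)) (n z - k • (J1 *ᵥ Φ z)) = 0 := by
    intro z hz
    obtain ⟨e1, e2⟩ := g0_horizontalVector r (c z) (Φ z)
    have hzJ := hΩJ z hz
    have hdiff : ∀ {G : Type} [NormedAddCommGroup G] [NormedSpace ℝ G] {u : ℝ → G},
        ContDiffOn ℝ ∞ u J → DifferentiableAt ℝ u (z 1) := fun hu =>
      (hu.contDiffAt (hJ.mem_nhds hzJ)).differentiableAt (by simp)
    have dP : HasDerivAt P (deriv (fun y => polarB (ξ₁ y) (ξ₃ y)) (z 1) / r) (z 1) :=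
      (hdiff hpB).hasDerivAt.div_const _
    have dQ : HasDerivAt Q
        (omega ξ * conj (deriv (fun y => polarA (ξ₁ y) (ξ₂ y)) (z 1)) / r) (z 1) :=
      ((hdiff hpA).hasDerivAt.star.const_mul _).div_const _
    have d := hasDerivAt_line hΩ hΦs hz (EuclideanSpace.single 1 1)
    have hz1 : HasDerivAt (fun t : ℝ => z 1 + t) 1 0 := (hasDerivAt_id 0).const_add (z 1)
    have hz1' : z 1 + 0 = z 1 := add_zero _
    have d1 := (zA.hasFDerivAt.comp_hasDerivAt (0 : ℝ) d).unique
      ((HasDerivAt.scomp (0 : ℝ) (h := fun t : ℝ => z 1 + t)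
        (by rw [hz1']; exact hasDerivAt_transport_initial (r := r) (α := α) (β := β) (k := k)
              (l := l) (x := z 0) (c := c₀) dP dQ)
        hz1).congr_of_eventuallyEq (Filter.Eventually.of_forall fun t => by simp [hA]))
    have d2 := (zB.hasFDerivAt.comp_hasDerivAt (0 : ℝ) d).unique
      ((HasDerivAt.scomp (0 : ℝ) (h := fun t : ℝ => z 1 + t)
        (by rw [hz1']; exact hasDerivAt_transport_initial (r := r) (α := α) (β := β) (k := k)
              (l := l) (x := z 0) (c := c₀) dQ dP)
        hz1).congr_of_eventuallyEq (Filter.Eventually.of_forall fun t => by simp [hB']))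
    rw [one_smul] at d1 d2
    rw [conormal_eq (hquad z) e1 e2, phase_horizontalVector _ (hquad z), d1, d2, hA, hB',
      conormal_transport (z 0) hk]
    exact (hciff (hdiff h₁) (hdiff h₂) (hdiff h₃)).1 (hcon _ hzJ)
  refine ⟨hΩ, hΦs, ?_, fun z _ => hquad z, fun z _ => (g0_horizontalVector _ _ _).1,
    fun z _ => (g0_horizontalVector _ _ _).2, fun z _ => hunit z, fun z hz v => ?_⟩
  · have hre : ContDiffOn ℝ ∞ (fun z => (c z).re) Ω := Complex.reCLM.contDiff.comp_contDiffOn hcs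
    have him : ContDiffOn ℝ ∞ (fun z => (c z).im) Ω := Complex.imCLM.contDiff.comp_contDiffOn hcs
    have hJ2 : ContDiffOn ℝ ∞ (fun z => J2 *ᵥ Φ z) Ω :=
      (LinearMap.toContinuousLinearMap (Matrix.mulVecLin J2)).contDiff.comp_contDiffOn hΦs
    have hJ3 : ContDiffOn ℝ ∞ (fun z => J3 *ᵥ Φ z) Ω :=
      (LinearMap.toContinuousLinearMap (Matrix.mulVecLin J3)).contDiff.comp_contDiffOn hΦs
    exact ((hre.smul hJ2).add (him.smul hJ3)).const_smul r
  · have hv : v = v 0 • EuclideanSpace.single 0 1 + v 1 • EuclideanSpace.single 1 1 := by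
      ext i; fin_cases i <;> simp
    rw [hv, map_add, map_smul, map_smul, g0_add_left, g0_smul_left, g0_smul_left, hx z hz, hy z hz]
    ring

end

/-- The inclusion of an open set is one of its charts. -/
lemma mfderiv_subtype_val_injective (Ω : TopologicalSpace.Opens Plane) (z : Ω) :
    Function.Injective (mfderiv (𝓡 2) (𝓡 2) (Subtype.val : Ω → Plane) z) :=
  (mdifferentiable_chart (I := 𝓡 2) z).mfderiv_injective (mem_chart_source Plane z)

/-- An immersed patch is a helix surface. -/
lemma HelixPatch.isHelixSurface {κ τ lam ν : ℝ} (hκ : 0 < κ) (hτ : 0 < τ)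
    (hlam : lam = 1 ∨ lam = -1) {Ω : TopologicalSpace.Opens Plane} {f n : Plane → Fin 4 → ℝ}
    (h : HelixPatch (√κ / 2) τ lam ν Ω f n)
    (hi : ∀ z ∈ Ω, Function.Injective (fderiv ℝ f z)) :
    IsHelixSurface κ τ lam ν (fun z : Ω => f z)
      (fun z : Ω => n z - (lam * ν) • E1 κ τ (f z)) := by
  have hsmooth : ∀ {u : Plane → Fin 4 → ℝ}, ContDiffOn ℝ ∞ u (Ω : Set Plane) →
      ContMDiff (𝓡 2) 𝓘(ℝ, Fin 4 → ℝ) ∞ (fun z : Ω => u z) := fun hu z =>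
    contMDiffAt_subtype_iff.2 (contMDiffAt_iff_contDiffAt.2
      (hu.contDiffAt (h.isOpen.mem_nhds z.2)))
  have hder : ∀ z : Ω, mfderiv (𝓡 2) 𝓘(ℝ, Fin 4 → ℝ) (fun z : Ω => f z) z =
      (fderiv ℝ f z).comp (mfderiv (𝓡 2) (𝓡 2) (Subtype.val : Ω → Plane) z) := by
    intro z
    rw [← mfderiv_eq_fderiv]
    exact mfderiv_comp z (h.differentiableAt_f z.2).mdifferentiableAt
      ((contMDiff_subtype_val (n := ∞) z).mdifferentiableAt (by simp))
  have hn : ∀ z : Ω, n z = (n z - (lam * ν) • E1 κ τ (f z)) + (lam * ν) • E1 κ τ (f z) :=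
    fun z => (sub_add_cancel _ _).symm
  have key := fun z : Ω => (AntiDeSitter.normal_iff hτ hlam (h.quadric z z.2) (hn z)).2
    ⟨h.orthogonal z z.2, h.orthogonal_J1 z z.2, h.unit z z.2⟩
  refine ⟨hsmooth h.smooth_f, fun z => (mem_adS_iff hκ _).2 (h.quadric z z.2), fun z => ?_, ?_,
    fun z => (key z).1, fun z v => ?_, fun z => (key z).2.1, fun z => (key z).2.2⟩
  · rw [hder]
    exact (hi z z.2).comp (mfderiv_subtype_val_injective Ω z)
  · exact hsmooth (u := fun z => n z - (lam * ν) • E1 κ τ (f z)) (h.smooth_n.sub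
      ((((contDiffOn_J1 h.smooth_f).const_smul (√κ / 2)).const_smul τ⁻¹).const_smul (lam * ν)))
  · rw [hder]
    exact (gτ_normal hτ (h.quadric z z.2) (hn z) (h.orthogonal_J1 z z.2) _).trans
      (h.tangent z z.2 _)

end AntiDeSitter

theorem theorem6p7 (κ τ lam ν : ℝ) (hκ : 0 < κ) (hτ : 0 < τ) (hlam : lam = 1 ∨ lam = -1)
    (hν : ν ≠ 0) (hB : AntiDeSitter.helixB τ lam ν < 0) :
    (∀ (M : Type*) [TopologicalSpace M] [ChartedSpace (EuclideanSpace ℝ (Fin 2)) M]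
        [IsManifold (𝓡 2) ∞ M] (F N : M → (Fin 4 → ℝ)),
      AntiDeSitter.IsHelixSurface κ τ lam ν F N →
        (∀ p : M, ∃ (e : OpenPartialHomeomorph M (EuclideanSpace ℝ (Fin 2)))
            (a b : EuclideanSpace ℝ (Fin 2) → ℝ),
          p ∈ e.source ∧ AntiDeSitter.IsLocalSystem κ τ ν F N e a b ∧
            AntiDeSitter.HasHelixForm κ τ lam ν F e e.source) ∧
        (∀ (e : OpenPartialHomeomorph M (EuclideanSpace ℝ (Fin 2))) (η : ℝ → ℝ),
          AntiDeSitter.IsLocalSystem κ τ ν F N e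
            (fun z => -(lam * τ / √(-AntiDeSitter.helixB τ lam ν)) *
              Real.sinh (η (z 1) + ν * √(-(κ * AntiDeSitter.helixB τ lam ν)) * z 0))
            (fun z => Real.cosh (η (z 1) + ν * √(-(κ * AntiDeSitter.helixB τ lam ν)) * z 0)) →
          ∀ p ∈ e.source, ∃ V : Set M, IsOpen V ∧ p ∈ V ∧ V ⊆ e.source ∧
            AntiDeSitter.HasHelixForm κ τ lam ν F e V)) ∧
    (∀ (J : Set ℝ) (ξ : ℝ) (ξ₁ ξ₂ ξ₃ : ℝ → ℝ), IsOpen J →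
      ContDiffOn ℝ ∞ ξ₁ J → ContDiffOn ℝ ∞ ξ₂ J → ContDiffOn ℝ ∞ ξ₃ J →
      (∀ y ∈ J, AntiDeSitter.Constraint τ lam ν ξ₁ ξ₂ ξ₃ y) →
      ∀ (Φ : EuclideanSpace ℝ (Fin 2) → (Fin 4 → ℝ)),
      (∀ z, Φ z = AntiDeSitter.matA ξ (ξ₁ (z 1)) (ξ₂ (z 1)) (ξ₃ (z 1)) *ᵥ
        AntiDeSitter.helixGamma κ τ lam ν (z 0)) →
      ∀ Ω : TopologicalSpace.Opens (EuclideanSpace ℝ (Fin 2)),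
        (∀ z ∈ Ω, z 1 ∈ J) →
        (∀ z ∈ Ω, Function.Injective (fderiv ℝ Φ z)) →
        ∃ N : Ω → (Fin 4 → ℝ),
          AntiDeSitter.IsHelixSurface κ τ lam ν (fun z : Ω => Φ z) N) := by
  refine ⟨fun M _ _ _ F N h => ⟨fun p => h.exists_helixForm hκ hτ hlam hν hB p,
    fun e η he p hp => h.helixForm_of_isLocalSystem hκ hτ hlam hν hB he hp⟩, ?_⟩
  intro J ξ ξ₁ ξ₂ ξ₃ hJ h₁ h₂ h₃ hcon Φ hΦ Ω hΩJ hi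
  exact ⟨_, (AntiDeSitter.helixPatch_of_constraint hκ hτ hlam hν hB hJ h₁ h₂ h₃ hcon hΦ Ω.isOpen
    hΩJ).isHelixSurface hκ hτ hlam hi⟩
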